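/- Let $n \ge 1$ and let $q : \mathbb{R}^n_x \times \mathbb{R}^n_\xi \to \mathbb{C}$ be a complex-valued quadratic form which is elliptic, i.e. $q(x,\xi)=0$ only for $(x,\xi)=(0,0)$. Let $$q(x,\xi)^w u(x) = \frac{1}{(2\pi)^n}\int_{\mathbb{R}^{2n}} e^{i(x-y)\cdot\xi}\, q\Big(\frac{x+y}{2},\xi\Big) u(y)\,dy\,d\xi$$ be its Weyl quantization, extended to tempered distributions and considered as an unbounded operator on $L^2(\mathbb{R}^n)$ with domain $$B=\{u \in L^2(\mathbb{R}^n) : x^\alpha D_x^\beta u \in L^2(\mathbb{R}^n) \text{ if } |\alpha+\beta| \le 2\}, \qquad D_x=-i\partial_x,$$ and for $0<h\le 1$ let $q(x,h\xi)^w$ be the operator with domain $B$ defined in the same way by the quadratic form $(x,\xi)\mapsto q(x,h\xi)$. Write $\Sigma(q)=q(\mathbb{R}^n\times\mathbb{R}^n)$, and put $\|(A-z)^{-1}\|=+\infty$ if $z$ belongs to the spectrum of $A$. The semiclassical pseudospectrum of index $\mu \ge 0$ of a family $(P_h)_{0<h\le 1}$ is $$\Lambda^{\mathrm{sc}}_\mu(P_h)=\{z\in\mathbb{C}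 : \forall C>0,\ \forall h_0>0,\ \exists\, 0<h<h_0,\ \|(P_h-z)^{-1}\| \ge C h^{-\mu}\}.$$ Assume that $q(x,\xi)^w$ is not a normal operator and that $\Sigma(q)\neq\mathbb{C}$. Then $$\partial\Sigma(q)\setminus\{0\} \subset \mathbb{C}\setminus \Lambda^{\mathrm{sc}}_1\big(q(x,h\xi)^w\big),$$ and for every $z\in\partial\Sigma(q)\setminus\{0\}$ the line $\mathbb{R}z$ does not meet the spectrum of $q(x,\xi)^w$ and $$\sup_{\eta\in\mathbb{R}} \big\|\big(q(x,\xi)^w-\eta z\big)^{-1}\big\| < +\infty .$$ -/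

import Mathlib

open MeasureTheory SchwartzMap
open scoped ENNReal FourierTransform LineDeriv LinearPMap

noncomputable section

namespace QuadWeyl

/-! ### Unbounded operators on a Hilbert space: normality, resolvent, pseudospectrum -/

section Operators

variable {H : Type*} [NormedAddCommGroup H] [InnerProductSpace ℂ H]

/-- A densely defined closed operator `A` is normal when `A* A = A A*`, as an equality of unbounded
operators (equality of the domains included; the two products are compared through their graphs). -/
def IsNormalOp [CompleteSpace H] (A : H →ₗ.[ℂ] H) : Prop :=
  Dense (A.domain : Set H) ∧ A.IsClosed ∧
    ∀ u w : H, (∃ v, (u, v) ∈ A.graph ∧ (v, w) ∈ A†.graph) ↔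
      (∃ v, (u, v) ∈ A†.graph ∧ (v, w) ∈ A.graph)

/-- `R` is the bounded, everywhere defined, two-sided inverse of `A - z`. -/
def IsResolventAt (A : H →ₗ.[ℂ] H) (z : ℂ) (R : H →L[ℂ] H) : Prop :=
  (∀ u : A.domain, R (A u - z • (u : H)) = u) ∧
    ∀ f : H, ∃ u : A.domain, (u : H) = R f ∧ A u - z • (u : H) = f

/-- The norm `‖(A - z)⁻¹‖`, with the convention that it is `+∞` when `z` is in the spectrum
(there is at most one `R` as in the infimum, and the infimum over the empty set is `∞`). -/
def resolventNorm (A : H →ₗ.[ℂ] H) (z : ℂ) : ℝ≥0∞ :=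
  ⨅ (R : H →L[ℂ] H) (_ : IsResolventAt A z R), ‖R‖ₑ

/-- The semiclassical pseudospectrum of index `μ` of a family `(P h)`, `0 < h ≤ 1`. -/
def scPseudospectrum (μ : ℝ) (P : ℝ → (H →ₗ.[ℂ] H)) : Set ℂ :=
  {z | ∀ C > 0, ∀ h₀ > 0, ∃ h : ℝ, 0 < h ∧ h < h₀ ∧ h ≤ 1 ∧
    ENNReal.ofReal (C * h ^ (-μ)) ≤ resolventNorm (P h) z}

end Operators

/-! ### Quadratic symbols and the space `B` -/

/-- `ℝⁿ` with its Euclidean structure. -/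
abbrev Rn (n : ℕ) : Type := EuclideanSpace ℝ (Fin n)

/-- `L²(ℝⁿ)`, complex-valued. -/
abbrev L2 (n : ℕ) : Type := Lp ℂ 2 (volume : Measure (Rn n))

/-- Complex-valued quadratic forms in `(x, ξ) ∈ ℝⁿ × ℝⁿ`. -/
abbrev Symbol (n : ℕ) : Type := QuadraticMap ℝ (Rn n × Rn n) ℂ

variable {n : ℕ}

/-- Ellipticity: `q` vanishes only at the origin. -/
def IsElliptic (q : Symbol n) : Prop := ∀ X, q X = 0 → X = 0

/-- The numerical range `Σ(q) = q(ℝⁿ × ℝⁿ)`. -/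
def numRange (q : Symbol n) : Set ℂ := Set.range q

/-- The quadratic form `(x, ξ) ↦ q(x, t ξ)`. -/
def scaleXi (q : Symbol n) (t : ℝ) : Symbol n :=
  q.comp (LinearMap.prodMap LinearMap.id (t • LinearMap.id))

/-- The `j`-th vector of the standard basis of `ℝⁿ`. -/
def stdVec (j : Fin n) : Rn n := EuclideanSpace.single j 1

/-- `x^α D_x^β T` for a tempered distribution `T`, where `D_x = -i ∂_x`, the monomials being written
as words: `x^α = x_{a 0} ⋯ x_{a (k-1)}` and `D_x^β = D_{b 0} ⋯ D_{b (l-1)}`, so that `|α| = k` and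
`|β| = l`. -/
def monomialOp {k l : ℕ} (a : Fin k → Fin n) (b : Fin l → Fin n) (T : 𝓢'(Rn n, ℂ)) :
    𝓢'(Rn n, ℂ) :=
  TemperedDistribution.smulLeftCLM ℂ (fun x : Rn n => ∏ i, (x (a i) : ℂ))
    ((-Complex.I) ^ l • ∂^{fun i => stdVec (b i)} T)

/-- `L²(ℝⁿ)` as a subspace of the space of tempered distributions. -/
def l2Dist (n : ℕ) : Submodule ℂ 𝓢'(Rn n, ℂ) :=
  LinearMap.range (Lp.toTemperedDistributionCLM ℂ (volume : Measure (Rn n)) 2).toLinearMap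

/-- The space `B` of all `u ∈ L²(ℝⁿ)` with `x^α D_x^β u ∈ L²(ℝⁿ)` whenever `|α + β| ≤ 2`. -/
def spaceB (n : ℕ) : Submodule ℂ (L2 n) where
  carrier := {u | ∀ k l : ℕ, k + l ≤ 2 → ∀ (a : Fin k → Fin n) (b : Fin l → Fin n),
    monomialOp a b (u : 𝓢'(Rn n, ℂ)) ∈ l2Dist n}
  zero_mem' := by
    intro k l _ a b
    have h : ((0 : L2 n) : 𝓢'(Rn n, ℂ)) = 0 :=
      map_zero (Lp.toTemperedDistributionCLM ℂ (volume : Measure (Rn n)) 2)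
    rw [h, monomialOp, LineDeriv.iteratedLineDerivOp_zero, map_smul, map_zero]
    exact (l2Dist n).smul_mem _ (zero_mem _)
  add_mem' := by
    intro u v hu hv k l hkl a b
    have h : ((u + v : L2 n) : 𝓢'(Rn n, ℂ)) = (u : 𝓢'(Rn n, ℂ)) + (v : 𝓢'(Rn n, ℂ)) :=
      map_add (Lp.toTemperedDistributionCLM ℂ (volume : Measure (Rn n)) 2) u v
    rw [h]
    simpa [monomialOp, LineDeriv.iteratedLineDerivOp_add] using
      add_mem (hu k l hkl a b) (hv k l hkl a b)
  smul_mem' := by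
    intro c u hu k l hkl a b
    have h : ((c • u : L2 n) : 𝓢'(Rn n, ℂ)) = c • (u : 𝓢'(Rn n, ℂ)) :=
      map_smul (Lp.toTemperedDistributionCLM ℂ (volume : Measure (Rn n)) 2) c u
    rw [h]
    have h2 := (l2Dist n).smul_mem c (hu k l hkl a b)
    rw [monomialOp, LineDeriv.iteratedLineDerivOp_smul, smul_comm, map_smul]
    exact h2

/-! ### Weyl quantization -/

/-- The Weyl quantization
`a(x, ξ)^w φ (x) = (2π)⁻ⁿ ∫∫ e^{i (x - y)·ξ} a((x + y)/2, ξ) φ(y) dy dξ`,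
as an iterated integral (`y` first). For a polynomial symbol `a` and a Schwartz function `φ` both
integrals converge absolutely: the inner one is then a Schwartz function of `ξ`. -/
def weylIntegral (a : Rn n × Rn n → ℂ) (φ : Rn n → ℂ) (x : Rn n) : ℂ :=
  ((2 * Real.pi : ℝ) ^ n : ℂ)⁻¹ *
    ∫ ξ : Rn n, ∫ y : Rn n,
      Complex.exp (Complex.I * (inner ℝ (x - y) ξ : ℝ)) * a ((1 / 2 : ℝ) • (x + y), ξ) * φ y

/-- `f = a(x, ξ)^w u` for `u, f ∈ L²(ℝⁿ)`, in the sense of tempered distributions: the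
quantization extends from Schwartz functions to tempered distributions by
`⟨a(x, ξ)^w u, φ⟩ = ⟨u, a(x, -ξ)^w φ⟩`, since `a(x, -ξ)^w` is the transpose of `a(x, ξ)^w`. -/
def IsWeylImage (a : Rn n × Rn n → ℂ) (u f : L2 n) : Prop :=
  ∀ φ : 𝓢(Rn n, ℂ),
    ∫ x, φ x * f x = ∫ x, weylIntegral (fun X => a (X.1, -X.2)) φ x * u x

/-! ### On quadratic symbols the quantization is a differential operator

What follows only serves to show that `a(x, ξ)^w u` exists in `L²(ℝⁿ)` for `u ∈ B`. -/

/-- Multiplication by `x_j` on Schwartz functions. -/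
def mulX (j : Fin n) : 𝓢(Rn n, ℂ) →L[ℂ] 𝓢(Rn n, ℂ) :=
  SchwartzMap.smulLeftCLM ℂ (fun x : Rn n => (x j : ℂ))

/-- `D_j = -i ∂_j` on Schwartz functions. -/
def opD (j : Fin n) : 𝓢(Rn n, ℂ) →L[ℂ] 𝓢(Rn n, ℂ) :=
  (-Complex.I) • LineDeriv.lineDerivOpCLM ℂ 𝓢(Rn n, ℂ) (stdVec j)

theorem coord_growth (j : Fin n) : Function.HasTemperateGrowth (fun x : Rn n => (x j : ℂ)) :=
  (Complex.ofRealCLM.comp (EuclideanSpace.proj (𝕜 := ℝ) j)).hasTemperateGrowth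

@[simp] theorem mulX_apply (j : Fin n) (φ : 𝓢(Rn n, ℂ)) (x : Rn n) :
    mulX j φ x = (x j : ℂ) * φ x := by
  simp [mulX, SchwartzMap.smulLeftCLM_apply_apply (coord_growth j)]

theorem opD_apply (j : Fin n) (φ : 𝓢(Rn n, ℂ)) : opD j φ = (-Complex.I) • ∂_{stdVec j} φ := rfl

/-- The coefficients of a quadratic symbol. -/
def coeffXX (q : Symbol n) (j k : Fin n) : ℂ :=
  (1 / 2) * QuadraticMap.polar q (stdVec j, 0) (stdVec k, 0)
/-- The coefficients of a quadratic symbol. -/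
def coeffXD (q : Symbol n) (j k : Fin n) : ℂ :=
  QuadraticMap.polar q (stdVec j, 0) (0, stdVec k)
/-- The coefficients of a quadratic symbol. -/
def coeffDD (q : Symbol n) (j k : Fin n) : ℂ :=
  (1 / 2) * QuadraticMap.polar q (0, stdVec j) (0, stdVec k)

theorem vec_eq_sum (x : Rn n) : x = ∑ j, x j • stdVec j := by
  ext i
  simp [stdVec, Finset.sum_apply, Pi.single_apply]

theorem symbol_expand (q : Symbol n) (x ξ : Rn n) :
    q (x, ξ) = ∑ j, ∑ k, (coeffXX q j k * (x j * x k) + coeffXD q j k * (x j * ξ k) +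
      coeffDD q j k * (ξ j * ξ k)) := by
  have hb : ∀ x ξ y η : Rn n, q.polarBilin (x, ξ) (y, η) =
      q.polarBilin (x, 0) (y, 0) + q.polarBilin (x, 0) (0, η) +
      q.polarBilin (0, ξ) (y, 0) + q.polarBilin (0, ξ) (0, η) := by
    intro x ξ y η
    have h1 : ((x, ξ) : Rn n × Rn n) = (x, 0) + (0, ξ) := by simp
    have h2 : ((y, η) : Rn n × Rn n) = (y, 0) + (0, η) := by simp
    rw [h1, h2]
    simp only [map_add, LinearMap.add_apply]
    ring
  have hexp : ∀ (f g : Rn n →ₗ[ℝ] Rn n × Rn n) (x y : Rn n), q.polarBilin (f x) (g y) =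
      ∑ j, ∑ k, (x j * y k : ℂ) * QuadraticMap.polar q (f (stdVec j)) (g (stdVec k)) := by
    intro f g x y
    conv_lhs => rw [vec_eq_sum x, vec_eq_sum y]
    simp only [map_sum, map_smul, LinearMap.sum_apply, LinearMap.smul_apply, Finset.smul_sum,
      smul_smul, QuadraticMap.polarBilin_apply_apply]
    rw [Finset.sum_comm]
    refine Finset.sum_congr rfl fun j _ => Finset.sum_congr rfl fun k _ => ?_
    rw [Complex.real_smul]
    push_cast
    ring
  have h0 : (2 : ℂ) * q (x, ξ) = q.polarBilin (x, ξ) (x, ξ) := by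
    rw [QuadraticMap.polarBilin_apply_apply, QuadraticMap.polar_self]
    simp
  have hc : q.polarBilin (0, ξ) (x, 0) = q.polarBilin (x, 0) (0, ξ) := by
    simp only [QuadraticMap.polarBilin_apply_apply]
    exact QuadraticMap.polar_comm _ _ _
  rw [hb, hc] at h0
  have e1 := hexp (LinearMap.inl ℝ _ _) (LinearMap.inl ℝ _ _) x x
  have e2 := hexp (LinearMap.inl ℝ _ _) (LinearMap.inr ℝ _ _) x ξ
  have e3 := hexp (LinearMap.inr ℝ _ _) (LinearMap.inr ℝ _ _) ξ ξ
  simp only [LinearMap.inl_apply, LinearMap.inr_apply] at e1 e2 e3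
  rw [e1, e2, e3] at h0
  have : q (x, ξ) = (1 / 2) * ((2 : ℂ) * q (x, ξ)) := by ring
  rw [this, h0]
  simp only [mul_add, Finset.mul_sum, ← Finset.sum_add_distrib]
  refine Finset.sum_congr rfl fun j _ => Finset.sum_congr rfl fun k _ => ?_
  simp only [coeffXX, coeffXD, coeffDD]
  ring

/-- The inner integral in the definition of the quantization. -/
def innerInt (ψ : Rn n → ℂ) (x ξ : Rn n) : ℂ :=
  ∫ y : Rn n, Complex.exp (Complex.I * (inner ℝ (x - y) ξ : ℝ)) * ψ y

theorem innerInt_eq (ψ : 𝓢(Rn n, ℂ)) (x ξ : Rn n) :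
    innerInt ψ x ξ = Complex.exp (Complex.I * (inner ℝ x ξ : ℝ)) *
      (𝓕 ψ) ((2 * Real.pi)⁻¹ • ξ) := by
  rw [SchwartzMap.fourier_coe, Real.fourier_eq', innerInt, ← integral_const_mul]
  refine integral_congr_ae (Filter.Eventually.of_forall fun y => ?_)
  simp only [smul_eq_mul, inner_sub_left, inner_smul_right]
  rw [← mul_assoc, ← Complex.exp_add]
  congr 2
  push_cast
  have : (Real.pi : ℂ) ≠ 0 := by exact_mod_cast Real.pi_ne_zero
  field_simp
  ring

theorem innerInt_opD (ψ : 𝓢(Rn n, ℂ)) (k : Fin n) (x ξ : Rn n) :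
    innerInt (opD k ψ) x ξ = ξ k * innerInt ψ x ξ := by
  rw [innerInt_eq, innerInt_eq, opD_apply, FourierTransform.fourier_smul,
    SchwartzMap.fourier_lineDerivOp_eq]
  have hg : Function.HasTemperateGrowth (fun y : Rn n => inner ℝ y (stdVec k)) := by fun_prop
  have hi : inner ℝ ξ (stdVec k) = ξ k := by
    simp [stdVec, EuclideanSpace.inner_single_right]
  simp only [smul_apply, SchwartzMap.smulLeftCLM_apply_apply hg, real_inner_smul_left,
    hi, smul_eq_mul, Complex.real_smul]
  have : (Real.pi : ℂ) ≠ 0 := by exact_mod_cast Real.pi_ne_zero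
  generalize (𝓕 ψ) ((2 * Real.pi)⁻¹ • ξ) = c
  push_cast
  field_simp
  linear_combination (-(ξ k : ℂ) * c) * Complex.I_sq

theorem integral_innerInt (ψ : 𝓢(Rn n, ℂ)) (x : Rn n) :
    ((2 * Real.pi : ℝ) ^ n : ℂ)⁻¹ * ∫ ξ, innerInt ψ x ξ = ψ x := by
  have h1 := Measure.integral_comp_smul (volume : Measure (Rn n)) (fun ξ => innerInt ψ x ξ)
    (2 * Real.pi)
  have h2 : ∀ w : Rn n, innerInt ψ x ((2 * Real.pi) • w) =
      Complex.exp ((2 * Real.pi * inner ℝ w x : ℝ) * Complex.I) • (𝓕 ψ) w := by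
    intro w
    rw [innerInt_eq, smul_smul, inv_mul_cancel₀ (by positivity), one_smul, inner_smul_right,
      real_inner_comm, smul_eq_mul, mul_comm Complex.I]
  have h3 : ∫ w : Rn n, innerInt ψ x ((2 * Real.pi) • w) = ψ x := by
    simp_rw [h2]
    rw [← Real.fourierInv_eq' (𝓕 ψ : 𝓢(Rn n, ℂ)) x, ← SchwartzMap.fourierInv_coe]
    simp
  rw [h3] at h1
  rw [h1, finrank_euclideanSpace_fin, abs_of_pos (by positivity), Complex.real_smul]
  push_cast
  ring

/-- The differential operator with Weyl symbol `q`. -/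
def weylS (q : Symbol n) (φ : 𝓢(Rn n, ℂ)) : 𝓢(Rn n, ℂ) :=
  ∑ j, ∑ k, (coeffXX q j k • mulX j (mulX k φ) +
    coeffXD q j k • ((1 / 2 : ℂ) • (mulX j (opD k φ) + opD k (mulX j φ))) +
    coeffDD q j k • opD j (opD k φ))

theorem innerInt_integrable (ψ : 𝓢(Rn n, ℂ)) (x ξ : Rn n) :
    Integrable fun y : Rn n => Complex.exp (Complex.I * (inner ℝ (x - y) ξ : ℝ)) * ψ y := by
  refine (ψ.integrable (μ := volume)).bdd_mul (c := 1) ?_ ?_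
  · exact Continuous.aestronglyMeasurable (by fun_prop)
  · refine Filter.Eventually.of_forall fun y => ?_
    rw [mul_comm, Complex.norm_exp_ofReal_mul_I]

theorem weylIntegral_eq_weylS (q : Symbol n) (φ : 𝓢(Rn n, ℂ)) (x : Rn n) :
    weylIntegral q φ x = weylS q φ x := by
  let M : Fin n → 𝓢(Rn n, ℂ) → 𝓢(Rn n, ℂ) := fun j ψ =>
    (1 / 2 : ℂ) • ((x j : ℂ) • ψ + mulX j ψ)
  have hM : ∀ j ψ y, M j ψ y = ((x j + y j) / 2 : ℂ) * ψ y := by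
    intro j ψ y
    simp [M]
    ring
  let Ψ : 𝓢(Rn n, ℂ) := ∑ j, ∑ k, (coeffXX q j k • M j (M k φ) +
    coeffXD q j k • opD k (M j φ) + coeffDD q j k • opD j (opD k φ))
  have hΨ : Ψ x = weylS q φ x := by
    simp only [Ψ, weylS, sum_apply, add_apply, smul_apply, hM, mulX_apply]
    refine Finset.sum_congr rfl fun j _ => Finset.sum_congr rfl fun k _ => ?_
    simp only [M, map_smul, map_add, add_apply, smul_apply, smul_eq_mul]
    ring
  rw [← hΨ, ← integral_innerInt, weylIntegral]
  congr 1
  refine integral_congr_ae (Filter.Eventually.of_forall fun ξ => ?_)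
  have hadd : ∀ f g : 𝓢(Rn n, ℂ), innerInt (f + g : 𝓢(Rn n, ℂ)) x ξ =
      innerInt f x ξ + innerInt g x ξ := by
    intro f g
    simp only [innerInt, add_apply, mul_add]
    exact integral_add (innerInt_integrable f x ξ) (innerInt_integrable g x ξ)
  have hsmul : ∀ (c : ℂ) (f : 𝓢(Rn n, ℂ)), innerInt (c • f : 𝓢(Rn n, ℂ)) x ξ =
      c * innerInt f x ξ := by
    intro c f
    simp only [innerInt, smul_apply, smul_eq_mul, ← integral_const_mul]
    congr 1
    ext y
    ring
  let L : 𝓢(Rn n, ℂ) →ₗ[ℂ] ℂ :=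
    { toFun := fun f => innerInt f x ξ
      map_add' := hadd
      map_smul' := by intro c f; simpa using hsmul c f }
  let Θ : 𝓢(Rn n, ℂ) := ∑ j, ∑ k, (coeffXX q j k • M j (M k φ) +
    (coeffXD q j k * ξ k) • M j φ + (coeffDD q j k * (ξ j * ξ k)) • φ)
  have hLD : ∀ k f, L (opD k f) = ξ k * L f := fun k f => innerInt_opD f k x ξ
  have hΘ : L Ψ = L Θ := by
    simp only [Ψ, Θ, map_sum, map_add, map_smul, hLD, smul_eq_mul]
    refine Finset.sum_congr rfl fun j _ => Finset.sum_congr rfl fun k _ => ?_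
    ring
  change _ = L Ψ
  rw [hΘ]
  change _ = innerInt Θ x ξ
  refine integral_congr_ae (Filter.Eventually.of_forall fun y => ?_)
  simp only [mul_assoc]
  congr 1
  rw [symbol_expand]
  simp only [Θ, sum_apply, add_apply, smul_apply, hM, Finset.sum_mul, smul_eq_mul]
  refine Finset.sum_congr rfl fun j _ => Finset.sum_congr rfl fun k _ => ?_
  simp
  ring

theorem opD_mulX (j k : Fin n) (φ : 𝓢(Rn n, ℂ)) :
    mulX j (opD k φ) = opD k (mulX j φ) + (if j = k then Complex.I else 0) • φ := by
  ext x
  have h1 : HasFDerivAt (fun y : Rn n => (y j : ℂ))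
      (Complex.ofRealCLM.comp (EuclideanSpace.proj (𝕜 := ℝ) j)) x :=
    (Complex.ofRealCLM.comp (EuclideanSpace.proj (𝕜 := ℝ) j)).hasFDerivAt
  have h2 := h1.mul (φ.hasFDerivAt x)
  have h3 : (mulX j φ : Rn n → ℂ) = (fun y : Rn n => (y j : ℂ)) * φ := by
    ext y
    simp
  simp only [mulX_apply, opD_apply, add_apply, smul_apply,
    SchwartzMap.lineDerivOp_apply_eq_fderiv, h3, h2.fderiv]
  by_cases hjk : j = k
  · subst hjk
    simp [stdVec]
    ring
  · simp [stdVec, hjk]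
    ring

theorem scaleXi_apply (q : Symbol n) (t : ℝ) (x ξ : Rn n) :
    scaleXi q t (x, ξ) = q (x, t • ξ) := rfl

theorem weylIntegral_flip (q : Symbol n) (φ : 𝓢(Rn n, ℂ)) (x : Rn n) :
    weylIntegral (fun X => q (X.1, -X.2)) φ x = weylS (scaleXi q (-1)) φ x := by
  rw [← weylIntegral_eq_weylS]
  congr 1
  funext X
  simp [scaleXi_apply q (-1) X.1 X.2]

theorem isWeylImage_iff (q : Symbol n) (u f : L2 n) :
    IsWeylImage q u f ↔
      ∀ φ, (f : 𝓢'(Rn n, ℂ)) φ = (u : 𝓢'(Rn n, ℂ)) (weylS (scaleXi q (-1)) φ) := by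
  simp only [IsWeylImage, weylIntegral_flip, Lp.toTemperedDistribution_apply, smul_eq_mul]

theorem toDist_injective {f g : L2 n}
    (h : ∀ φ, (f : 𝓢'(Rn n, ℂ)) φ = (g : 𝓢'(Rn n, ℂ)) φ) : f = g := by
  have hk := LinearMap.ker_eq_bot.mp
    (Lp.ker_toTemperedDistributionCLM_eq_bot (F := ℂ) (μ := (volume : Measure (Rn n))) (p := 2))
  apply hk
  ext φ
  exact h φ

theorem exists_isWeylImage (q : Symbol n) {u : L2 n} (hu : u ∈ spaceB n) :
    ∃ f, IsWeylImage q u f := by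
  simp only [isWeylImage_iff]
  set T : 𝓢'(Rn n, ℂ) := (u : 𝓢'(Rn n, ℂ)) with hT
  have hXX : ∀ j k : Fin n, ∃ f : L2 n, ∀ φ, (f : 𝓢'(Rn n, ℂ)) φ = T (mulX j (mulX k φ)) := by
    intro j k
    obtain ⟨f, hf⟩ := hu 2 0 le_rfl ![j, k] ![]
    refine ⟨f, fun φ => ?_⟩
    have h : mulX j (mulX k φ) = SchwartzMap.smulLeftCLM ℂ
        (fun x : Rn n => ∏ i, (x (![j, k] i) : ℂ)) φ := by
      have hg : (fun x : Rn n => ∏ i, (x (![j, k] i) : ℂ)) =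
          (fun x : Rn n => (x j : ℂ)) * (fun x : Rn n => (x k : ℂ)) := by
        ext x
        simp
      rw [hg, ← SchwartzMap.smulLeftCLM_smulLeftCLM_apply (coord_growth j) (coord_growth k)]
      rfl
    refine (DFunLike.congr_fun hf φ).trans ?_
    rw [h]
    simp [monomialOp, hT]
  have hXD : ∀ j k : Fin n, ∃ f : L2 n, ∀ φ, (f : 𝓢'(Rn n, ℂ)) φ = T (opD k (mulX j φ)) := by
    intro j k
    obtain ⟨f, hf⟩ := hu 1 1 le_rfl ![j] ![k]
    refine ⟨-f, fun φ => ?_⟩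
    have h : mulX j φ = SchwartzMap.smulLeftCLM ℂ (fun x : Rn n => ∏ i, (x (![j] i) : ℂ)) φ := by
      simp [mulX]
    have h1 : ((-f : L2 n) : 𝓢'(Rn n, ℂ)) = -(f : 𝓢'(Rn n, ℂ)) :=
      map_neg (Lp.toTemperedDistributionCLM ℂ (volume : Measure (Rn n)) 2) f
    rw [h1, h]
    refine (congrArg Neg.neg (DFunLike.congr_fun hf φ)).trans ?_
    simp [monomialOp, opD_apply, hT, -Lp.toTemperedDistribution_apply]
  have hDD : ∀ j k : Fin n, ∃ f : L2 n, ∀ φ, (f : 𝓢'(Rn n, ℂ)) φ = T (opD j (opD k φ)) := by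
    intro j k
    obtain ⟨f, hf⟩ := hu 0 2 le_rfl ![] ![k, j]
    refine ⟨f, fun φ => ?_⟩
    refine (DFunLike.congr_fun hf φ).trans ?_
    have hI : ∀ a : ℂ, -a = Complex.I * (Complex.I * a) := fun a => by
      rw [← mul_assoc, Complex.I_mul_I, neg_one_mul]
    simp [monomialOp, opD_apply, LineDeriv.iteratedLineDerivOp_succ_left, Fin.tail, hT,
      LineDeriv.lineDerivOp_smul, -Lp.toTemperedDistribution_apply]
    exact hI _
  choose fXX hfXX using hXX
  choose fXD hfXD using hXD
  choose fDD hfDD using hDD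
  let p := scaleXi q (-1)
  refine ⟨∑ j, ∑ k, (coeffXX p j k • fXX j k + coeffXD p j k • (fXD j k +
    (1 / 2 * (if j = k then Complex.I else 0)) • u) + coeffDD p j k • fDD j k), fun φ => ?_⟩
  rw [← Lp.toTemperedDistributionCLM_apply]
  have e1 : ∀ j k, (1 / 2 : ℂ) • (mulX j (opD k φ) + opD k (mulX j φ)) =
      opD k (mulX j φ) + (1 / 2 * (if j = k then Complex.I else 0) : ℂ) • φ := by
    intro j k
    rw [opD_mulX, mul_smul]
    module
  simp only [weylS, e1, map_sum, map_add, map_smul, Lp.toTemperedDistributionCLM_apply]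
  simp only [sum_apply, add_apply, smul_apply, hfXX, hfXD, hfDD]
  rfl

theorem IsWeylImage.unique {q : Symbol n} {u f g : L2 n} (hf : IsWeylImage q u f)
    (hg : IsWeylImage q u g) : f = g :=
  toDist_injective fun φ => (((isWeylImage_iff q u f).mp hf) φ).trans
    (((isWeylImage_iff q u g).mp hg) φ).symm

theorem IsWeylImage.add {q : Symbol n} {u v f g : L2 n} (hf : IsWeylImage q u f)
    (hg : IsWeylImage q v g) : IsWeylImage q (u + v) (f + g) := by
  rw [isWeylImage_iff] at *
  intro φ
  have h : ∀ a b : L2 n, ((a + b : L2 n) : 𝓢'(Rn n, ℂ)) = (a : 𝓢'(Rn n, ℂ)) + (b : 𝓢'(Rn n, ℂ)) :=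
    map_add (Lp.toTemperedDistributionCLM ℂ (volume : Measure (Rn n)) 2)
  rw [h, h, add_apply, add_apply, hf φ, hg φ]

theorem IsWeylImage.smul {q : Symbol n} {u f : L2 n} (c : ℂ) (hf : IsWeylImage q u f) :
    IsWeylImage q (c • u) (c • f) := by
  rw [isWeylImage_iff] at *
  intro φ
  have h : ∀ a : L2 n, ((c • a : L2 n) : 𝓢'(Rn n, ℂ)) = c • (a : 𝓢'(Rn n, ℂ)) :=
    map_smul (Lp.toTemperedDistributionCLM ℂ (volume : Measure (Rn n)) 2) c
  rw [h, h, smul_apply, smul_apply, hf φ]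

/-- The operator `q(x, ξ)^w : B → L²(ℝⁿ)` of a complex-valued quadratic form `q`, as an unbounded
operator on `L²(ℝⁿ)` with domain `B`. -/
def weylOp (q : Symbol n) : L2 n →ₗ.[ℂ] L2 n where
  domain := spaceB n
  toFun :=
    { toFun := fun u => (exists_isWeylImage q u.2).choose
      map_add' := fun u v => (exists_isWeylImage q (u + v).2).choose_spec.unique
        ((exists_isWeylImage q u.2).choose_spec.add (exists_isWeylImage q v.2).choose_spec)
      map_smul' := fun c u => (exists_isWeylImage q (c • u).2).choose_spec.unique
        ((exists_isWeylImage q u.2).choose_spec.smul c) }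

theorem weylOp_isWeylImage (q : Symbol n) (u : (weylOp q).domain) :
    IsWeylImage q u (weylOp q u) :=
  (exists_isWeylImage q u.2).choose_spec

/-- The semiclassical family `h ↦ q(x, h ξ)^w`. -/
def scFamily (q : Symbol n) (h : ℝ) : L2 n →ₗ.[ℂ] L2 n := weylOp (scaleXi q h)

end QuadWeyl

end

/-! Ellipticity makes the range of `q` a closed cone, and at a boundary point `z ≠ 0` the line `ℝz`
supports it: for a suitable sign, `p = ±(i/z)q` has nonnegative real part, and `ℝz` becomes the
imaginary axis (`exists_support`). If `Re p` vanished identically, `q` would be a complex multiple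
of a definite real form and its quantization would be normal (`isNormalOp_weylOp`). Hence `Re p` is
not zero.

The analytic core is a lower bound for `p^w - iη` on Schwartz functions, uniform in real `η`
(`exists_lower_bound`). Write `p^w = ∑ L_j² + iB`, with `L_j` quantized real linear forms and `B`
symmetric. If `(p^w - iη)u` is small compared with `u`, the real part of its pairing with `u` makes
every `L_j u` small, so `u` is almost fixed by the Weyl unitaries `exp(i r L_j)`. It is also almost
fixed by the unitaries transported along the Hamilton flow of `Im p`: the derivative of `⟨u,
W(Y(t))u⟩` is a commutator with `B - η`, in which `η` cancels, and `i(B - η)u` can be replaced by a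
small term minus `∑ L_j² u` (`norm_deriv_le`). Ellipticity provides an `L_j` and a transported `L_k`
with nonzero symplectic product (`exists_noncomm`). After rescaling one of them, the two unitaries
anticommute, and two anticommuting unitaries cannot both almost fix `u`.

A lower bound on Schwartz functions is not yet a resolvent on `B`. Let `H` be the harmonic
oscillator. Completeness of the Hermite functions gives `H` dense range, so `H⁻¹` extends boundedly
to `L²`, with range exactly `B`, and `q^w H⁻¹` extends to a bounded operator (`weylInv`). Some
rotation of `q` has positive definite real part (`exists_rotation`); a priori estimates and a
homotopy from `H` make `weylInv q` invertible, and a second homotopy along the segment from `0` to a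
point of `ℝz` preserves this. The resolvent is `H⁻¹ (q^w H⁻¹ - ζH⁻¹)⁻¹`, bounded by the inverse of
the lower bound (`resolventNorm_le`). Dilations turn `q(x, hξ)^w` into `h q^w`, which gives the
bound of order `h⁻¹`. -/

open MeasureTheory SchwartzMap
open scoped ENNReal FourierTransform LineDeriv LinearPMap

noncomputable section

namespace QuadWeyl

variable {n : ℕ}

/-! ### Position and momentum operators on Schwartz functions -/

/-- Indices of the `2n` phase space coordinates, positions first. -/
abbrev Idx (n : ℕ) : Type := Fin n ⊕ Fin n

/-- The position and momentum operators. -/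
def gen : Idx n → 𝓢(Rn n, ℂ) →L[ℂ] 𝓢(Rn n, ℂ) := Sum.elim mulX opD

/-- The standard symplectic matrix. -/
def sympJ : Matrix (Idx n) (Idx n) ℝ := Matrix.fromBlocks 0 1 (-1) 0

/-- The standard basis of phase space. -/
def phaseVec : Idx n → Rn n × Rn n := Sum.elim (fun j => (stdVec j, 0)) (fun j => (0, stdVec j))

/-- The inclusion of Schwartz functions in `L²`. -/
def incl : 𝓢(Rn n, ℂ) →L[ℂ] L2 n := toLpCLM ℂ ℂ 2 volume

theorem inner_incl (φ ψ : 𝓢(Rn n, ℂ)) :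
    inner ℂ (incl φ) (incl ψ) = ∫ x, (starRingEnd ℂ) (φ x) * ψ x := by
  refine (inner_toL2_toL2_eq φ ψ).trans ?_
  simp [mul_comm]

theorem denseRange_incl : DenseRange (incl (n := n)) :=
  denseRange_toLpCLM (F := ℂ) (p := 2) (by simp)

/-- The canonical commutation relations. All later commutator computations use only these, so
positions and momenta need not be separated again. -/
theorem gen_comm (i k : Idx n) (φ : 𝓢(Rn n, ℂ)) :
    gen i (gen k φ) = gen k (gen i φ) + (Complex.I * (sympJ i k : ℂ)) • φ := by
  rcases i with i | i <;> rcases k with k | k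
  · ext x
    simp [gen, sympJ]
    ring
  · simp only [gen, Sum.elim_inl, Sum.elim_inr, sympJ, Matrix.fromBlocks_apply₁₂, Matrix.one_apply]
    rw [opD_mulX]
    split_ifs <;> simp
  · simp only [gen, Sum.elim_inl, Sum.elim_inr, sympJ, Matrix.fromBlocks_apply₂₁, Matrix.neg_apply,
      Matrix.one_apply]
    rw [opD_mulX]
    by_cases h : i = k
    · subst h
      simp
    · simp [h, Ne.symm h]
  -- Two momenta commute by symmetry of the second derivative.
  · simp only [gen, Sum.elim_inr, sympJ, Matrix.fromBlocks_apply₂₂, Matrix.zero_apply]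
    simp only [opD_apply, Complex.ofReal_zero, mul_zero, zero_smul, add_zero,
      LineDeriv.lineDerivOp_smul]
    congr 2
    ext x
    simp only [SchwartzMap.lineDerivOp_apply_eq_fderiv]
    have h1 : ∀ v : Rn n, (∂_{v} φ : 𝓢(Rn n, ℂ)) = fun y : Rn n => fderiv ℝ φ y v := fun v => by
      ext y
      exact SchwartzMap.lineDerivOp_apply_eq_fderiv v φ y
    have h2 : DifferentiableAt ℝ (fderiv ℝ φ) x :=
      ((φ.smooth 2).fderiv_right (m := 1) (by norm_num)).differentiable (by norm_num) x
    have h3 : ∀ v w : Rn n, fderiv ℝ (fun y : Rn n => fderiv ℝ φ y v) x w =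
        fderiv ℝ (fderiv ℝ φ) x w v := fun v w => by
      rw [fderiv_clm_apply h2 (differentiableAt_const v)]
      simp
    rw [h1, h1, h3, h3]
    exact ((φ.smooth 2).contDiffAt.isSymmSndFDerivAt (by simp)) _ _

theorem integral_opD_mul (j : Fin n) (φ ψ : 𝓢(Rn n, ℂ)) :
    ∫ x, opD j φ x * ψ x = -∫ x, φ x * opD j ψ x := by
  have h := integral_mul_lineDerivOp_right_eq_neg_left (μ := volume) φ ψ (stdVec j)
  simp only [opD_apply, smul_apply, smul_eq_mul, mul_assoc, mul_left_comm _ (-Complex.I),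
    integral_const_mul]
  rw [h]
  ring

theorem inner_gen (i : Idx n) (φ ψ : 𝓢(Rn n, ℂ)) :
    inner ℂ (incl (gen i φ)) (incl ψ) = inner ℂ (incl φ) (incl (gen i ψ)) := by
  rw [inner_incl, inner_incl]
  rcases i with j | j
  · congr 1
    ext x
    simp [gen]
    ring
  -- Conjugation in the first factor is only real-bilinear, so the integration by parts is done with
  -- a real bilinear map.
  · let L : ℂ →L[ℝ] ℂ →L[ℝ] ℂ := (ContinuousLinearMap.mul ℝ ℂ).comp Complex.conjCLE.toContinuousLinearMap
    have h := integral_bilinear_lineDerivOp_right_eq_neg_left (μ := volume) φ ψ L (stdVec j)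
    simp only [L, ContinuousLinearMap.comp_apply, ContinuousLinearMap.mul_apply',
      ContinuousLinearEquiv.coe_coe, Complex.conjCLE_apply] at h
    simp only [gen, Sum.elim_inr, opD_apply, smul_apply, smul_eq_mul, map_mul, map_neg,
      Complex.conj_I, neg_neg, mul_assoc, mul_left_comm _ (-Complex.I), integral_const_mul]
    rw [h]
    ring

/-! ### Quadratic operators -/

/-- The operator `∑ M i k ℓ_i ℓ_k`. -/
def quadOp (M : Matrix (Idx n) (Idx n) ℂ) : 𝓢(Rn n, ℂ) →L[ℂ] 𝓢(Rn n, ℂ) :=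
  ∑ i, ∑ k, M i k • (gen i).comp (gen k)

theorem quadOp_apply (M : Matrix (Idx n) (Idx n) ℂ) (φ : 𝓢(Rn n, ℂ)) :
    quadOp M φ = ∑ i, ∑ k, M i k • gen i (gen k φ) := by
  simp [quadOp]

/-- The symmetric matrix of a quadratic symbol. -/
def symMat (q : Symbol n) : Matrix (Idx n) (Idx n) ℂ :=
  Matrix.of fun i k => (1 / 2) * QuadraticMap.polar q (phaseVec i) (phaseVec k)

theorem symMat_comm (q : Symbol n) (i k : Idx n) : symMat q i k = symMat q k i := by
  simp [symMat, QuadraticMap.polar_comm]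

/-- The symmetrized ordering of `x D` terms is exactly what the symmetric matrix produces, so there
is no lower-order correction. -/
theorem weylS_eq_quadOp (q : Symbol n) (φ : 𝓢(Rn n, ℂ)) : weylS q φ = quadOp (symMat q) φ := by
  rw [quadOp_apply]
  simp only [Fintype.sum_sum_type, gen, Sum.elim_inl, Sum.elim_inr, weylS, Finset.sum_add_distrib]
  have h : ∑ i : Fin n, ∑ k : Fin n, symMat q (Sum.inr i) (Sum.inl k) • opD i (mulX k φ) =
      ∑ i : Fin n, ∑ k : Fin n, symMat q (Sum.inl i) (Sum.inr k) • opD k (mulX i φ) := by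
    rw [Finset.sum_comm]
    simp only [symMat_comm q (Sum.inr _) (Sum.inl _)]
  rw [h]
  have h2 : ∑ j : Fin n, ∑ k : Fin n,
      coeffXD q j k • (1 / 2 : ℂ) • (mulX j (opD k φ) + opD k (mulX j φ)) =
      ∑ i : Fin n, ∑ k : Fin n, symMat q (Sum.inl i) (Sum.inr k) • mulX i (opD k φ) +
      ∑ i : Fin n, ∑ k : Fin n, symMat q (Sum.inl i) (Sum.inr k) • opD k (mulX i φ) := by
    simp only [← Finset.sum_add_distrib, ← smul_add]
    refine Finset.sum_congr rfl fun j _ => Finset.sum_congr rfl fun k _ => ?_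
    rw [smul_smul]
    congr 1
    simp [symMat, coeffXD, phaseVec]
    ring
  rw [h2]
  simp only [symMat, coeffXX, coeffDD, phaseVec, Matrix.of_apply, Sum.elim_inl, Sum.elim_inr]
  abel

/-- The phase space point with given coordinates. -/
def phasePt (Y : Idx n → ℝ) : Rn n × Rn n := ∑ i, Y i • phaseVec i

theorem phasePt_fst (Y : Idx n → ℝ) (j : Fin n) : (phasePt Y).1 j = Y (Sum.inl j) := by
  simp [phasePt, phaseVec, Prod.fst_sum, stdVec, Pi.single_apply]

theorem phasePt_snd (Y : Idx n → ℝ) (j : Fin n) : (phasePt Y).2 j = Y (Sum.inr j) := by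
  simp [phasePt, phaseVec, Prod.snd_sum, stdVec, Pi.single_apply]

theorem exists_phasePt (X : Rn n × Rn n) : ∃ Y, phasePt Y = X := by
  refine ⟨Sum.elim (fun j => X.1 j) (fun j => X.2 j), ?_⟩
  ext j <;> simp [phasePt_fst, phasePt_snd]

theorem phasePt_eq_zero {Y : Idx n → ℝ} (h : phasePt Y = 0) : Y = 0 := by
  ext (j | j)
  · rw [← phasePt_fst Y j, h]; rfl
  · rw [← phasePt_snd Y j, h]; rfl

theorem symbol_phasePt (q : Symbol n) (Y : Idx n → ℝ) :
    q (phasePt Y) = ∑ i, ∑ k, symMat q i k * (Y i * Y k : ℝ) := by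
  have h0 : (2 : ℂ) * q (phasePt Y) = q.polarBilin (phasePt Y) (phasePt Y) := by
    rw [QuadraticMap.polarBilin_apply_apply, QuadraticMap.polar_self]
    simp
  have h1 : q.polarBilin (phasePt Y) (phasePt Y) = ∑ i, ∑ k, 2 * (symMat q i k * (Y i * Y k : ℝ)) := by
    simp only [phasePt, map_sum, map_smul, LinearMap.sum_apply, LinearMap.smul_apply,
      QuadraticMap.polarBilin_apply_apply, symMat, Matrix.of_apply, Finset.smul_sum]
    rw [Finset.sum_comm]
    refine Finset.sum_congr rfl fun j _ => Finset.sum_congr rfl fun k _ => ?_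
    simp only [Complex.real_smul]
    push_cast
    ring
  simp only [h1, ← Finset.mul_sum] at h0
  exact mul_left_cancel₀ two_ne_zero h0

theorem continuous_symbol (q : Symbol n) : Continuous q := by
  have h : (q : Rn n × Rn n → ℂ) = fun X => q (X.1, X.2) := rfl
  rw [h]
  simp only [symbol_expand]
  fun_prop

theorem symMat_add (p q : Symbol n) : symMat (p + q) = symMat p + symMat q := by
  ext i k
  simp [symMat, QuadraticMap.polar_add, mul_add]

theorem symMat_smul (c : ℂ) (q : Symbol n) : symMat (c • q) = c • symMat q := by
  ext i k
  simp [symMat, QuadraticMap.polar_smul]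
  ring

theorem weylS_add (p q : Symbol n) (φ : 𝓢(Rn n, ℂ)) :
    weylS (p + q) φ = weylS p φ + weylS q φ := by
  simp [weylS_eq_quadOp, quadOp_apply, symMat_add, add_smul, Finset.sum_add_distrib]

theorem weylS_smul (c : ℂ) (q : Symbol n) (φ : 𝓢(Rn n, ℂ)) :
    weylS (c • q) φ = c • weylS q φ := by
  simp [weylS_eq_quadOp, quadOp_apply, symMat_smul, mul_smul, Finset.smul_sum]

/-! ### Linear operators -/

/-- The quantization of the linear form with real coefficients `Y`. -/
def linOp (Y : Idx n → ℝ) : 𝓢(Rn n, ℂ) →L[ℂ] 𝓢(Rn n, ℂ) := ∑ i, (Y i : ℂ) • gen i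

theorem linOp_apply (Y : Idx n → ℝ) (φ : 𝓢(Rn n, ℂ)) : linOp Y φ = ∑ i, (Y i : ℂ) • gen i φ := by
  simp [linOp]

theorem linOp_smul (c : ℝ) (Y : Idx n → ℝ) (φ : 𝓢(Rn n, ℂ)) :
    linOp (c • Y) φ = (c : ℂ) • linOp Y φ := by
  simp [linOp_apply, Finset.smul_sum, mul_smul]

/-- The symplectic form. -/
def sympForm (Y Z : Idx n → ℝ) : ℝ := ∑ i, ∑ k, sympJ i k * (Y i * Z k)

theorem sympForm_smul_left (c : ℝ) (Y Z : Idx n → ℝ) : sympForm (c • Y) Z = c * sympForm Y Z := by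
  simp only [sympForm, Finset.mul_sum, Pi.smul_apply, smul_eq_mul]
  refine Finset.sum_congr rfl fun j _ => Finset.sum_congr rfl fun k _ => ?_
  ring

theorem sympForm_smul_right (c : ℝ) (Y Z : Idx n → ℝ) : sympForm Y (c • Z) = c * sympForm Y Z := by
  simp only [sympForm, Finset.mul_sum, Pi.smul_apply, smul_eq_mul]
  refine Finset.sum_congr rfl fun j _ => Finset.sum_congr rfl fun k _ => ?_
  ring

theorem sympForm_eq (Y Z : Idx n → ℝ) : sympForm Y Z =
    ∑ j, (Y (Sum.inl j) * Z (Sum.inr j) - Y (Sum.inr j) * Z (Sum.inl j)) := by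
  rw [Finset.sum_sub_distrib]
  simp [sympForm, Fintype.sum_sum_type, sympJ, Matrix.one_apply, sub_eq_add_neg]

theorem sympForm_self (Y : Idx n → ℝ) : sympForm Y Y = 0 := by
  rw [sympForm_eq]
  exact Finset.sum_eq_zero fun j _ => by ring

theorem inner_linOp (Y : Idx n → ℝ) (φ ψ : 𝓢(Rn n, ℂ)) :
    inner ℂ (incl (linOp Y φ)) (incl ψ) = inner ℂ (incl φ) (incl (linOp Y ψ)) := by
  simp only [linOp_apply, map_sum, map_smul, sum_inner, inner_sum, inner_smul_left, inner_smul_right,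
    inner_gen, Complex.conj_ofReal]

/-- A Gram factorization of a real matrix becomes a sum of squares of symmetric operators, again
without a correction term. -/
theorem quadOp_gram {ι : Type*} [Fintype ι] (S : Matrix ι (Idx n) ℝ) (φ : 𝓢(Rn n, ℂ)) :
    quadOp ((S.transpose * S).map (fun x : ℝ => (x : ℂ))) φ = ∑ j, linOp (S j) (linOp (S j) φ) := by
  simp only [quadOp_apply, linOp_apply, Matrix.map_apply, Matrix.mul_apply, Matrix.transpose_apply,
    map_sum, map_smul, Complex.ofReal_sum, Complex.ofReal_mul, Finset.sum_smul, Finset.smul_sum,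
    smul_smul]
  rw [Finset.sum_comm_cycle]
  refine Finset.sum_congr rfl fun j _ => ?_
  rw [Finset.sum_comm]
  simp only [mul_comm]

theorem norm_linOp_sq (Y : Idx n → ℝ) (φ : 𝓢(Rn n, ℂ)) :
    inner ℂ (incl φ) (incl (linOp Y (linOp Y φ))) = ((‖incl (linOp Y φ)‖ ^ 2 : ℝ) : ℂ) := by
  rw [← inner_linOp, inner_self_eq_norm_sq_to_K]
  simp

/-! ### Linear algebra of quadratic symbols -/

theorem symbol_smul (q : Symbol n) (t : ℝ) (X : Rn n × Rn n) :
    q (t • X) = ((t ^ 2 : ℝ) : ℂ) * q X := by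
  rw [QuadraticMap.map_smul, Complex.real_smul, sq]

theorem symbol_add_smul (q : Symbol n) (X Y : Rn n × Rn n) (s : ℝ) :
    q (X + s • Y) = q X + s * QuadraticMap.polar q X Y + ((s ^ 2 : ℝ) : ℂ) * q Y := by
  have h : QuadraticMap.polar q X (s • Y) = q (X + s • Y) - q X - q (s • Y) := rfl
  rw [QuadraticMap.polar_smul_right, Complex.real_smul, symbol_smul] at h
  linear_combination -h

theorem exists_sqrt_smul (q : Symbol n) {t : ℝ} (ht : 0 ≤ t) {w : ℂ} (hw : w ∈ Set.range q) :
    (t : ℂ) * w ∈ Set.range q := by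
  obtain ⟨X, rfl⟩ := hw
  exact ⟨Real.sqrt t • X, by rw [symbol_smul, Real.sq_sqrt ht]⟩

theorem sphere_reduction {P : Rn n × Rn n → Prop}
    (hP : ∀ (t : ℝ) X, 0 < t → P X → P (t • X)) (h : ∀ X, ‖X‖ = 1 → P X) :
    ∀ X, X ≠ 0 → P X := by
  intro X hX
  have hn : ‖X‖ ≠ 0 := norm_ne_zero_iff.mpr hX
  have h1 := hP ‖X‖ (‖X‖⁻¹ • X) (norm_pos_iff.mpr hX)
    (h _ (by rw [norm_smul, norm_inv, norm_norm, inv_mul_cancel₀ hn]))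
  rwa [smul_smul, mul_inv_cancel₀ hn, one_smul] at h1

/-- A null vector of a nonnegative form lies in its radical: `Re p(Y + tX)` is affine in `t` and
bounded below, so its slope vanishes. -/
theorem re_polar_eq_zero {p : Symbol n} (hre : ∀ X, 0 ≤ (p X).re) {X : Rn n × Rn n}
    (hX : (p X).re = 0) (Y : Rn n × Rn n) : (QuadraticMap.polar p Y X).re = 0 := by
  have h : ∀ t : ℝ, 0 ≤ (p Y).re + t * (QuadraticMap.polar p Y X).re := by
    intro t
    have h1 := hre (Y + t • X)
    rw [symbol_add_smul] at h1
    simpa [-Complex.ofReal_pow, Complex.re_ofReal_mul, hX] using h1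
  by_contra h0
  have h2 := h (-((p Y).re + 1) / (QuadraticMap.polar p Y X).re)
  rw [div_mul_cancel₀ _ h0] at h2
  linarith

/-- The zero set of `Re p` is a linear subspace, so the segment from `X` to `Y` stays in it. The
imaginary part vanishes somewhere on the segment, and ellipticity makes that point the origin. Then
`Y` is a real multiple of `X`, and its imaginary part cannot have the opposite sign. -/
theorem no_opposite_im {p : Symbol n} (hell : IsElliptic p) (hre : ∀ X, 0 ≤ (p X).re)
    {X Y : Rn n × Rn n} (hX : (p X).re = 0) (hY : (p Y).re = 0) (hX1 : 0 < (p X).im)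
    (hY1 : (p Y).im < 0) : False := by
  have hc : ContinuousOn (fun t : ℝ => (p ((1 - t) • X + t • Y)).im) (Set.Icc 0 1) := by
    have := continuous_symbol p
    fun_prop
  have h0 : (0 : ℝ) ∈ Set.Icc (p Y).im (p X).im := ⟨hY1.le, hX1.le⟩
  have h1 := intermediate_value_Icc' (zero_le_one' ℝ) hc
  simp only [sub_self, sub_zero, zero_smul, one_smul, add_zero, zero_add] at h1
  obtain ⟨t, -, ht⟩ := h1 h0
  have h2 : (p ((1 - t) • X + t • Y)).re = 0 := by
    have hx : (p ((1 - t) • X)).re = 0 := by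
      rw [symbol_smul, Complex.re_ofReal_mul, hX, mul_zero]
    rw [symbol_add_smul]
    simp [-Complex.ofReal_pow, hx, re_polar_eq_zero hre hY, hY]
  have h3 := hell _ (Complex.ext h2 ht)
  rcases eq_or_ne t 0 with rfl | ht0
  · simp only [sub_zero, one_smul, zero_smul, add_zero] at h3
    rw [h3, QuadraticMap.map_zero] at hX1
    exact lt_irrefl _ hX1
  · have h4 : Y = (-(1 - t) / t) • X := by
      have h5 : t • Y = (-(1 - t)) • X := by
        rw [neg_smul]; exact eq_neg_of_add_eq_zero_right h3
      rw [div_eq_inv_mul, mul_smul, ← h5, smul_smul, inv_mul_cancel₀ ht0, one_smul]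
    rw [h4, symbol_smul, Complex.im_ofReal_mul] at hY1
    nlinarith [sq_nonneg (-(1 - t) / t)]

/-- An elliptic form with nonnegative real part becomes positive definite after a rotation. -/
theorem exists_rotation {p : Symbol n} (hell : IsElliptic p) (hre : ∀ X, 0 ≤ (p X).re) :
    ∃ M s : ℝ, 0 ≤ M ∧ (s = 1 ∨ s = -1) ∧ ∀ X, X ≠ 0 → 0 < M * (p X).re + s * (p X).im := by
  have hs : ∃ s : ℝ, (s = 1 ∨ s = -1) ∧ ∀ X, X ≠ 0 → (p X).re = 0 → 0 < s * (p X).im := by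
    by_cases hex : ∃ X, (p X).re = 0 ∧ (p X).im < 0
    · obtain ⟨X, hX, hX1⟩ := hex
      refine ⟨-1, Or.inr rfl, fun Y hY0 hY => ?_⟩
      have h1 : (p Y).im ≠ 0 := fun h => hY0 (hell Y (Complex.ext hY h))
      rcases lt_or_gt_of_ne h1 with h2 | h2
      · linarith
      · exact (no_opposite_im hell hre hY hX h2 hX1).elim
    · push Not at hex
      refine ⟨1, Or.inl rfl, fun Y hY0 hY => ?_⟩
      have h1 : (p Y).im ≠ 0 := fun h => hY0 (hell Y (Complex.ext hY h))
      rw [one_mul]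
      exact lt_of_le_of_ne (hex Y hY) h1.symm
  obtain ⟨s, hs1, hs⟩ := hs
  have hcp := continuous_symbol p
  -- Only where `s Im p ≤ 0` is help from `Re p` needed. On this compact set `Re p` has a positive
  -- minimum, and dividing a bound `C + 1` for `|s Im p|` by that minimum gives `M`.
  let T : Set (Rn n × Rn n) := Metric.sphere 0 1 ∩ {X | s * (p X).im ≤ 0}
  have hT : IsCompact T := (isCompact_sphere _ _).inter_right
    (isClosed_le (by fun_prop) continuous_const)
  have hne : ∀ X : Rn n × Rn n, ‖X‖ = 1 → X ≠ 0 := by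
    rintro X hX rfl
    simp at hX
  have key : ∃ M : ℝ, 0 ≤ M ∧ ∀ X, ‖X‖ = 1 → 0 < M * (p X).re + s * (p X).im := by
    rcases T.eq_empty_or_nonempty with hT0 | hT0
    · refine ⟨0, le_rfl, fun X hX => ?_⟩
      by_contra hcon
      have : X ∈ T := ⟨by simpa using hX, by simpa using hcon⟩
      rw [hT0] at this
      exact this
    · obtain ⟨X0, hX0, hmin⟩ := hT.exists_isMinOn hT0
        (f := fun X => (p X).re) (by fun_prop)
      obtain ⟨C, hC⟩ := (isCompact_sphere (0 : Rn n × Rn n) 1).exists_bound_of_continuousOn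
        (f := fun X => s * (p X).im) (by fun_prop)
      have hm : 0 < (p X0).re := by
        refine lt_of_le_of_ne (hre X0) fun h => ?_
        have h1 := hs X0 (hne X0 (by simpa using hX0.1)) h.symm
        exact absurd hX0.2 (not_le.mpr h1)
      have hC0 : 0 ≤ C := (norm_nonneg _).trans (hC X0 hX0.1)
      refine ⟨(C + 1) / (p X0).re, by positivity, fun X hX => ?_⟩
      by_cases hXT : s * (p X).im ≤ 0
      · have h1 : (p X0).re ≤ (p X).re := hmin ⟨by simpa using hX, hXT⟩
        have h2 := hC X (by simpa using hX)
        have h3 : C + 1 ≤ (C + 1) / (p X0).re * (p X).re := by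
          rw [div_mul_eq_mul_div, le_div_iff₀ hm]
          gcongr
        have h4 := neg_le_of_abs_le h2
        linarith
      · have h5 : 0 ≤ (C + 1) / (p X0).re * (p X).re := mul_nonneg (by positivity) (hre X)
        linarith
  obtain ⟨M, hM, hMp⟩ := key
  refine ⟨M, s, hM, hs1, sphere_reduction (fun t X ht h => ?_) hMp⟩
  rw [symbol_smul, Complex.re_ofReal_mul, Complex.im_ofReal_mul]
  nlinarith [pow_pos ht 2]

theorem exists_coercive {p : Symbol n} (hpos : ∀ X, X ≠ 0 → 0 < (p X).re) :
    ∃ c : ℝ, 0 < c ∧ ∀ Y : Idx n → ℝ, c * ∑ i, Y i ^ 2 ≤ (p (phasePt Y)).re := by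
  have hcp := continuous_symbol p
  have hlin : Continuous (phasePt (n := n)) := by
    unfold phasePt
    fun_prop
  rcases (Metric.sphere (0 : Idx n → ℝ) 1).eq_empty_or_nonempty with h0 | h0
  · refine ⟨1, one_pos, fun Y => ?_⟩
    have hY : Y = 0 := by
      by_contra hY
      have : ‖Y‖⁻¹ • Y ∈ Metric.sphere (0 : Idx n → ℝ) 1 := by
        simp [norm_smul, inv_mul_cancel₀ (norm_ne_zero_iff.mpr hY)]
      rw [h0] at this
      exact this
    simp [hY, phasePt]
  obtain ⟨X0, hX0, hmin⟩ := (isCompact_sphere (0 : Idx n → ℝ) 1).exists_isMinOn h0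
    (f := fun Y => (p (phasePt Y)).re) (by fun_prop)
  have hX0' : X0 ≠ 0 := by
    rintro rfl
    simp at hX0
  have hm := hpos (phasePt X0) fun h => hX0' (phasePt_eq_zero h)
  set m := (p (phasePt X0)).re
  set N : ℝ := (Fintype.card (Idx n) : ℝ) + 1
  have hN : 0 < N := by positivity
  refine ⟨m / N, by positivity, fun Y => ?_⟩
  have h1 : ∑ i, Y i ^ 2 ≤ N * ‖Y‖ ^ 2 := by
    have : ∑ i, Y i ^ 2 ≤ ∑ _i : Idx n, ‖Y‖ ^ 2 :=
      Finset.sum_le_sum fun i _ => by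
        rw [← sq_abs (Y i)]
        gcongr
        exact norm_le_pi_norm Y i
    rw [Finset.sum_const, nsmul_eq_mul, Finset.card_univ] at this
    nlinarith [sq_nonneg ‖Y‖]
  have h2 : m * ‖Y‖ ^ 2 ≤ (p (phasePt Y)).re := by
    rcases eq_or_ne Y 0 with rfl | hY
    · simp [phasePt]
    · have hn := norm_ne_zero_iff.mpr hY
      have h3 : m ≤ (p (phasePt (‖Y‖⁻¹ • Y))).re := hmin (by
        simp [norm_smul, inv_mul_cancel₀ hn])
      have h4 : phasePt (‖Y‖⁻¹ • Y) = ‖Y‖⁻¹ • phasePt Y := by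
        simp [phasePt, Finset.smul_sum, mul_smul]
      rw [h4, symbol_smul, Complex.re_ofReal_mul] at h3
      calc m * ‖Y‖ ^ 2 ≤ (‖Y‖⁻¹ ^ 2 * (p (phasePt Y)).re) * ‖Y‖ ^ 2 := by gcongr
        _ = (p (phasePt Y)).re := by field_simp
  calc m / N * ∑ i, Y i ^ 2 ≤ m / N * (N * ‖Y‖ ^ 2) := by gcongr
    _ = m * ‖Y‖ ^ 2 := by field_simp
    _ ≤ _ := h2

open scoped MatrixOrder in
theorem exists_gram (A : Matrix (Idx n) (Idx n) ℝ) (hA : ∀ i k, A i k = A k i)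
    (hpos : ∀ Y : Idx n → ℝ, 0 ≤ ∑ i, ∑ k, A i k * (Y i * Y k)) :
    ∃ S : Matrix (Idx n) (Idx n) ℝ, A = S.transpose * S := by
  have hps : A.PosSemidef := by
    refine Matrix.PosSemidef.of_dotProduct_mulVec_nonneg (by ext i k; simp [hA i k]) fun Y => ?_
    refine (hpos Y).trans_eq ?_
    simp only [dotProduct, Matrix.mulVec, star_trivial, Finset.mul_sum]
    refine Finset.sum_congr rfl fun j _ => Finset.sum_congr rfl fun k _ => ?_
    ring
  obtain ⟨B, hB⟩ := CStarAlgebra.nonneg_iff_eq_star_mul_self.mp hps.nonneg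
  exact ⟨B, by rw [hB, Matrix.star_eq_conjTranspose, Matrix.conjTranspose_eq_transpose_of_trivial]⟩

/-! ### The boundary of the numerical range -/

/-- Ellipticity gives `‖q X‖ ≥ m‖X‖²`, so near any point the range lies in the compact image of a
ball. -/
theorem isClosed_numRange {q : Symbol n} (hell : IsElliptic q) : IsClosed (numRange q) := by
  have hcq := continuous_symbol q
  rcases (Metric.sphere (0 : Rn n × Rn n) 1).eq_empty_or_nonempty with h0 | h0
  · have : ∀ X : Rn n × Rn n, X = 0 := by
      intro X
      by_contra hX
      have : ‖X‖⁻¹ • X ∈ Metric.sphere (0 : Rn n × Rn n) 1 := by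
        rw [mem_sphere_zero_iff_norm, norm_smul, norm_inv, norm_norm,
          inv_mul_cancel₀ (norm_ne_zero_iff.mpr hX)]
      rw [h0] at this
      exact this
    have h2 : numRange q = {0} := by
      ext w
      constructor
      · rintro ⟨X, rfl⟩
        simp [this X]
      · rintro rfl
        exact ⟨0, QuadraticMap.map_zero q⟩
    rw [h2]
    exact isClosed_singleton
  obtain ⟨X0, hX0, hmin⟩ := (isCompact_sphere (0 : Rn n × Rn n) 1).exists_isMinOn h0
    (f := fun X => ‖q X‖) (by fun_prop)
  have hX0' : X0 ≠ 0 := by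
    rintro rfl
    simp at hX0
  have hm : 0 < ‖q X0‖ := norm_pos_iff.mpr fun h => hX0' (hell _ h)
  set m := ‖q X0‖
  have hlow : ∀ X, X ≠ 0 → m * ‖X‖ ^ 2 ≤ ‖q X‖ := by
    refine sphere_reduction (fun t X ht h => ?_) fun X hX => ?_
    · rw [symbol_smul, norm_mul, norm_smul, mul_pow, Complex.norm_real, norm_pow, Real.norm_eq_abs,
        sq_abs]
      nlinarith [pow_pos ht 2]
    · rw [hX, one_pow, mul_one]
      exact hmin (by simpa using hX)
  refine isClosed_of_closure_subset fun z hz => ?_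
  set R := Real.sqrt ((‖z‖ + 1) / m)
  have hK : IsCompact (q '' Metric.closedBall 0 R) :=
    (isCompact_closedBall _ _).image hcq
  have h1 : numRange q ∩ Metric.ball z 1 ⊆ q '' Metric.closedBall 0 R := by
    rintro _ ⟨⟨X, rfl⟩, hX⟩
    refine ⟨X, ?_, rfl⟩
    rw [mem_closedBall_zero_iff]
    rcases eq_or_ne X 0 with rfl | hX0
    · simp [R]
    · refine Real.le_sqrt_of_sq_le ?_
      rw [le_div_iff₀ hm, mul_comm]
      refine (hlow X hX0).trans ?_
      have := norm_sub_norm_le (q X) z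
      rw [Metric.mem_ball, dist_eq_norm] at hX
      linarith
  have h2 : z ∈ closure (numRange q ∩ Metric.ball z 1) := by
    rw [Set.inter_comm]
    exact Metric.isOpen_ball.inter_closure ⟨Metric.mem_ball_self one_pos, hz⟩
  have h3 := closure_minimal h1 hK.isClosed h2
  exact Set.image_subset_range _ _ h3

/-- Moving from `X₀` in the direction `±Y` gives a curve of values starting at `i` whose slope `ε Re
/ Im` goes from `0` to a positive number. By the intermediate value theorem every direction in
between is attained, and homogeneity fills the rays. -/
theorem sector_subset_range {p : Symbol n} {X₀ Y : Rn n × Rn n} (hX₀ : p X₀ = Complex.I)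
    {ε : ℝ} (hε : ε = 1 ∨ ε = -1) (hY : 0 < ε * (p Y).re) :
    ∃ ρ : ℝ, 0 < ρ ∧ ∀ w : ℂ, 0 < w.im → 0 ≤ ε * w.re → ε * w.re ≤ ρ * w.im → w ∈ Set.range p := by
  set β := QuadraticMap.polar p X₀ Y
  obtain ⟨σ, hσ, hσβ⟩ : ∃ σ : ℝ, (σ = 1 ∨ σ = -1) ∧ 0 ≤ σ * (ε * β.re) := by
    rcases le_total 0 (ε * β.re) with h | h
    · exact ⟨1, Or.inl rfl, by linarith⟩
    · exact ⟨-1, Or.inr rfl, by linarith⟩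
  have hσ2 : σ ^ 2 = 1 := by rcases hσ with rfl | rfl <;> norm_num
  let c : ℝ → ℂ := fun s => p (X₀ + (s * σ) • Y)
  have hre : ∀ s, ε * (c s).re = s * (σ * (ε * β.re)) + s ^ 2 * (ε * (p Y).re) := by
    intro s
    simp only [c, symbol_add_smul, hX₀, Complex.add_re, Complex.re_ofReal_mul, Complex.I_re,
      mul_pow, hσ2]
    ring
  have him : ∀ s, (c s).im = 1 + s * (σ * β.im) + s ^ 2 * (p Y).im := by
    intro s
    simp only [c, symbol_add_smul, hX₀, Complex.add_im, Complex.im_ofReal_mul, Complex.I_im,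
      mul_pow, hσ2]
    ring
  -- Small enough that the imaginary part, equal to `1` at `s = 0`, changes by at most `1/2` on `[0,
  -- s₁]`.
  set s₁ : ℝ := 1 / (2 * (1 + |β.im| + |(p Y).im|))
  have hs₁ : 0 < s₁ := by positivity
  have hs₁' : s₁ * (1 + |β.im| + |(p Y).im|) = 1 / 2 := by
    simp only [s₁]
    field_simp
  have hs₁1 : s₁ ≤ 1 := by nlinarith [abs_nonneg β.im, abs_nonneg (p Y).im]
  have hpos : ∀ s ∈ Set.Icc 0 s₁, 0 < (c s).im := by
    rintro s ⟨h0, h1⟩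
    rw [him]
    have e1 : |σ * β.im| = |β.im| := by
      rcases hσ with rfl | rfl <;> simp
    have e2 : -(s * |β.im|) ≤ s * (σ * β.im) := by
      have := neg_abs_le (σ * β.im)
      rw [e1] at this
      nlinarith
    have e3 : -(s * |(p Y).im|) ≤ s ^ 2 * (p Y).im := by
      have e4 := neg_abs_le (p Y).im
      have e5 : s ^ 2 ≤ s := by nlinarith
      nlinarith [abs_nonneg (p Y).im, sq_nonneg s]
    nlinarith [abs_nonneg β.im, abs_nonneg (p Y).im]
  have hc1 : 0 < (c s₁).im := hpos s₁ ⟨hs₁.le, le_rfl⟩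
  have hr1 : 0 < ε * (c s₁).re := by
    rw [hre]
    have := mul_nonneg hs₁.le hσβ
    have := mul_pos (pow_pos hs₁ 2) hY
    linarith
  have hcc : Continuous c := by
    have := continuous_symbol p
    fun_prop
  refine ⟨ε * (c s₁).re / (c s₁).im, by positivity, fun w hw h0 h1 => ?_⟩
  have hg : ContinuousOn (fun s => ε * (c s).re * w.im - ε * w.re * (c s).im) (Set.Icc 0 s₁) := by
    fun_prop
  have hiv := intermediate_value_Icc hs₁.le hg
  have hmem : (0 : ℝ) ∈ Set.Icc (ε * (c 0).re * w.im - ε * w.re * (c 0).im)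
      (ε * (c s₁).re * w.im - ε * w.re * (c s₁).im) := by
    constructor
    · rw [hre, him]
      simpa using h0
    · rw [div_mul_eq_mul_div, le_div_iff₀ hc1] at h1
      linarith
  obtain ⟨s, hs, hs0⟩ := hiv hmem
  have hcs := hpos s hs
  have hε0 : ε ≠ 0 := by rcases hε with rfl | rfl <;> norm_num
  have hcross : (c s).re * w.im = w.re * (c s).im := by
    have : ε * ((c s).re * w.im - w.re * (c s).im) = 0 := by
      simp only at hs0
      linarith
    rcases mul_eq_zero.mp this with h | h
    · exact absurd h hε0
    · linarith
  have hw' : w = ((w.im / (c s).im : ℝ) : ℂ) * c s := by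
    apply Complex.ext
    · rw [Complex.re_ofReal_mul, div_mul_eq_mul_div, eq_div_iff hcs.ne']
      linarith
    · rw [Complex.im_ofReal_mul, div_mul_cancel₀ _ hcs.ne']
  rw [hw']
  exact exists_sqrt_smul p (by positivity) ⟨_, rfl⟩

theorem range_mem_nhds_I {p : Symbol n} {X₀ Y₁ Y₂ : Rn n × Rn n} (hX₀ : p X₀ = Complex.I)
    (h1 : 0 < (p Y₁).re) (h2 : (p Y₂).re < 0) : Set.range p ∈ nhds Complex.I := by
  obtain ⟨ρ₁, hρ₁, H1⟩ := sector_subset_range hX₀ (Or.inl rfl : (1 : ℝ) = 1 ∨ _) (Y := Y₁)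
    (by simpa using h1)
  obtain ⟨ρ₂, hρ₂, H2⟩ := sector_subset_range hX₀ (Or.inr rfl : _ ∨ (-1 : ℝ) = -1) (Y := Y₂)
    (by simpa using h2)
  have hU : IsOpen {w : ℂ | 0 < w.im ∧ w.re < ρ₁ * w.im ∧ -w.re < ρ₂ * w.im} := by
    refine (isOpen_lt continuous_const Complex.continuous_im).inter
      ((isOpen_lt Complex.continuous_re (continuous_const.mul Complex.continuous_im)).inter
      (isOpen_lt Complex.continuous_re.neg (continuous_const.mul Complex.continuous_im)))
  refine Filter.mem_of_superset (hU.mem_nhds ⟨by simp, by simpa using hρ₁, by simpa using hρ₂⟩) ?_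
  rintro w ⟨hw, hw1, hw2⟩
  rcases le_total 0 w.re with h | h
  · exact H1 w hw (by linarith) (by linarith)
  · exact H2 w hw (by linarith) (by linarith)

/-- At a nonzero boundary point of the numerical range the line through the origin supports it. -/
theorem exists_support {q : Symbol n} (hell : IsElliptic q) {z : ℂ}
    (hz : z ∈ frontier (numRange q)) (hz0 : z ≠ 0) :
    ∃ s : ℝ, (s = 1 ∨ s = -1) ∧ ∀ X, 0 ≤ (s * (Complex.I / z) * q X).re := by
  obtain ⟨X₀, hX₀⟩ := (isClosed_numRange hell).closure_subset hz.1
  set p : Symbol n := (Complex.I / z) • q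
  have hp : ∀ X, p X = Complex.I / z * q X := fun X => rfl
  have hpX₀ : p X₀ = Complex.I := by
    rw [hp, hX₀, div_mul_cancel₀ _ hz0]
  by_cases h1 : ∃ Y, 0 < (p Y).re
  · obtain ⟨Y₁, hY₁⟩ := h1
    refine ⟨1, Or.inl rfl, fun X => ?_⟩
    by_contra hX
    have hX' : (p X).re < 0 := by simpa [hp] using hX
    have hn := range_mem_nhds_I hpX₀ hY₁ hX'
    refine hz.2 (mem_interior_iff_mem_nhds.mpr ?_)
    have ht : Filter.Tendsto (fun w : ℂ => Complex.I / z * w) (nhds z) (nhds Complex.I) := by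
      have : Continuous fun w : ℂ => Complex.I / z * w := by fun_prop
      have h := this.tendsto z
      rwa [div_mul_cancel₀ _ hz0] at h
    refine Filter.mem_of_superset (ht hn) ?_
    rintro w ⟨X, hX⟩
    refine ⟨X, ?_⟩
    rw [hp] at hX
    exact mul_left_cancel₀ (div_ne_zero Complex.I_ne_zero hz0) hX
  · push Not at h1
    refine ⟨-1, Or.inr rfl, fun X => ?_⟩
    have := h1 X
    rw [hp] at this
    simpa using this

/-! ### Weyl operators -/

theorem hasTemperateGrowth_expI :
    Function.HasTemperateGrowth (fun t : ℝ => Complex.exp (Complex.I * t)) := by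
  have hd : ∀ k : ℕ, iteratedDeriv k (fun t : ℝ => Complex.exp (Complex.I * t)) =
      fun t : ℝ => Complex.I ^ k * Complex.exp (Complex.I * t) := by
    intro k
    induction k with
    | zero => simp
    | succ k ih =>
      rw [iteratedDeriv_succ, ih]
      ext t
      have h1 : HasDerivAt (fun t : ℝ => Complex.exp (Complex.I * t))
          (Complex.exp (Complex.I * t) * (Complex.I * 1)) t :=
        ((Complex.ofRealCLM.hasDerivAt (x := t)).const_mul Complex.I).cexp
      rw [(h1.const_mul (Complex.I ^ k)).deriv]
      ring
  refine ⟨(contDiff_const.mul Complex.ofRealCLM.contDiff).cexp, fun k => ⟨0, 1, fun t => ?_⟩⟩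
  rw [norm_iteratedFDeriv_eq_norm_iteratedDeriv, hd, norm_mul, norm_pow, Complex.norm_I, one_pow,
    mul_comm Complex.I, Complex.norm_exp_ofReal_mul_I]
  simp

theorem hasTemperateGrowth_expInner (p : Rn n) :
    Function.HasTemperateGrowth (fun x : Rn n => Complex.exp (Complex.I * (inner ℝ p x : ℝ))) :=
  hasTemperateGrowth_expI.comp (Function.hasTemperateGrowth_inner_right p)

/-- The Weyl operator `exp(i L)`, where `L` is the quantization of the linear form `Y`. -/
def weylW (Y : Idx n → ℝ) : 𝓢(Rn n, ℂ) →L[ℂ] 𝓢(Rn n, ℂ) :=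
  Complex.exp (Complex.I * (inner ℝ (phasePt Y).1 (phasePt Y).2 / 2 : ℝ)) •
    (SchwartzMap.smulLeftCLM ℂ fun x : Rn n => Complex.exp (Complex.I * (inner ℝ (phasePt Y).1 x : ℝ))).comp
      (compSubConstCLM ℂ (-(phasePt Y).2))

theorem weylW_apply (Y : Idx n → ℝ) (φ : 𝓢(Rn n, ℂ)) (x : Rn n) :
    weylW Y φ x = Complex.exp (Complex.I *
      (inner ℝ (phasePt Y).1 x + inner ℝ (phasePt Y).1 (phasePt Y).2 / 2 : ℝ)) *
        φ (x + (phasePt Y).2) := by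
  simp only [weylW, smul_apply, ContinuousLinearMap.comp_apply,
    SchwartzMap.smulLeftCLM_apply_apply (hasTemperateGrowth_expInner _), compSubConstCLM_apply,
    smul_eq_mul, sub_neg_eq_add]
  rw [← mul_assoc, ← Complex.exp_add]
  congr 2
  push_cast
  ring

theorem linOp_apply_apply (Y : Idx n → ℝ) (φ : 𝓢(Rn n, ℂ)) (x : Rn n) :
    linOp Y φ x = (inner ℝ (phasePt Y).1 x : ℝ) * φ x - Complex.I * fderiv ℝ φ x (phasePt Y).2 := by
  have h1 : inner ℝ (phasePt Y).1 x = ∑ j, Y (Sum.inl j) * x j := by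
    simp [PiLp.inner_apply, phasePt_fst, mul_comm]
  have h2 : (phasePt Y).2 = ∑ j, Y (Sum.inr j) • stdVec j := by
    rw [vec_eq_sum (phasePt Y).2]
    simp only [phasePt_snd]
  rw [linOp_apply, Fintype.sum_sum_type, h1, h2]
  simp only [gen, Sum.elim_inl, Sum.elim_inr, add_apply, sum_apply, smul_apply, mulX_apply,
    opD_apply, SchwartzMap.lineDerivOp_apply_eq_fderiv, map_sum, map_smul, smul_eq_mul,
    Complex.real_smul, Complex.ofReal_sum, Complex.ofReal_mul, Finset.sum_mul, Finset.mul_sum]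
  rw [sub_eq_add_neg, ← Finset.sum_neg_distrib]
  congr 1
  · exact Finset.sum_congr rfl fun j _ => by ring
  · exact Finset.sum_congr rfl fun j _ => by ring

theorem sympForm_eq_inner (Y Z : Idx n → ℝ) : sympForm Y Z =
    inner ℝ (phasePt Y).1 (phasePt Z).2 - inner ℝ (phasePt Y).2 (phasePt Z).1 := by
  rw [sympForm_eq, Finset.sum_sub_distrib]
  simp [PiLp.inner_apply, phasePt_fst, phasePt_snd, mul_comm]

/-- Conjugation by a Weyl operator translates phase space, hence shifts each linear observable by a
constant. -/
theorem linOp_weylW (Y Z : Idx n → ℝ) (φ : 𝓢(Rn n, ℂ)) :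
    linOp Z (weylW Y φ) = weylW Y (linOp Z φ) + (sympForm Y Z : ℂ) • weylW Y φ := by
  ext x
  set p := (phasePt Y).1 with hp
  set r := (phasePt Y).2 with hr
  have h1 : HasFDerivAt (fun y : Rn n => ((inner ℝ p y + inner ℝ p r / 2 : ℝ) : ℂ))
      (Complex.ofRealCLM.comp (innerSL ℝ p)) x :=
    Complex.ofRealCLM.hasFDerivAt.comp x ((innerSL ℝ p).hasFDerivAt.add_const _)
  have h2 := (h1.const_mul Complex.I).cexp
  have h3 : HasFDerivAt (fun y : Rn n => φ (y + r)) (fderiv ℝ φ (x + r)) x :=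
    (φ.hasFDerivAt (x + r)).comp x ((hasFDerivAt_id x).add_const r)
  have h4 : (weylW Y φ : Rn n → ℂ) = fun y => Complex.exp (Complex.I *
      (inner ℝ p y + inner ℝ p r / 2 : ℝ)) * φ (y + r) := by
    ext y
    exact weylW_apply Y φ y
  simp only [add_apply, smul_apply, linOp_apply_apply, weylW_apply, ← hp, ← hr]
  rw [h4, (h2.fun_mul h3).fderiv, sympForm_eq_inner]
  simp only [add_apply, smul_apply, ContinuousLinearMap.comp_apply, innerSL_apply_apply,
    Complex.ofRealCLM_apply, smul_eq_mul, inner_add_right, ← hp, ← hr, real_inner_comm (phasePt Z).1 r]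
  push_cast
  linear_combination (-Complex.exp (Complex.I *
      (inner ℝ p x + inner ℝ p r / 2)) * (inner ℝ p (phasePt Z).2 : ℝ) * φ (x + r)) * Complex.I_sq

/-- The Weyl form of the commutation relations. When the symplectic product is `π`, the phase is
`-1` and the two unitaries anticommute. -/
theorem weylW_weylW (Y Z : Idx n → ℝ) (φ : 𝓢(Rn n, ℂ)) :
    weylW Y (weylW Z φ) = Complex.exp (-(Complex.I * sympForm Y Z)) • weylW Z (weylW Y φ) := by
  ext x
  simp only [smul_apply, smul_eq_mul, weylW_apply]
  rw [← mul_assoc, ← Complex.exp_add, ← mul_assoc, ← Complex.exp_add, ← mul_assoc,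
    ← Complex.exp_add, add_right_comm x]
  congr 2
  rw [sympForm_eq_inner, inner_add_right, inner_add_right, real_inner_comm (phasePt Z).1]
  push_cast
  ring

theorem inner_weylW (Y : Idx n → ℝ) (φ ψ : 𝓢(Rn n, ℂ)) :
    inner ℂ (incl (weylW Y φ)) (incl (weylW Y ψ)) = inner ℂ (incl φ) (incl ψ) := by
  rw [inner_incl, inner_incl,
    ← integral_add_right_eq_self (fun x => (starRingEnd ℂ) (φ x) * ψ x) (phasePt Y).2]
  congr 1
  ext x
  simp only [weylW_apply, map_mul]
  rw [mul_mul_mul_comm, ← Complex.exp_conj, ← Complex.exp_add]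
  simp only [map_mul, Complex.conj_I, Complex.conj_ofReal]
  simp

theorem norm_weylW (Y : Idx n → ℝ) (φ : 𝓢(Rn n, ℂ)) :
    ‖incl (weylW Y φ)‖ = ‖incl φ‖ := by
  rw [@norm_eq_sqrt_re_inner ℂ, @norm_eq_sqrt_re_inner ℂ, inner_weylW]

theorem weylW_zero (φ : 𝓢(Rn n, ℂ)) : weylW 0 φ = φ := by
  ext x
  simp [weylW_apply, phasePt]

/-- By unitarity `‖Wu - u‖² = 2‖u‖² - 2 Re⟨u, Wu⟩`. Closeness of `Wu` to `u` is thus read off a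
scalar matrix coefficient, which can be differentiated along a curve. -/
theorem norm_weylW_sub_sq (Y : Idx n → ℝ) (φ : 𝓢(Rn n, ℂ)) :
    ‖incl (weylW Y φ) - incl φ‖ ^ 2 ≤
      2 * ‖inner ℂ (incl φ) (incl (weylW Y φ)) - inner ℂ (incl φ) (incl φ)‖ := by
  rw [@norm_sub_sq ℂ, norm_weylW, ← inner_conj_symm, RCLike.conj_re]
  have h := Complex.abs_re_le_norm (inner ℂ (incl φ) (incl (weylW Y φ)) - inner ℂ (incl φ) (incl φ))
  have h2 := neg_abs_le (inner ℂ (incl φ) (incl (weylW Y φ)) - inner ℂ (incl φ) (incl φ)).re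
  rw [Complex.sub_re] at h h2
  have h3 : (inner ℂ (incl φ) (incl φ)).re = ‖incl φ‖ ^ 2 := by
    rw [inner_self_eq_norm_sq_to_K]
    norm_cast
  rw [h3] at h h2
  simp only [RCLike.re_eq_complex_re]
  linarith

/-- Differentiation of a matrix coefficient along a curve of Weyl operators. -/
theorem hasDerivAt_inner_weylW (u : 𝓢(Rn n, ℂ)) {Y Y' : ℝ → Idx n → ℝ}
    (hY : ∀ t, HasDerivAt Y (Y' t) t) (hY' : Continuous Y') (t : ℝ) :
    HasDerivAt (fun s => inner ℂ (incl u) (incl (weylW (Y s) u)))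
      (Complex.I * inner ℂ (incl u) (incl (weylW (Y t)
        (linOp (Y' t) u + ((sympForm (Y t) (Y' t) / 2 : ℝ) : ℂ) • u)))) t := by
  have hYc : Continuous Y := continuous_iff_continuousAt.mpr fun s => (hY s).continuousAt
  let ph : (Idx n → ℝ) →L[ℝ] Rn n × Rn n :=
    LinearMap.toContinuousLinearMap
      (∑ i, (LinearMap.proj i : (Idx n → ℝ) →ₗ[ℝ] ℝ).smulRight (phaseVec i))
  have hph : ∀ Z, ph Z = phasePt Z := fun Z => by simp [ph, phasePt]
  have hpt : ∀ s, HasDerivAt (fun s => phasePt (Y s)) (phasePt (Y' s)) s := fun s => by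
    simp only [← hph]
    exact ph.hasFDerivAt.comp_hasDerivAt s (hY s)
  have hptc : Continuous (phasePt (n := n)) := by
    rw [show phasePt (n := n) = ph from funext fun Z => (hph Z).symm]
    exact ph.continuous
  let v : ℝ → 𝓢(Rn n, ℂ) := fun s => linOp (Y' s) u + ((sympForm (Y s) (Y' s) / 2 : ℝ) : ℂ) • u
  let F : ℝ → Rn n → ℂ := fun s x => (starRingEnd ℂ) (u x) * weylW (Y s) u x
  let F' : ℝ → Rn n → ℂ := fun s x => (starRingEnd ℂ) (u x) * (Complex.I * weylW (Y s) (v s) x)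
  have hderiv : ∀ x s, HasDerivAt (fun s => F s x) (F' s x) s := by
    intro x s
    refine HasDerivAt.const_mul _ ?_
    have e1 : HasDerivAt (fun s => (phasePt (Y s)).1) (phasePt (Y' s)).1 s := (hpt s).fst
    have e2 : HasDerivAt (fun s => (phasePt (Y s)).2) (phasePt (Y' s)).2 s := (hpt s).snd
    have e3 := (e1.inner ℝ (hasDerivAt_const s x)).fun_add ((e1.inner ℝ e2).div_const 2)
    have e4 := (e3.ofReal_comp.const_mul Complex.I).cexp
    have e5 : HasDerivAt (fun s => u (x + (phasePt (Y s)).2))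
        (fderiv ℝ u (x + (phasePt (Y s)).2) (phasePt (Y' s)).2) s :=
      (u.hasFDerivAt _).comp_hasDerivAt s (e2.const_add x)
    have e6 := e4.mul e5
    have e7 : (fun s => weylW (Y s) u x) = fun s => Complex.exp (Complex.I *
      (inner ℝ (phasePt (Y s)).1 x + inner ℝ (phasePt (Y s)).1 (phasePt (Y s)).2 / 2 : ℝ)) *
        u (x + (phasePt (Y s)).2) := funext fun s => weylW_apply _ _ _
    rw [e7]
    refine e6.congr_deriv ?_
    simp only [v, weylW_apply, add_apply, smul_apply, linOp_apply_apply, sympForm_eq_inner,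
      smul_eq_mul, inner_add_right, inner_zero_right]
    rw [real_inner_comm (phasePt (Y' s)).1 (phasePt (Y s)).2]
    push_cast
    linear_combination (Complex.exp (Complex.I * (inner ℝ (phasePt (Y s)).1 x +
      inner ℝ (phasePt (Y s)).1 (phasePt (Y s)).2 / 2)) *
        fderiv ℝ u (x + (phasePt (Y s)).2) (phasePt (Y' s)).2) * Complex.I_sq
  -- Uniform control for `s` near `t`: the moving factor is bounded by Schwartz seminorms of `u` and
  -- the size `R` of the curve, while the fixed factor `u x` supplies integrability.
  obtain ⟨R, hR⟩ : ∃ R : ℝ, ∀ s ∈ Metric.closedBall t 1,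
      ‖phasePt (Y s)‖ ≤ R ∧ ‖phasePt (Y' s)‖ ≤ R := by
    obtain ⟨R₁, h₁⟩ := (isCompact_closedBall t 1).exists_bound_of_continuousOn
      (hptc.comp hYc).continuousOn
    obtain ⟨R₂, h₂⟩ := (isCompact_closedBall t 1).exists_bound_of_continuousOn
      (hptc.comp hY').continuousOn
    exact ⟨max R₁ R₂, fun s hs => ⟨(h₁ s hs).trans (le_max_left _ _),
      (h₂ s hs).trans (le_max_right _ _)⟩⟩
  have hR0 : 0 ≤ R := (norm_nonneg _).trans (hR t (Metric.mem_closedBall_self zero_le_one)).1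
  set C₀ := SchwartzMap.seminorm ℝ 0 0 u
  set C₁ := SchwartzMap.seminorm ℝ 1 0 u
  set C₂ := SchwartzMap.seminorm ℝ 0 1 u
  have b0 : ∀ y, ‖u y‖ ≤ C₀ := fun y => by simpa using SchwartzMap.le_seminorm ℝ 0 0 u y
  have b1 : ∀ y, ‖y‖ * ‖u y‖ ≤ C₁ := fun y => by simpa using SchwartzMap.le_seminorm ℝ 1 0 u y
  have b2 : ∀ y, ‖fderiv ℝ u y‖ ≤ C₂ := fun y => by
    simpa [norm_iteratedFDeriv_one] using SchwartzMap.le_seminorm ℝ 0 1 u y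
  have hv : ∀ s ∈ Metric.ball t 1, ∀ y, ‖v s y‖ ≤ R * C₁ + C₂ * R + R * R * C₀ := by
    intro s hs y
    obtain ⟨hR1, hR2⟩ := hR s (Metric.ball_subset_closedBall hs)
    have hp1 := (norm_fst_le (phasePt (Y s))).trans hR1
    have hp2 := (norm_snd_le (phasePt (Y s))).trans hR1
    have hp3 := (norm_fst_le (phasePt (Y' s))).trans hR2
    have hp4 := (norm_snd_le (phasePt (Y' s))).trans hR2
    simp only [v, add_apply, smul_apply, linOp_apply_apply, smul_eq_mul]
    refine (norm_add_le _ _).trans (add_le_add ((norm_sub_le _ _).trans (add_le_add ?_ ?_)) ?_)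
    · rw [norm_mul, Complex.norm_real]
      calc ‖inner ℝ (phasePt (Y' s)).1 y‖ * ‖u y‖ ≤ (‖(phasePt (Y' s)).1‖ * ‖y‖) * ‖u y‖ := by
            gcongr
            exact norm_inner_le_norm _ _
        _ = ‖(phasePt (Y' s)).1‖ * (‖y‖ * ‖u y‖) := by ring
        _ ≤ R * C₁ := mul_le_mul hp3 (b1 y) (by positivity) hR0
    · rw [norm_mul, Complex.norm_I, one_mul]
      exact ((fderiv ℝ u y).le_opNorm _).trans
        (mul_le_mul (b2 y) hp4 (norm_nonneg _) ((norm_nonneg _).trans (b2 y)))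
    · rw [norm_mul, Complex.norm_real]
      refine mul_le_mul ?_ (b0 y) (norm_nonneg _) (by positivity)
      rw [sympForm_eq_inner, norm_div, Real.norm_ofNat]
      have i1 : ‖inner ℝ (phasePt (Y s)).1 (phasePt (Y' s)).2‖ ≤ R * R :=
        (norm_inner_le_norm _ _).trans (mul_le_mul hp1 hp4 (norm_nonneg _) hR0)
      have i2 : ‖inner ℝ (phasePt (Y s)).2 (phasePt (Y' s)).1‖ ≤ R * R :=
        (norm_inner_le_norm _ _).trans (mul_le_mul hp2 hp3 (norm_nonneg _) hR0)
      have i3 := norm_sub_le (inner ℝ (phasePt (Y s)).1 (phasePt (Y' s)).2)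
        (inner ℝ (phasePt (Y s)).2 (phasePt (Y' s)).1)
      linarith
  have hW : ∀ (Z : Idx n → ℝ) (ψ : 𝓢(Rn n, ℂ)) x, ‖weylW Z ψ x‖ = ‖ψ (x + (phasePt Z).2)‖ := by
    intro Z ψ x
    rw [weylW_apply, norm_mul, mul_comm Complex.I, Complex.norm_exp_ofReal_mul_I, one_mul]
  have hFint : ∀ ψ : 𝓢(Rn n, ℂ), Integrable fun x => (starRingEnd ℂ) (u x) * ψ x := fun ψ => by
    refine (ψ.integrable (μ := volume)).bdd_mul (c := C₀) ?_ (Filter.Eventually.of_forall fun y => ?_)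
    · exact (Complex.continuous_conj.comp u.continuous).aestronglyMeasurable
    · simpa using b0 y
  have main := hasDerivAt_integral_of_dominated_loc_of_deriv_le (μ := volume) (F := F) (F' := F')
    (x₀ := t) (s := Metric.ball t 1)
    (bound := fun x => ‖u x‖ * (R * C₁ + C₂ * R + R * R * C₀)) (Metric.ball_mem_nhds t one_pos)
    (Filter.Eventually.of_forall fun s => (hFint _).aestronglyMeasurable) (hFint _)
    (by
      have := (hFint (Complex.I • weylW (Y t) (v t))).aestronglyMeasurable
      simpa [F'] using this)
    (Filter.Eventually.of_forall fun x s hs => by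
      simp only [F', norm_mul, RCLike.norm_conj, Complex.norm_I, one_mul, hW]
      gcongr
      exact hv s hs _)
    (u.integrable.norm.mul_const _)
    (Filter.Eventually.of_forall fun x s _ => hderiv x s)
  have h := main.2
  simp only [inner_incl]
  refine h.congr_deriv ?_
  rw [← integral_const_mul]
  congr 1
  ext x
  simp only [F', v]
  ring

/-! ### The uniform lower bound on the boundary ray -/

/-- The coordinates of the linear form `Z ↦ sympForm Y Z`. -/
def sigVec (Y : Idx n → ℝ) : Idx n → ℝ := sympJ.transpose.mulVec Y

theorem sympForm_eq_sigVec (Y Z : Idx n → ℝ) : sympForm Y Z = ∑ k, sigVec Y k * Z k := by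
  simp only [sympForm, sigVec, Matrix.mulVec, dotProduct, Matrix.transpose_apply, Finset.sum_mul]
  rw [Finset.sum_comm]
  refine Finset.sum_congr rfl fun j _ => Finset.sum_congr rfl fun k _ => ?_
  ring

theorem sigVec_eq_zero {Y : Idx n → ℝ} (h : sigVec Y = 0) : Y = 0 := by
  have h1 : ∀ Z, sympForm Y Z = 0 := fun Z => by simp [sympForm_eq_sigVec, h]
  ext (j | j)
  · have := h1 (Pi.single (Sum.inr j) 1)
    rw [sympForm_eq] at this
    simpa [Pi.single_apply] using this
  · have := h1 (Pi.single (Sum.inl j) 1)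
    rw [sympForm_eq] at this
    simpa [Pi.single_apply] using this

/-! ### Conjugation by Weyl operators and commutators along the Hamilton flow -/

theorem gen_weylW (Y : Idx n → ℝ) (k : Idx n) (φ : 𝓢(Rn n, ℂ)) :
    gen k (weylW Y φ) = weylW Y (gen k φ + (sigVec Y k : ℂ) • φ) := by
  have h := linOp_weylW Y (Pi.single k 1) φ
  have h1 : ∀ ψ : 𝓢(Rn n, ℂ), linOp (Pi.single k 1) ψ = gen k ψ := fun ψ => by
    rw [linOp_apply, Finset.sum_eq_single k]
    · simp
    · intro i _ hi
      simp [hi]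
    · simp
  have h2 : sympForm Y (Pi.single k 1) = sigVec Y k := by
    rw [sympForm_eq_sigVec, Finset.sum_eq_single k]
    · simp
    · intro i _ hi
      simp [hi]
    · simp
  rw [h1, h1, h2] at h
  rw [h, map_add, map_smul]

/-- The Hamilton vector field of a real quadratic form, acting on linear forms. -/
def hamMap (b : Matrix (Idx n) (Idx n) ℝ) : (Idx n → ℝ) →L[ℝ] (Idx n → ℝ) :=
  LinearMap.toContinuousLinearMap (Matrix.toLin' ((2 : ℝ) • (b * sympJ.transpose)))

theorem hamMap_apply (b : Matrix (Idx n) (Idx n) ℝ) (Y : Idx n → ℝ) (i : Idx n) :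
    hamMap b Y i = 2 * ∑ k, b i k * sigVec Y k := by
  have h : hamMap b Y = (2 : ℝ) • b.mulVec (sigVec Y) := by
    simp [hamMap, sigVec]
  rw [h]
  rfl

theorem sympForm_hamMap (b : Matrix (Idx n) (Idx n) ℝ) (Y : Idx n → ℝ) :
    sympForm Y (hamMap b Y) = 2 * ∑ i, ∑ k, b i k * (sigVec Y i * sigVec Y k) := by
  simp only [sympForm_eq_sigVec, hamMap_apply, Finset.mul_sum]
  refine Finset.sum_congr rfl fun j _ => Finset.sum_congr rfl fun k _ => ?_
  ring

/-- Complexification of a real matrix. -/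
abbrev cpx (b : Matrix (Idx n) (Idx n) ℝ) : Matrix (Idx n) (Idx n) ℂ := b.map (fun x : ℝ => (x : ℂ))

/-- The commutator of `B` with `W(Y)` is `W(Y)` times a linear operator plus a scalar, precisely the
combination in `hasDerivAt_inner_weylW` when `Y' = hamMap b Y`. This makes the Hamilton flow the
right curve. -/
theorem quadOp_weylW {b : Matrix (Idx n) (Idx n) ℝ} (hb : ∀ i k, b i k = b k i) (Y : Idx n → ℝ)
    (φ : 𝓢(Rn n, ℂ)) :
    quadOp (cpx b) (weylW Y φ) = weylW Y (quadOp (cpx b) φ) +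
      weylW Y (linOp (hamMap b Y) φ + ((sympForm Y (hamMap b Y) / 2 : ℝ) : ℂ) • φ) := by
  rw [← map_add]
  have h0 : quadOp (cpx b) (weylW Y φ) = weylW Y (∑ i, ∑ k, (b i k : ℂ) •
      (gen i (gen k φ + (sigVec Y k : ℂ) • φ) + (sigVec Y i : ℂ) • (gen k φ + (sigVec Y k : ℂ) • φ))) := by
    simp only [quadOp_apply, gen_weylW, map_sum, map_smul, Matrix.map_apply]
  rw [h0, quadOp_apply]
  congr 1
  have h1 : linOp (hamMap b Y) φ = ∑ i, ∑ k, ((b i k : ℂ) * sigVec Y k) • gen i φ +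
      ∑ i, ∑ k, ((b i k : ℂ) * sigVec Y i) • gen k φ := by
    rw [Finset.sum_comm (f := fun i k => ((b i k : ℂ) * sigVec Y i) • gen k φ)]
    simp only [← Finset.sum_add_distrib, linOp_apply, hamMap_apply]
    refine Finset.sum_congr rfl fun i _ => ?_
    simp only [Complex.ofReal_mul, Complex.ofReal_sum, Finset.mul_sum, Finset.sum_smul]
    refine Finset.sum_congr rfl fun k _ => ?_
    rw [hb k i, ← add_smul]
    congr 1
    push_cast
    ring
  have h2 : ((sympForm Y (hamMap b Y) / 2 : ℝ) : ℂ) • φ =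
      ∑ i, ∑ k, ((b i k : ℂ) * (sigVec Y i * sigVec Y k)) • φ := by
    rw [sympForm_hamMap, mul_div_cancel_left₀ _ two_ne_zero]
    simp only [Complex.ofReal_sum, Complex.ofReal_mul, Finset.sum_smul]
  rw [h1, h2]
  simp only [← Finset.sum_add_distrib]
  refine Finset.sum_congr rfl fun i _ => Finset.sum_congr rfl fun k _ => ?_
  simp only [map_add, map_smul, Matrix.map_apply]
  module

theorem inner_quadOp {b : Matrix (Idx n) (Idx n) ℝ} (hb : ∀ i k, b i k = b k i)
    (φ ψ : 𝓢(Rn n, ℂ)) :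
    inner ℂ (incl (quadOp (cpx b) φ)) (incl ψ) = inner ℂ (incl φ) (incl (quadOp (cpx b) ψ)) := by
  simp only [quadOp_apply, map_sum, map_smul, sum_inner, inner_sum, inner_smul_left,
    inner_smul_right, inner_gen, Matrix.map_apply, Complex.conj_ofReal]
  rw [Finset.sum_comm]
  simp only [hb]

/-- The operator `A + i (B - η)` for `A` a sum of squares and `B` a real quadratic operator. -/
def dissOp (S b : Matrix (Idx n) (Idx n) ℝ) (η : ℝ) (u : 𝓢(Rn n, ℂ)) : 𝓢(Rn n, ℂ) :=
  ∑ j, linOp (S j) (linOp (S j) u) + Complex.I • (quadOp (cpx b) u - (η : ℂ) • u)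

/-- `B - η` is symmetric, so it drops out of the real part of `⟨u, (A + i(B - η))u⟩`. -/
theorem sum_norm_linOp_sq_le {S b : Matrix (Idx n) (Idx n) ℝ} (hb : ∀ i k, b i k = b k i)
    (η : ℝ) (u : 𝓢(Rn n, ℂ)) :
    ∑ j, ‖incl (linOp (S j) u)‖ ^ 2 ≤ ‖incl u‖ * ‖incl (dissOp S b η u)‖ := by
  have h : (inner ℂ (incl u) (incl (dissOp S b η u))).re = ∑ j, ‖incl (linOp (S j) u)‖ ^ 2 := by
    have h1 : (inner ℂ (incl u) (incl (quadOp (cpx b) u))).im = 0 := by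
      have h2 := inner_quadOp hb u u
      rw [← inner_conj_symm] at h2
      exact Complex.conj_eq_iff_im.mp h2
    have h3 : (inner ℂ (incl u) (incl u)).im = 0 := inner_self_im (𝕜 := ℂ) (incl u)
    simp only [dissOp, map_add, map_sum, map_smul, map_sub, inner_add_right, inner_sum,
      inner_smul_right, inner_sub_right, norm_linOp_sq, Complex.add_re, Complex.re_sum,
      Complex.ofReal_re, Complex.I_mul_re, Complex.sub_im, h1, Complex.im_ofReal_mul, h3]
    simp
  rw [← h]
  exact (Complex.re_le_norm _).trans (norm_inner_le_norm _ _)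

/-- The left side is the norm of `i⟨u, [B - η, W]u⟩`. By symmetry `B - η` lands on `u` in both
terms, and there `i(B - η)u = f - ∑ L_j² u`. The resulting bound contains only `f` and first powers
of the `L_j` on `u`, and depends on `η` only through `f`. -/
theorem norm_deriv_le {S b : Matrix (Idx n) (Idx n) ℝ} (hb : ∀ i k, b i k = b k i)
    (η : ℝ) (u : 𝓢(Rn n, ℂ)) (Y : Idx n → ℝ) :
    ‖Complex.I * inner ℂ (incl u) (incl (weylW Y
      (linOp (hamMap b Y) u + ((sympForm Y (hamMap b Y) / 2 : ℝ) : ℂ) • u)))‖ ≤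
      2 * (‖incl u‖ * ‖incl (dissOp S b η u)‖) + 2 * ∑ j, ‖incl (linOp (S j) u)‖ ^ 2 +
        2 * ∑ j, |sympForm Y (S j)| * (‖incl (linOp (S j) u)‖ * ‖incl u‖) := by
  set f := dissOp S b η u with hf
  have hB : Complex.I • (quadOp (cpx b) u - (η : ℂ) • u) = f - ∑ j, linOp (S j) (linOp (S j) u) := by
    rw [hf, dissOp, add_sub_cancel_left]
  have h1 : weylW Y (linOp (hamMap b Y) u + ((sympForm Y (hamMap b Y) / 2 : ℝ) : ℂ) • u) =
      (quadOp (cpx b) (weylW Y u) - (η : ℂ) • weylW Y u) -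
        weylW Y (quadOp (cpx b) u - (η : ℂ) • u) := by
    rw [quadOp_weylW hb, map_sub, map_smul]
    abel
  have h2 : inner ℂ (incl u) (incl (quadOp (cpx b) (weylW Y u) - (η : ℂ) • weylW Y u)) =
      inner ℂ (incl (quadOp (cpx b) u - (η : ℂ) • u)) (incl (weylW Y u)) := by
    simp only [map_sub, map_smul, inner_sub_left, inner_sub_right, inner_smul_left,
      inner_smul_right, inner_quadOp hb, Complex.conj_ofReal]
  have h3 : Complex.I * inner ℂ (incl u) (incl (weylW Y
      (linOp (hamMap b Y) u + ((sympForm Y (hamMap b Y) / 2 : ℝ) : ℂ) • u))) =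
      -inner ℂ (incl (f - ∑ j, linOp (S j) (linOp (S j) u))) (incl (weylW Y u)) -
        inner ℂ (incl u) (incl (weylW Y (f - ∑ j, linOp (S j) (linOp (S j) u)))) := by
    rw [← hB, h1, map_sub, inner_sub_right, h2]
    simp only [map_smul, inner_smul_left, inner_smul_right, Complex.conj_I]
    ring
  -- One `L_j` of each square is moved across `W` to the other side, at the cost of the scalar
  -- `sympForm Y (S j)`.
  have h4 : ∀ j, inner ℂ (incl (linOp (S j) (linOp (S j) u))) (incl (weylW Y u)) +
      inner ℂ (incl u) (incl (weylW Y (linOp (S j) (linOp (S j) u)))) =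
      inner ℂ (incl (linOp (S j) u)) (incl (weylW Y (linOp (S j) u))) +
      sympForm Y (S j) * inner ℂ (incl (linOp (S j) u)) (incl (weylW Y u)) +
      (inner ℂ (incl (linOp (S j) u)) (incl (weylW Y (linOp (S j) u))) -
      sympForm Y (S j) * inner ℂ (incl u) (incl (weylW Y (linOp (S j) u)))) := by
    intro j
    have e1 : weylW Y (linOp (S j) (linOp (S j) u)) = linOp (S j) (weylW Y (linOp (S j) u)) -
        (sympForm Y (S j) : ℂ) • weylW Y (linOp (S j) u) := by
      rw [linOp_weylW]
      abel
    rw [inner_linOp, linOp_weylW, e1]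
    simp only [map_add, map_sub, map_smul, inner_add_right, inner_sub_right, inner_smul_right,
      ← inner_linOp]
  have h5 : Complex.I * inner ℂ (incl u) (incl (weylW Y
      (linOp (hamMap b Y) u + ((sympForm Y (hamMap b Y) / 2 : ℝ) : ℂ) • u))) =
      -inner ℂ (incl f) (incl (weylW Y u)) - inner ℂ (incl u) (incl (weylW Y f)) +
      ∑ j, (inner ℂ (incl (linOp (S j) u)) (incl (weylW Y (linOp (S j) u))) +
      sympForm Y (S j) * inner ℂ (incl (linOp (S j) u)) (incl (weylW Y u)) +
      (inner ℂ (incl (linOp (S j) u)) (incl (weylW Y (linOp (S j) u))) -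
      sympForm Y (S j) * inner ℂ (incl u) (incl (weylW Y (linOp (S j) u))))) := by
    rw [h3, ← Finset.sum_congr rfl fun j _ => h4 j]
    simp only [map_sub, map_sum, inner_sub_left, inner_sub_right, sum_inner, inner_sum,
      Finset.sum_add_distrib]
    ring
  rw [h5]
  have hin : ∀ φ ψ : 𝓢(Rn n, ℂ), ‖inner ℂ (incl φ) (incl (weylW Y ψ))‖ ≤ ‖incl φ‖ * ‖incl ψ‖ :=
    fun φ ψ => (norm_inner_le_norm _ _).trans_eq (by rw [norm_weylW])
  have hsum : ‖∑ j, (inner ℂ (incl (linOp (S j) u)) (incl (weylW Y (linOp (S j) u))) +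
      sympForm Y (S j) * inner ℂ (incl (linOp (S j) u)) (incl (weylW Y u)) +
      (inner ℂ (incl (linOp (S j) u)) (incl (weylW Y (linOp (S j) u))) -
      sympForm Y (S j) * inner ℂ (incl u) (incl (weylW Y (linOp (S j) u)))))‖ ≤
      2 * ∑ j, ‖incl (linOp (S j) u)‖ ^ 2 +
        2 * ∑ j, |sympForm Y (S j)| * (‖incl (linOp (S j) u)‖ * ‖incl u‖) := by
    rw [Finset.mul_sum, Finset.mul_sum, ← Finset.sum_add_distrib]
    refine norm_sum_le_of_le _ fun j _ => ?_
    have g1 := hin (linOp (S j) u) (linOp (S j) u)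
    have g2 := mul_le_mul_of_nonneg_left (hin (linOp (S j) u) u) (abs_nonneg (sympForm Y (S j)))
    have g3 := mul_le_mul_of_nonneg_left (hin u (linOp (S j) u)) (abs_nonneg (sympForm Y (S j)))
    have g4 := norm_add_le (inner ℂ (incl (linOp (S j) u)) (incl (weylW Y (linOp (S j) u))) +
      sympForm Y (S j) * inner ℂ (incl (linOp (S j) u)) (incl (weylW Y u)))
      (inner ℂ (incl (linOp (S j) u)) (incl (weylW Y (linOp (S j) u))) -
      sympForm Y (S j) * inner ℂ (incl u) (incl (weylW Y (linOp (S j) u))))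
    have g5 := norm_add_le (inner ℂ (incl (linOp (S j) u)) (incl (weylW Y (linOp (S j) u))))
      (sympForm Y (S j) * inner ℂ (incl (linOp (S j) u)) (incl (weylW Y u)))
    have g6 := norm_sub_le (inner ℂ (incl (linOp (S j) u)) (incl (weylW Y (linOp (S j) u))))
      (sympForm Y (S j) * inner ℂ (incl u) (incl (weylW Y (linOp (S j) u))))
    rw [norm_mul, Complex.norm_real, Real.norm_eq_abs] at g5 g6
    nlinarith
  have k1 := hin f u
  have k2 := hin u f
  have k3 := norm_add_le (-inner ℂ (incl f) (incl (weylW Y u)) - inner ℂ (incl u) (incl (weylW Y f)))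
    (∑ j, (inner ℂ (incl (linOp (S j) u)) (incl (weylW Y (linOp (S j) u))) +
      sympForm Y (S j) * inner ℂ (incl (linOp (S j) u)) (incl (weylW Y u)) +
      (inner ℂ (incl (linOp (S j) u)) (incl (weylW Y (linOp (S j) u))) -
      sympForm Y (S j) * inner ℂ (incl u) (incl (weylW Y (linOp (S j) u))))))
  have k4 := norm_sub_le (-inner ℂ (incl f) (incl (weylW Y u))) (inner ℂ (incl u) (incl (weylW Y f)))
  rw [norm_neg] at k4
  linarith

/-- On a ray the symplectic correction vanishes, so the derivative of the coefficient only involves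
`linOp Z u`. -/
theorem norm_inner_weylW_smul_sub (u : 𝓢(Rn n, ℂ)) (Z : Idx n → ℝ) (s : ℝ) :
    ‖inner ℂ (incl u) (incl (weylW (s • Z) u)) - inner ℂ (incl u) (incl u)‖ ≤
      |s| * (‖incl u‖ * ‖incl (linOp Z u)‖) := by
  have hY : ∀ t : ℝ, HasDerivAt (fun t : ℝ => t • (s • Z)) (s • Z) t := fun t => by
    simpa using (hasDerivAt_id t).smul_const (s • Z)
  have hd := fun t => hasDerivAt_inner_weylW u hY continuous_const t
  have hbd : ∀ t : ℝ, ‖Complex.I * inner ℂ (incl u) (incl (weylW (t • (s • Z))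
      (linOp (s • Z) u + ((sympForm (t • (s • Z)) (s • Z) / 2 : ℝ) : ℂ) • u)))‖ ≤
      |s| * (‖incl u‖ * ‖incl (linOp Z u)‖) := by
    intro t
    rw [sympForm_smul_left, sympForm_self, norm_mul, Complex.norm_I, one_mul]
    simp only [mul_zero, zero_div, Complex.ofReal_zero, zero_smul, add_zero]
    refine (norm_inner_le_norm _ _).trans_eq ?_
    rw [norm_weylW, linOp_smul, map_smul, norm_smul, Complex.norm_real, Real.norm_eq_abs]
    ring
  have h := norm_image_sub_le_of_norm_deriv_le_segment_01'
    (fun t _ => (hd t).hasDerivWithinAt) (fun t _ => hbd t)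
  simpa [weylW_zero] using h

/-- The lower bound, given two noncommuting observables obtained from the dissipative part by the
Hamilton flow of the conservative part. -/
theorem exists_lower_bound_of_noncomm {S b : Matrix (Idx n) (Idx n) ℝ} (hb : ∀ i k, b i k = b k i)
    {j k : Idx n} {t₀ : ℝ} (ht₀ : 0 ≤ t₀)
    (hne : sympForm (S j) (NormedSpace.exp (t₀ • hamMap b) (S k)) ≠ 0) :
    ∃ c : ℝ, 0 < c ∧ ∀ (η : ℝ) (u : 𝓢(Rn n, ℂ)), c * ‖incl u‖ ≤ ‖incl (dissOp S b η u)‖ := by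
  -- Normalizes the symplectic product of `S j` with the endpoint `Y t₀` to `π`.
  set s : ℝ := Real.pi / sympForm (S j) (NormedSpace.exp (t₀ • hamMap b) (S k)) with hs
  let Y : ℝ → Idx n → ℝ := fun t => NormedSpace.exp (t • hamMap b) (s • S k)
  have hY : ∀ t, HasDerivAt Y (hamMap b (Y t)) t := fun t => by
    have h := (hasDerivAt_exp_smul_const' (𝕂 := ℝ) (hamMap b) t)
    exact h.clm_apply (hasDerivAt_const t (s • S k)) |>.congr_deriv (by simp [Y])
  have hYc : Continuous Y := continuous_iff_continuousAt.mpr fun t => (hY t).continuousAt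
  have hY0 : Y 0 = s • S k := by simp [Y]
  have hpi : sympForm (S j) (Y t₀) = Real.pi := by
    simp only [Y, map_smul, sympForm_smul_right, hs]
    exact div_mul_cancel₀ _ hne
  have hsym : ∀ i, Continuous fun t => |sympForm (Y t) (S i)| := fun i => by
    simp only [sympForm]
    fun_prop
  obtain ⟨K, hK⟩ : ∃ K : ℝ, ∀ t ∈ Set.Icc 0 t₀, ∑ i, |sympForm (Y t) (S i)| ≤ K := by
    obtain ⟨K, hK⟩ := (isCompact_Icc (a := (0 : ℝ)) (b := t₀)).exists_bound_of_continuousOn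
      (continuous_finsetSum Finset.univ fun i _ => hsym i).continuousOn
    exact ⟨K, fun t ht => (le_abs_self _).trans (hK t ht)⟩
  have hK0 : 0 ≤ K := (Finset.sum_nonneg fun i _ => abs_nonneg _).trans (hK 0 ⟨le_rfl, ht₀⟩)
  -- Accounts for all drifts in units of `N²δ`: `1` for `W(S j)`, `|s|` for the start `s • S k` of
  -- the flow line, and `t₀(4 + 2K)` for transport along it, by `norm_deriv_le`.
  set C : ℝ := 1 + |s| + t₀ * (4 + 2 * K) with hC
  have hC1 : 1 ≤ C := by
    have : 0 ≤ t₀ * (4 + 2 * K) := by positivity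
    have := abs_nonneg s
    linarith
  -- If the bound fails, then `δ = √(ε/N) < 1/(8C)`, so each matrix coefficient is within `N²/8` of
  -- `N²`.
  refine ⟨1 / (64 * C ^ 2), by positivity, fun η u => ?_⟩
  set N := ‖incl u‖
  set ε := ‖incl (dissOp S b η u)‖
  have hN0 : 0 ≤ N := norm_nonneg _
  have hε0 : 0 ≤ ε := norm_nonneg _
  rcases hN0.eq_or_lt with hN | hN
  · rw [← hN]
    simpa using hε0
  by_contra hcon
  push Not at hcon
  -- With this choice `Nε = (Nδ)²`, hence `‖L_i u‖ ≤ Nδ`: the smallness of the `L_i u` is the square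
  -- root of that of the image of `u`.
  set δ := Real.sqrt (ε / N)
  have hδ0 : 0 ≤ δ := Real.sqrt_nonneg _
  have hδ2 : δ ^ 2 = ε / N := Real.sq_sqrt (by positivity)
  have hδ : δ < 1 / (8 * C) := by
    refine (Real.sqrt_lt' (by positivity)).mpr ?_
    rw [div_lt_iff₀ hN]
    refine hcon.trans_eq ?_
    rw [div_pow, mul_pow]
    norm_num
  have hδ1 : δ ≤ 1 := hδ.le.trans (by
    rw [div_le_one (by positivity)]
    linarith)
  have hNε : N * ε = (N * δ) ^ 2 := by
    rw [mul_pow, hδ2]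
    field_simp
  have hL2 := sum_norm_linOp_sq_le (S := S) hb η u
  change _ ≤ N * ε at hL2
  have hL : ∀ i, ‖incl (linOp (S i) u)‖ ≤ N * δ := fun i => by
    have h1 : ‖incl (linOp (S i) u)‖ ^ 2 ≤ (N * δ) ^ 2 := by
      rw [← hNε]
      exact (Finset.single_le_sum (f := fun i => ‖incl (linOp (S i) u)‖ ^ 2)
        (fun i _ => sq_nonneg _) (Finset.mem_univ i)).trans hL2
    exact (abs_le_of_sq_le_sq' h1 (by positivity)).2
  have hNε' : N * ε ≤ N ^ 2 * δ := by
    rw [hNε, mul_pow]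
    gcongr
    nlinarith
  have hbd : ∀ t ∈ Set.Ico 0 t₀, ‖Complex.I * inner ℂ (incl u) (incl (weylW (Y t)
      (linOp (hamMap b (Y t)) u + ((sympForm (Y t) (hamMap b (Y t)) / 2 : ℝ) : ℂ) • u)))‖ ≤
      (4 + 2 * K) * (N ^ 2 * δ) := by
    intro t ht
    refine (norm_deriv_le (S := S) hb η u (Y t)).trans ?_
    have h1 : ∑ i, |sympForm (Y t) (S i)| * (‖incl (linOp (S i) u)‖ * ‖incl u‖) ≤
        K * (N ^ 2 * δ) := by
      refine (Finset.sum_le_sum fun i _ => mul_le_mul_of_nonneg_left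
        (b := ‖incl (linOp (S i) u)‖ * ‖incl u‖) (c := N ^ 2 * δ) ?_ (abs_nonneg _)).trans ?_
      · calc ‖incl (linOp (S i) u)‖ * ‖incl u‖ ≤ (N * δ) * N :=
              mul_le_mul_of_nonneg_right (hL i) hN0
          _ = N ^ 2 * δ := by ring
      · rw [← Finset.sum_mul]
        exact mul_le_mul_of_nonneg_right (hK t ⟨ht.1, ht.2.le⟩) (by positivity)
    linarith
  have hd := fun t => hasDerivAt_inner_weylW u hY ((hamMap b).continuous.comp hYc) t
  have hmv := norm_image_sub_le_of_norm_deriv_le_segment'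
    (fun t _ => (hd t).hasDerivWithinAt) hbd t₀ ⟨ht₀, le_rfl⟩
  rw [hY0] at hmv
  have h0 : ∀ (i : Idx n) (r : ℝ), ‖inner ℂ (incl u) (incl (weylW (r • S i) u)) -
      inner ℂ (incl u) (incl u)‖ ≤ |r| * (N ^ 2 * δ) := fun i r => by
    refine (norm_inner_weylW_smul_sub u (S i) r).trans ?_
    refine mul_le_mul_of_nonneg_left ?_ (abs_nonneg r)
    calc N * ‖incl (linOp (S i) u)‖ ≤ N * (N * δ) := mul_le_mul_of_nonneg_left (hL i) hN0
      _ = N ^ 2 * δ := by ring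
  have hW1 : ‖inner ℂ (incl u) (incl (weylW (S j) u)) - inner ℂ (incl u) (incl u)‖ ≤
      C * (N ^ 2 * δ) := by
    have h1 := h0 j 1
    rw [one_smul, abs_one] at h1
    refine h1.trans ?_
    gcongr
  have hW2 : ‖inner ℂ (incl u) (incl (weylW (Y t₀) u)) - inner ℂ (incl u) (incl u)‖ ≤
      C * (N ^ 2 * δ) := by
    have h1 := norm_sub_le_norm_sub_add_norm_sub (inner ℂ (incl u) (incl (weylW (Y t₀) u)))
      (inner ℂ (incl u) (incl (weylW (s • S k) u))) (inner ℂ (incl u) (incl u))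
    have h2 := h0 k s
    have h3 : 0 ≤ N ^ 2 * δ := by positivity
    rw [hC]
    linarith
  have hsmall : ∀ Z : Idx n → ℝ, ‖inner ℂ (incl u) (incl (weylW Z u)) -
      inner ℂ (incl u) (incl u)‖ ≤ C * (N ^ 2 * δ) → ‖incl (weylW Z u) - incl u‖ < N / 2 := by
    intro Z hZ
    have h1 := norm_weylW_sub_sq Z u
    have h2 : C * (N ^ 2 * δ) < N ^ 2 / 8 := by
      have h3 : C * δ < 1 / 8 := by
        rw [lt_div_iff₀ (by positivity)] at hδ
        linarith
      calc C * (N ^ 2 * δ) = N ^ 2 * (C * δ) := by ring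
        _ < N ^ 2 * (1 / 8) := by gcongr
        _ = N ^ 2 / 8 := by ring
    have h4 : ‖incl (weylW Z u) - incl u‖ ^ 2 < (N / 2) ^ 2 := by
      rw [div_pow]
      linarith
    exact (abs_lt_of_sq_lt_sq' h4 (by positivity)).2
  have a1 := hsmall _ hW1
  have a2 := hsmall _ hW2
  have hcomm : weylW (S j) (weylW (Y t₀) u) = -weylW (Y t₀) (weylW (S j) u) := by
    rw [weylW_weylW, hpi, mul_comm, Complex.exp_neg, Complex.exp_pi_mul_I]
    simp
  have b1 : ‖incl (weylW (S j) (weylW (Y t₀) u)) - incl u‖ < N := by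
    have e : incl (weylW (S j) (weylW (Y t₀) u)) - incl u =
        incl (weylW (S j) (weylW (Y t₀) u - u)) + (incl (weylW (S j) u) - incl u) := by
      simp only [map_sub]
      abel
    rw [e]
    refine (norm_add_le _ _).trans_lt ?_
    rw [norm_weylW, map_sub]
    linarith
  have b2 : ‖incl (weylW (Y t₀) (weylW (S j) u)) - incl u‖ < N := by
    have e : incl (weylW (Y t₀) (weylW (S j) u)) - incl u =
        incl (weylW (Y t₀) (weylW (S j) u - u)) + (incl (weylW (Y t₀) u) - incl u) := by
      simp only [map_sub]
      abel
    rw [e]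
    refine (norm_add_le _ _).trans_lt ?_
    rw [norm_weylW, map_sub]
    linarith
  -- By anticommutation the two products applied to `u` sum to zero. Each is within `N` of `u`, so
  -- `2N < 2N`.
  have hfin : (2 : ℂ) • incl u = -(incl (weylW (S j) (weylW (Y t₀) u)) - incl u) -
      (incl (weylW (Y t₀) (weylW (S j) u)) - incl u) := by
    rw [hcomm, map_neg, two_smul]
    abel
  have hfin2 := congrArg norm hfin
  rw [norm_smul] at hfin2
  have := norm_sub_le (-(incl (weylW (S j) (weylW (Y t₀) u)) - incl u))
    (incl (weylW (Y t₀) (weylW (S j) u)) - incl u)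
  rw [norm_neg, ← hfin2] at this
  simp only [Complex.norm_ofNat] at this
  linarith

/-- Suppose all products vanish for `t ≥ 0` and take `S j ≠ 0`. At `t = 0`, the vector `sigVec (S
j)` is killed by every form `S k`, so the real part vanishes there; the derivative at `t = 0` says
that the form of `b` vanishes there as well. This contradicts ellipticity. -/
theorem exists_noncomm {S b : Matrix (Idx n) (Idx n) ℝ} (hS : S ≠ 0)
    (hell : ∀ Y : Idx n → ℝ, Y ≠ 0 → (∀ j, ∑ i, S j i * Y i = 0) →
      ∑ i, ∑ k, b i k * (Y i * Y k) ≠ 0) :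
    ∃ j k : Idx n, ∃ t₀ : ℝ, 0 ≤ t₀ ∧
      sympForm (S j) (NormedSpace.exp (t₀ • hamMap b) (S k)) ≠ 0 := by
  by_contra hcon
  push Not at hcon
  obtain ⟨j, hj⟩ : ∃ j, S j ≠ 0 := by
    by_contra h
    push Not at h
    exact hS (funext h)
  have h0 : ∀ k, sympForm (S j) (S k) = 0 := fun k => by simpa using hcon j k 0 le_rfl
  have hd : HasDerivAt (fun t : ℝ => sympForm (S j) (NormedSpace.exp (t • hamMap b) (S j)))
      (sympForm (S j) (hamMap b (S j))) 0 := by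
    have h := (hasDerivAt_exp_smul_const' (𝕂 := ℝ) (hamMap b) 0).clm_apply
      (hasDerivAt_const (0 : ℝ) (S j))
    have h' := hasDerivAt_pi.mp h
    simp only [sympForm_eq_sigVec]
    refine (HasDerivAt.fun_sum fun k _ => (h' k).const_mul (sigVec (S j) k)).congr_deriv ?_
    simp
  -- The products are known to vanish only for `t ≥ 0`, so the derivative is compared from the
  -- right.
  have hd0 : HasDerivWithinAt (fun t : ℝ => sympForm (S j) (NormedSpace.exp (t • hamMap b) (S j)))
      0 (Set.Ici 0) 0 :=
    (hasDerivWithinAt_const (0 : ℝ) (Set.Ici 0) (0 : ℝ)).congr (fun t ht => hcon j j t ht)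
      (hcon j j 0 le_rfl)
  have heq := (uniqueDiffOn_Ici (0 : ℝ) 0 Set.self_mem_Ici).eq_deriv _ hd.hasDerivWithinAt hd0
  rw [sympForm_hamMap] at heq
  refine hell (sigVec (S j)) (fun h => hj (sigVec_eq_zero h)) (fun k => ?_) (by linarith)
  rw [← h0 k, sympForm_eq_sigVec]
  exact Finset.sum_congr rfl fun i _ => mul_comm _ _

/-- The uniform lower bound for an elliptic quadratic operator with nonnegative, nonzero real part,
along the imaginary axis. -/
theorem exists_lower_bound {p : Symbol n} (hell : IsElliptic p) (hre : ∀ X, 0 ≤ (p X).re)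
    (hre0 : ∃ X, (p X).re ≠ 0) :
    ∃ c : ℝ, 0 < c ∧ ∀ (η : ℝ) (u : 𝓢(Rn n, ℂ)),
      c * ‖incl u‖ ≤ ‖incl (weylS p u - (Complex.I * η) • u)‖ := by
  set a : Matrix (Idx n) (Idx n) ℝ := (symMat p).map Complex.re with ha
  set b : Matrix (Idx n) (Idx n) ℝ := (symMat p).map Complex.im with hb
  have hare : ∀ Y, (p (phasePt Y)).re = ∑ i, ∑ k, a i k * (Y i * Y k) := fun Y => by
    simp [symbol_phasePt, ha, -Complex.ofReal_mul]
  have hbim : ∀ Y, (p (phasePt Y)).im = ∑ i, ∑ k, b i k * (Y i * Y k) := fun Y => by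
    simp [symbol_phasePt, hb, -Complex.ofReal_mul]
  have hbs : ∀ i k, b i k = b k i := fun i k => by simp [hb, symMat_comm p i k]
  obtain ⟨S, hS⟩ := exists_gram a (fun i k => by simp [ha, symMat_comm p i k])
    fun Y => (hre (phasePt Y)).trans_eq (hare Y)
  have hsq : ∀ Y : Idx n → ℝ, ∑ i, ∑ k, a i k * (Y i * Y k) = ∑ j, (∑ i, S j i * Y i) ^ 2 := by
    intro Y
    simp only [hS, Matrix.mul_apply, Matrix.transpose_apply, Finset.sum_mul]
    rw [Finset.sum_comm_cycle]
    refine Finset.sum_congr rfl fun j _ => ?_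
    rw [sq, Finset.sum_mul_sum, Finset.sum_comm]
    refine Finset.sum_congr rfl fun i _ => Finset.sum_congr rfl fun k _ => ?_
    ring
  have hS0 : S ≠ 0 := by
    rintro rfl
    obtain ⟨X, hX⟩ := hre0
    obtain ⟨Y, rfl⟩ := exists_phasePt X
    refine hX ?_
    rw [hare, hS]
    simp
  obtain ⟨j, k, t₀, ht₀, hne⟩ := exists_noncomm hS0 (fun Y hY hSY hbY => by
    refine hY (phasePt_eq_zero (hell _ (Complex.ext ?_ ?_)))
    · rw [hare, hsq]
      simp [hSY]
    · rw [hbim, hbY]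
      rfl)
  obtain ⟨c, hc, H⟩ := exists_lower_bound_of_noncomm hbs ht₀ hne
  refine ⟨c, hc, fun η u => (H η u).trans_eq ?_⟩
  congr 2
  have hmat : symMat p = cpx (S.transpose * S) + Complex.I • cpx b := by
    rw [← hS]
    ext i k
    simp [ha, hb, mul_comm Complex.I]
  rw [dissOp, weylS_eq_quadOp, hmat, ← quadOp_gram]
  simp only [quadOp_apply, Matrix.add_apply, Matrix.smul_apply, add_smul, Finset.sum_add_distrib,
    smul_eq_mul, mul_smul, ← Finset.smul_sum]
  rw [smul_sub]
  abel

/-! ### A priori estimates for symbols with positive definite real part -/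

theorem quadOp_add (M N : Matrix (Idx n) (Idx n) ℂ) (φ : 𝓢(Rn n, ℂ)) :
    quadOp (M + N) φ = quadOp M φ + quadOp N φ := by
  simp only [quadOp_apply, Matrix.add_apply, add_smul, Finset.sum_add_distrib]

theorem quadOp_smul (c : ℂ) (M : Matrix (Idx n) (Idx n) ℂ) (φ : 𝓢(Rn n, ℂ)) :
    quadOp (c • M) φ = c • quadOp M φ := by
  simp only [quadOp_apply, Matrix.smul_apply, smul_eq_mul, mul_smul, ← Finset.smul_sum]

theorem quadOp_one (φ : 𝓢(Rn n, ℂ)) : quadOp 1 φ = ∑ i, gen i (gen i φ) := by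
  rw [quadOp_apply]
  refine Finset.sum_congr rfl fun i _ => ?_
  rw [Finset.sum_eq_single i]
  · simp
  · intro k _ hk
    simp [Matrix.one_apply_ne hk.symm]
  · simp

theorem inner_quadOp_one (u : 𝓢(Rn n, ℂ)) :
    inner ℂ (incl u) (incl (quadOp 1 u)) = ((∑ i, ‖incl (gen i u)‖ ^ 2 : ℝ) : ℂ) := by
  rw [quadOp_one, map_sum, inner_sum, Complex.ofReal_sum]
  refine Finset.sum_congr rfl fun i _ => ?_
  rw [← inner_gen, inner_self_eq_norm_sq_to_K]
  simp

/-- The real form `Re p - c|X|²` is nonnegative, so its quantization is a sum of squares. The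
imaginary part is symmetric and does not contribute to the real part of the pairing. -/
theorem energy_le {p : Symbol n} {c : ℝ}
    (hc : ∀ Y : Idx n → ℝ, c * ∑ i, Y i ^ 2 ≤ (p (phasePt Y)).re) (u : 𝓢(Rn n, ℂ)) :
    c * ∑ i, ‖incl (gen i u)‖ ^ 2 ≤ (inner ℂ (incl u) (incl (weylS p u))).re := by
  set a : Matrix (Idx n) (Idx n) ℝ := (symMat p).map Complex.re - c • (1 : Matrix (Idx n) (Idx n) ℝ) with ha
  set b : Matrix (Idx n) (Idx n) ℝ := (symMat p).map Complex.im with hb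
  have hbs : ∀ i k, b i k = b k i := fun i k => by simp [hb, symMat_comm p i k]
  have hone : ∀ i k : Idx n, (1 : Matrix (Idx n) (Idx n) ℝ) i k = (1 : Matrix (Idx n) (Idx n) ℝ) k i :=
    fun i k => by simp [Matrix.one_apply, eq_comm]
  obtain ⟨S, hS⟩ := exists_gram a (fun i k => by
      simp only [ha, Matrix.sub_apply, Matrix.map_apply, Matrix.smul_apply, symMat_comm p i k, hone i k])
    fun Y => by
      have h1 : ∑ i, ∑ k, a i k * (Y i * Y k) = (p (phasePt Y)).re - c * ∑ i, Y i ^ 2 := by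
        simp only [ha, Matrix.sub_apply, sub_mul, Finset.sum_sub_distrib]
        congr 1
        · simp [symbol_phasePt, -Complex.ofReal_mul]
        · simp only [Matrix.smul_apply, smul_eq_mul, mul_assoc, ← Finset.mul_sum]
          congr 1
          refine Finset.sum_congr rfl fun i _ => ?_
          rw [Finset.sum_eq_single i]
          · simp [sq]
          · intro k _ hk
            simp [Matrix.one_apply_ne hk.symm]
          · simp
      rw [h1]
      linarith [hc Y]
  have hmat : symMat p = cpx (S.transpose * S) + (c : ℂ) • (1 : Matrix (Idx n) (Idx n) ℂ) +
      Complex.I • cpx b := by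
    rw [← hS]
    ext i k
    apply Complex.ext
    · rcases eq_or_ne i k with rfl | h
      · simp [ha, hb]
      · simp [ha, hb, Matrix.one_apply_ne h]
    · rcases eq_or_ne i k with rfl | h
      · simp [ha, hb]
      · simp [ha, hb, Matrix.one_apply_ne h]
  have h1 : (inner ℂ (incl u) (incl (quadOp (cpx b) u))).im = 0 := by
    have h2 := inner_quadOp hbs u u
    rw [← inner_conj_symm] at h2
    exact Complex.conj_eq_iff_im.mp h2
  rw [weylS_eq_quadOp, hmat, quadOp_add, quadOp_add, quadOp_smul, quadOp_smul, quadOp_gram]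
  simp only [map_add, map_smul, map_sum, inner_add_right, inner_smul_right, inner_sum,
    norm_linOp_sq, inner_quadOp_one, Complex.add_re, Complex.I_mul_re, h1, Complex.re_ofReal_mul,
    Complex.re_sum, Complex.ofReal_re]
  have : 0 ≤ ∑ j, ‖incl (linOp (S j) u)‖ ^ 2 := Finset.sum_nonneg fun j _ => sq_nonneg _
  linarith

/-- The uncertainty principle. -/
theorem norm_sq_le_energy (hn : 1 ≤ n) (u : 𝓢(Rn n, ℂ)) :
    ‖incl u‖ ^ 2 ≤ ∑ i, ‖incl (gen i u)‖ ^ 2 := by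
  let j : Fin n := ⟨0, hn⟩
  have h := gen_comm (Sum.inl j) (Sum.inr j) u
  have hJ : sympJ (n := n) (Sum.inl j) (Sum.inr j) = 1 := by simp [sympJ]
  rw [hJ] at h
  have h1 := congrArg (fun w => inner ℂ (incl u) (incl w)) h
  simp only [map_add, map_smul, inner_add_right, inner_smul_right] at h1
  rw [← inner_gen (Sum.inl j) u, ← inner_gen (Sum.inr j) u, inner_self_eq_norm_sq_to_K] at h1
  have h2 : ((‖incl u‖ ^ 2 : ℝ) : ℂ) = -Complex.I *
      (inner ℂ (incl (gen (Sum.inl j) u)) (incl (gen (Sum.inr j) u)) -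
        inner ℂ (incl (gen (Sum.inr j) u)) (incl (gen (Sum.inl j) u))) := by
    rw [h1]
    push_cast
    linear_combination ((‖incl u‖ : ℂ) ^ 2) * Complex.I_sq
  have h3 := congrArg norm h2
  rw [Complex.norm_real, norm_mul, norm_neg, Complex.norm_I, one_mul, norm_pow, norm_norm] at h3
  have h4 := norm_sub_le (inner ℂ (incl (gen (Sum.inl j) u)) (incl (gen (Sum.inr j) u)))
    (inner ℂ (incl (gen (Sum.inr j) u)) (incl (gen (Sum.inl j) u)))
  have h5 := norm_inner_le_norm (𝕜 := ℂ) (incl (gen (Sum.inl j) u)) (incl (gen (Sum.inr j) u))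
  have h6 := norm_inner_le_norm (𝕜 := ℂ) (incl (gen (Sum.inr j) u)) (incl (gen (Sum.inl j) u))
  have h7 : ‖incl (gen (Sum.inl j) u)‖ ^ 2 + ‖incl (gen (Sum.inr j) u)‖ ^ 2 ≤
      ∑ i, ‖incl (gen i u)‖ ^ 2 := by
    rw [Fintype.sum_sum_type]
    exact add_le_add
      (Finset.single_le_sum (f := fun j => ‖incl (gen (Sum.inl j) u)‖ ^ 2)
        (fun i _ => sq_nonneg _) (Finset.mem_univ j))
      (Finset.single_le_sum (f := fun j => ‖incl (gen (Sum.inr j) u)‖ ^ 2)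
        (fun i _ => sq_nonneg _) (Finset.mem_univ j))
  nlinarith [sq_nonneg (‖incl (gen (Sum.inl j) u)‖ - ‖incl (gen (Sum.inr j) u)‖)]

/-! ### Commutators with linear operators and second-order estimates -/

theorem quadOp_gen (M : Matrix (Idx n) (Idx n) ℂ) (k : Idx n) (u : 𝓢(Rn n, ℂ)) :
    quadOp M (gen k u) = gen k (quadOp M u) + ∑ i, ∑ m, M i m •
      ((Complex.I * (sympJ m k : ℂ)) • gen i u + (Complex.I * (sympJ i k : ℂ)) • gen m u) := by
  simp only [quadOp_apply, map_sum, map_smul, ← Finset.sum_add_distrib, ← smul_add]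
  refine Finset.sum_congr rfl fun i _ => Finset.sum_congr rfl fun m _ => ?_
  rw [gen_comm m k u, map_add, map_smul, gen_comm i k]
  congr 1
  abel

/-- Absorption: `√s · T ≤ cs/2 + T²/(2c)`, and half of `cs` remains on the left. -/
theorem sqrt_le_of_le_sqrt_mul {c s T D : ℝ} (hc : 0 < c) (hs : 0 ≤ s) (hT : 0 ≤ T) (hD : 0 ≤ D)
    (h : c * s ≤ Real.sqrt s * T + D * T ^ 2) :
    Real.sqrt s ≤ Real.sqrt (1 / c ^ 2 + 2 * D / c) * T := by
  have h3 := Real.sq_sqrt hs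
  have h4 : Real.sqrt s * T ≤ c * s / 2 + T ^ 2 / (2 * c) := by
    have h5 : 0 ≤ (c * Real.sqrt s - T) ^ 2 / (2 * c) := by positivity
    have h6 : (c * Real.sqrt s - T) ^ 2 / (2 * c) =
        c * (Real.sqrt s ^ 2) / 2 - Real.sqrt s * T + T ^ 2 / (2 * c) := by
      field_simp
      ring
    rw [h6, h3] at h5
    linarith
  have h7 : c * s / 2 ≤ T ^ 2 / (2 * c) + D * T ^ 2 := by linarith
  have h8 : s ≤ (1 / c ^ 2 + 2 * D / c) * T ^ 2 := by
    calc s = (c * s / 2) * (2 / c) := by field_simp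
      _ ≤ (T ^ 2 / (2 * c) + D * T ^ 2) * (2 / c) := by gcongr
      _ = (1 / c ^ 2 + 2 * D / c) * T ^ 2 := by field_simp
  refine Real.sqrt_le_iff.mpr ⟨by positivity, ?_⟩
  rwa [mul_pow, Real.sq_sqrt (by positivity)]

theorem norm_gen_le_sqrt (u : 𝓢(Rn n, ℂ)) (i : Idx n) :
    ‖incl (gen i u)‖ ≤ Real.sqrt (∑ i, ‖incl (gen i u)‖ ^ 2) :=
  Real.le_sqrt_of_sq_le (Finset.single_le_sum (f := fun i => ‖incl (gen i u)‖ ^ 2)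
    (fun i _ => sq_nonneg _) (Finset.mem_univ i))

theorem exists_first_order_bound (hn : 1 ≤ n) {p : Symbol n}
    (hpos : ∀ X, X ≠ 0 → 0 < (p X).re) :
    ∃ C : ℝ, 0 ≤ C ∧ ∀ u : 𝓢(Rn n, ℂ), ‖incl u‖ ≤ C * ‖incl (weylS p u)‖ ∧
      ∀ i, ‖incl (gen i u)‖ ≤ C * ‖incl (weylS p u)‖ := by
  obtain ⟨c, hc, hcp⟩ := exists_coercive hpos
  refine ⟨Real.sqrt (1 / c ^ 2 + 2 * 0 / c), Real.sqrt_nonneg _, fun u => ?_⟩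
  have h1 : ‖incl u‖ ≤ Real.sqrt (∑ i, ‖incl (gen i u)‖ ^ 2) :=
    Real.le_sqrt_of_sq_le (norm_sq_le_energy hn u)
  have h2 : c * ∑ i, ‖incl (gen i u)‖ ^ 2 ≤
      Real.sqrt (∑ i, ‖incl (gen i u)‖ ^ 2) * ‖incl (weylS p u)‖ + 0 * ‖incl (weylS p u)‖ ^ 2 := by
    rw [zero_mul, add_zero]
    exact (energy_le hcp u).trans ((Complex.re_le_norm _).trans ((norm_inner_le_norm _ _).trans
      (mul_le_mul_of_nonneg_right h1 (norm_nonneg _))))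
  have h3 := sqrt_le_of_le_sqrt_mul hc (Finset.sum_nonneg fun _ _ => sq_nonneg _) (norm_nonneg _)
    le_rfl h2
  exact ⟨h1.trans h3, fun i => (norm_gen_le_sqrt u i).trans h3⟩

theorem exists_commutator_bound (M : Matrix (Idx n) (Idx n) ℂ) (k : Idx n) :
    ∃ D : ℝ, 0 ≤ D ∧ ∀ (u : 𝓢(Rn n, ℂ)) (T : ℝ), (∀ i, ‖incl (gen i u)‖ ≤ T) →
      ‖incl (quadOp M (gen k u) - gen k (quadOp M u))‖ ≤ D * T := by
  refine ⟨∑ i, ∑ m, ‖M i m‖ * (‖sympJ m k‖ + ‖sympJ i k‖), by positivity, fun u T hT => ?_⟩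
  rw [quadOp_gen, add_sub_cancel_left]
  simp only [map_sum, Finset.sum_mul]
  refine norm_sum_le_of_le _ fun i _ => norm_sum_le_of_le _ fun m _ => ?_
  rw [map_smul, norm_smul, mul_assoc]
  refine mul_le_mul_of_nonneg_left ?_ (norm_nonneg _)
  rw [map_add, map_smul, map_smul, add_mul]
  refine (norm_add_le _ _).trans (add_le_add ?_ ?_)
  · rw [norm_smul, norm_mul, Complex.norm_I, one_mul, Complex.norm_real]
    exact mul_le_mul_of_nonneg_left (hT i) (norm_nonneg _)
  · rw [norm_smul, norm_mul, Complex.norm_I, one_mul, Complex.norm_real]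
    exact mul_le_mul_of_nonneg_left (hT m) (norm_nonneg _)

/-- The energy estimate is applied to `gen k u`. Moving one `gen k` across gives `⟨gen k (gen k u),
p^w u⟩`, which is absorbed, and a commutator term which is of first order and already controlled. -/
theorem exists_second_order_bound (hn : 1 ≤ n) {p : Symbol n}
    (hpos : ∀ X, X ≠ 0 → 0 < (p X).re) (k : Idx n) :
    ∃ C : ℝ, 0 ≤ C ∧ ∀ (u : 𝓢(Rn n, ℂ)) (i : Idx n),
      ‖incl (gen i (gen k u))‖ ≤ C * ‖incl (weylS p u)‖ := by
  obtain ⟨c, hc, hcp⟩ := exists_coercive hpos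
  obtain ⟨C₁, hC₁, H₁⟩ := exists_first_order_bound hn hpos
  obtain ⟨D, hD, HD⟩ := exists_commutator_bound (symMat p) k
  refine ⟨Real.sqrt (1 / c ^ 2 + 2 * (C₁ * (D * C₁)) / c), Real.sqrt_nonneg _, fun u i => ?_⟩
  set T := ‖incl (weylS p u)‖
  have hT : 0 ≤ T := norm_nonneg _
  have hcom := HD u (C₁ * T) (H₁ u).2
  have hen : c * ∑ i, ‖incl (gen i (gen k u))‖ ^ 2 ≤
      Real.sqrt (∑ i, ‖incl (gen i (gen k u))‖ ^ 2) * T + C₁ * (D * C₁) * T ^ 2 := by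
    refine (energy_le hcp (gen k u)).trans ?_
    have e : weylS p (gen k u) = gen k (weylS p u) +
        (quadOp (symMat p) (gen k u) - gen k (quadOp (symMat p) u)) := by
      rw [weylS_eq_quadOp, weylS_eq_quadOp]
      abel
    rw [e, map_add, inner_add_right, ← inner_gen, Complex.add_re]
    refine add_le_add ?_ ?_
    · exact (Complex.re_le_norm _).trans ((norm_inner_le_norm _ _).trans
        (mul_le_mul_of_nonneg_right (norm_gen_le_sqrt (gen k u) k) hT))
    · refine (Complex.re_le_norm _).trans ((norm_inner_le_norm _ _).trans ?_)
      refine (mul_le_mul ((H₁ u).2 k) hcom (norm_nonneg _) (by positivity)).trans_eq ?_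
      ring
  exact (norm_gen_le_sqrt (gen k u) i).trans
    (sqrt_le_of_le_sqrt_mul hc (Finset.sum_nonneg fun i _ => sq_nonneg _) hT (by positivity) hen)

/-- The global a priori estimate. -/
theorem exists_apriori (hn : 1 ≤ n) {p : Symbol n} (hpos : ∀ X, X ≠ 0 → 0 < (p X).re) :
    ∃ C : ℝ, 0 ≤ C ∧ ∀ u : 𝓢(Rn n, ℂ), ‖incl u‖ ≤ C * ‖incl (weylS p u)‖ ∧
      (∀ i, ‖incl (gen i u)‖ ≤ C * ‖incl (weylS p u)‖) ∧
      ∀ i k, ‖incl (gen i (gen k u))‖ ≤ C * ‖incl (weylS p u)‖ := by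
  obtain ⟨C₁, hC₁, H₁⟩ := exists_first_order_bound hn hpos
  choose C₂ hC₂ H₂ using exists_second_order_bound hn hpos
  have hs : 0 ≤ ∑ k, C₂ k := Finset.sum_nonneg fun k _ => hC₂ k
  refine ⟨C₁ + ∑ k, C₂ k, by positivity, fun u => ?_⟩
  have e1 : C₁ * ‖incl (weylS p u)‖ ≤ (C₁ + ∑ k, C₂ k) * ‖incl (weylS p u)‖ :=
    mul_le_mul_of_nonneg_right (by linarith) (norm_nonneg _)
  have e2 : ∀ k, C₂ k * ‖incl (weylS p u)‖ ≤ (C₁ + ∑ k, C₂ k) * ‖incl (weylS p u)‖ := fun k => by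
    have := Finset.single_le_sum (fun i _ => hC₂ i) (Finset.mem_univ k)
    exact mul_le_mul_of_nonneg_right (by linarith) (norm_nonneg _)
  exact ⟨(H₁ u).1.trans e1, fun i => ((H₁ u).2 i).trans e1, fun i k => (H₂ k u i).trans (e2 k)⟩

theorem exists_relative_bound (hn : 1 ≤ n) {p : Symbol n} (hpos : ∀ X, X ≠ 0 → 0 < (p X).re)
    (q : Symbol n) :
    ∃ C : ℝ, 0 < C ∧ ∀ u : 𝓢(Rn n, ℂ), ‖incl (weylS q u)‖ ≤ C * ‖incl (weylS p u)‖ := by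
  obtain ⟨C, hC, H⟩ := exists_apriori hn hpos
  have h0 : 0 ≤ ∑ i, ∑ k, ‖symMat q i k‖ * C := by positivity
  refine ⟨∑ i, ∑ k, ‖symMat q i k‖ * C + 1, by linarith, fun u => ?_⟩
  have h1 : ‖incl (weylS q u)‖ ≤ (∑ i, ∑ k, ‖symMat q i k‖ * C) * ‖incl (weylS p u)‖ := by
    rw [weylS_eq_quadOp q, quadOp_apply]
    simp only [map_sum, Finset.sum_mul]
    refine norm_sum_le_of_le _ fun i _ => norm_sum_le_of_le _ fun m _ => ?_
    rw [map_smul, norm_smul, mul_assoc]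
    exact mul_le_mul_of_nonneg_left ((H u).2.2 i m) (norm_nonneg _)
  have h2 : 0 ≤ ‖incl (weylS p u)‖ := norm_nonneg _
  linarith

/-! ### The harmonic oscillator -/

/-- A coordinate on phase space, with complex values. -/
def coordC : Idx n → (Rn n × Rn n →ₗ[ℝ] ℂ) := Sum.elim
  (fun j => (Complex.ofRealCLM.comp (EuclideanSpace.proj (𝕜 := ℝ) j)).toLinearMap ∘ₗ LinearMap.fst ℝ _ _)
  (fun j => (Complex.ofRealCLM.comp (EuclideanSpace.proj (𝕜 := ℝ) j)).toLinearMap ∘ₗ LinearMap.snd ℝ _ _)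

/-- The symbol `|x|² + |ξ|²` of the harmonic oscillator. -/
def harm (n : ℕ) : Symbol n := ∑ i : Idx n, QuadraticMap.linMulLin (coordC i) (coordC i)

theorem coordC_phaseVec (i k : Idx n) : coordC i (phaseVec k) = if i = k then 1 else 0 := by
  rcases i with i | i <;> rcases k with k | k <;>
    simp [coordC, phaseVec, stdVec, apply_ite Complex.ofReal]

theorem symMat_harm : symMat (harm n) = 1 := by
  ext i k
  have h : QuadraticMap.polar (harm n) (phaseVec i) (phaseVec k) =
      ∑ m : Idx n, 2 * (coordC m (phaseVec i) * coordC m (phaseVec k)) := by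
    simp only [QuadraticMap.polar, harm, sum_apply, QuadraticMap.linMulLin_apply,
      map_add, ← Finset.sum_sub_distrib]
    exact Finset.sum_congr rfl fun m _ => by ring
  simp only [symMat, Matrix.of_apply, h, coordC_phaseVec, Matrix.one_apply]
  rw [Finset.sum_eq_single i]
  · simp
  · intro m _ hm
    simp [hm]
  · simp

theorem weylS_harm (u : 𝓢(Rn n, ℂ)) : weylS (harm n) u = ∑ i, gen i (gen i u) := by
  rw [weylS_eq_quadOp, symMat_harm, quadOp_one]

theorem harm_re_pos : ∀ X : Rn n × Rn n, X ≠ 0 → 0 < (harm n X).re := by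
  intro X hX
  obtain ⟨Y, rfl⟩ := exists_phasePt X
  have h : (harm n (phasePt Y)).re = ∑ i, Y i ^ 2 := by
    rw [symbol_phasePt, symMat_harm, Complex.re_sum]
    refine Finset.sum_congr rfl fun i _ => ?_
    rw [Finset.sum_eq_single i]
    · simp [sq]
    · intro k _ hk
      simp [Matrix.one_apply_ne hk.symm]
    · simp
  rw [h]
  have hY : Y ≠ 0 := by
    rintro rfl
    simp [phasePt] at hX
  obtain ⟨i, hi⟩ := Function.ne_iff.mp hY
  exact Finset.sum_pos' (fun i _ => sq_nonneg _) ⟨i, Finset.mem_univ i, by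
    have : Y i ≠ 0 := hi
    positivity⟩

/-! ### The Gaussian and the Hermite functions -/

theorem iteratedDeriv_ofReal_exp (k : ℕ) :
    iteratedDeriv k (fun t : ℝ => (Real.exp t : ℂ)) = fun t : ℝ => (Real.exp t : ℂ) := by
  induction k with
  | zero => simp
  | succ k ih =>
    rw [iteratedDeriv_succ, ih]
    ext t
    exact (Real.hasDerivAt_exp t).ofReal_comp.deriv

theorem one_add_pow_mul_exp_le (N : ℕ) {t : ℝ} (ht : 0 ≤ t) :
    (1 + t) ^ N * Real.exp (-t ^ 2 / 2) ≤ N.factorial * Real.exp (3 / 2) := by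
  have h1 := Real.pow_div_factorial_le_exp (1 + t) (by linarith) N
  rw [div_le_iff₀ (by positivity)] at h1
  calc (1 + t) ^ N * Real.exp (-t ^ 2 / 2)
      ≤ (Real.exp (1 + t) * N.factorial) * Real.exp (-t ^ 2 / 2) := by gcongr
    _ = N.factorial * Real.exp (1 + t + -t ^ 2 / 2) := by
        rw [Real.exp_add (1 + t) (-t ^ 2 / 2)]
        ring
    _ ≤ N.factorial * Real.exp (3 / 2) := by
        gcongr
        -- The maximum of `1 + t - t²/2`, attained at `t = 1`, is `3/2`.
        nlinarith [sq_nonneg (t - 1)]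

theorem contDiff_ofReal_exp : ContDiff ℝ (⊤ : ℕ∞) (fun t : ℝ => (Real.exp t : ℂ)) :=
  Complex.ofRealCLM.contDiff.comp Real.contDiff_exp

theorem contDiff_neg_norm_sq_div : ContDiff ℝ (⊤ : ℕ∞) (fun x : Rn n => -‖x‖ ^ 2 / 2) :=
  (contDiff_norm_sq ℝ).neg.div_const 2

/-- Every derivative of `exp` is `exp`, and those of `-‖x‖²/2` grow polynomially. The chain rule for
higher derivatives thus bounds each derivative by a polynomial times the Gaussian. -/
theorem gaussian_decay (k m : ℕ) : ∃ C, ∀ x : Rn n,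
    ‖x‖ ^ k * ‖iteratedFDeriv ℝ m (fun x : Rn n => (Real.exp (-‖x‖ ^ 2 / 2) : ℂ)) x‖ ≤ C := by
  have htemp : Function.HasTemperateGrowth (fun x : Rn n => -‖x‖ ^ 2 / 2) := by
    have h := (Function.HasTemperateGrowth.const (-(1 / 2) : ℝ)).mul
      (Function.hasTemperateGrowth_norm_sq (Rn n))
    have h1 : (fun x : Rn n => -‖x‖ ^ 2 / 2) = fun x : Rn n => -(1 / 2) * ‖x‖ ^ 2 := by
      ext x
      ring
    rw [h1]
    exact h
  obtain ⟨l, A, hA, hbd⟩ := htemp.norm_iteratedFDeriv_le_uniform m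
  refine ⟨m.factorial * (1 + A) ^ m * ((k + l * m).factorial * Real.exp (3 / 2)), fun x => ?_⟩
  have h1 : ‖iteratedFDeriv ℝ m ((fun t : ℝ => (Real.exp t : ℂ)) ∘ fun x : Rn n => -‖x‖ ^ 2 / 2) x‖ ≤
      m.factorial * Real.exp (-‖x‖ ^ 2 / 2) * ((1 + A) * (1 + ‖x‖) ^ l) ^ m := by
    refine norm_iteratedFDeriv_comp_le (N := (⊤ : ℕ∞)) contDiff_ofReal_exp contDiff_neg_norm_sq_div
      (by exact_mod_cast le_top) x (fun i _ => ?_) fun i hi him => ?_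
    · rw [norm_iteratedFDeriv_eq_norm_iteratedDeriv, iteratedDeriv_ofReal_exp, Complex.norm_real,
        Real.norm_eq_abs, Real.abs_exp]
    -- The chain-rule bound needs an `i`-th power. The base is at least `1`, so the first power
    -- suffices when `i ≥ 1`.
    · have h2 : (1 : ℝ) ≤ (1 + ‖x‖) ^ l := one_le_pow₀ (by linarith [norm_nonneg x])
      refine (hbd i him x).trans ((mul_le_mul_of_nonneg_right (by linarith) (by positivity)).trans
        (le_self_pow₀ ?_ (by omega)))
      nlinarith
  calc ‖x‖ ^ k * ‖iteratedFDeriv ℝ m (fun x : Rn n => (Real.exp (-‖x‖ ^ 2 / 2) : ℂ)) x‖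
      ≤ (1 + ‖x‖) ^ k * (m.factorial * Real.exp (-‖x‖ ^ 2 / 2) * ((1 + A) * (1 + ‖x‖) ^ l) ^ m) := by
        gcongr
        · linarith [norm_nonneg x]
        · exact h1
    _ = m.factorial * (1 + A) ^ m * ((1 + ‖x‖) ^ (k + l * m) * Real.exp (-‖x‖ ^ 2 / 2)) := by
        rw [mul_pow, ← pow_mul, pow_add]
        ring
    _ ≤ _ := by
        exact mul_le_mul_of_nonneg_left (one_add_pow_mul_exp_le _ (norm_nonneg x)) (by positivity)

/-- The Gaussian `exp(-|x|²/2)`. -/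
def gauss (n : ℕ) : 𝓢(Rn n, ℂ) where
  toFun x := (Real.exp (-‖x‖ ^ 2 / 2) : ℂ)
  smooth' := contDiff_ofReal_exp.comp contDiff_neg_norm_sq_div
  decay' := gaussian_decay

theorem gauss_apply (x : Rn n) : gauss n x = (Real.exp (-‖x‖ ^ 2 / 2) : ℂ) := rfl

/-- The creation operators. -/
def raise (j : Fin n) : 𝓢(Rn n, ℂ) →L[ℂ] 𝓢(Rn n, ℂ) := mulX j - Complex.I • opD j

/-- The annihilation operators. -/
def lower (j : Fin n) : 𝓢(Rn n, ℂ) →L[ℂ] 𝓢(Rn n, ℂ) := mulX j + Complex.I • opD j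

theorem raise_apply (j : Fin n) (φ : 𝓢(Rn n, ℂ)) :
    raise j φ = mulX j φ - Complex.I • opD j φ := rfl

theorem lower_apply (j : Fin n) (φ : 𝓢(Rn n, ℂ)) :
    lower j φ = mulX j φ + Complex.I • opD j φ := rfl

theorem lower_gauss (j : Fin n) : lower j (gauss n) = 0 := by
  ext x
  have h1 : HasFDerivAt (fun x : Rn n => -‖x‖ ^ 2 / 2) (-(innerSL ℝ x)) x := by
    have h := ((hasStrictFDerivAt_norm_sq x).hasFDerivAt.neg.mul_const (1 / 2 : ℝ))
    refine (h.congr_of_eventuallyEq (Filter.Eventually.of_forall fun y => ?_)).congr_fderiv ?_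
    · simp only [Pi.neg_apply]
      ring
    · ext v
      simp
  have h2 : HasFDerivAt (gauss n) (Complex.ofRealCLM.comp
      (Real.exp (-‖x‖ ^ 2 / 2) • (-(innerSL ℝ x)))) x :=
    Complex.ofRealCLM.hasFDerivAt.comp x h1.exp
  have h3 : inner ℝ x (stdVec j) = x j := by
    simp [stdVec, EuclideanSpace.inner_single_right]
  simp only [lower_apply, add_apply, smul_apply, mulX_apply, opD_apply,
    SchwartzMap.lineDerivOp_apply_eq_fderiv, h2.fderiv, ContinuousLinearMap.comp_apply,
    neg_apply, innerSL_apply_apply, h3, smul_eq_mul, gauss_apply, Complex.ofRealCLM_apply,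
    zero_apply]
  push_cast
  linear_combination (Complex.exp (-(‖x‖ : ℂ) ^ 2 / 2) * x j) * Complex.I_sq

theorem opD_opD_comm (j k : Fin n) (φ : 𝓢(Rn n, ℂ)) : opD j (opD k φ) = opD k (opD j φ) := by
  have h := gen_comm (Sum.inr j) (Sum.inr k) φ
  simpa [gen, sympJ] using h

theorem mulX_mulX_comm (j k : Fin n) (φ : 𝓢(Rn n, ℂ)) : mulX j (mulX k φ) = mulX k (mulX j φ) := by
  have h := gen_comm (Sum.inl j) (Sum.inl k) φ
  simpa [gen, sympJ] using h

theorem lower_raise (j k : Fin n) (φ : 𝓢(Rn n, ℂ)) :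
    lower j (raise k φ) = raise k (lower j φ) + (if j = k then (2 : ℂ) else 0) • φ := by
  have hI : ∀ ψ : 𝓢(Rn n, ℂ), Complex.I • Complex.I • ψ = -ψ := fun ψ => by
    rw [smul_smul, Complex.I_mul_I, neg_one_smul]
  simp only [lower_apply, raise_apply, map_sub, map_add, map_smul, opD_mulX, smul_sub, smul_add, hI]
  rw [mulX_mulX_comm j k, opD_opD_comm j k]
  by_cases h : j = k
  · subst h
    simp only [if_true, hI, two_smul]
    abel
  · simp only [h, if_false, Ne.symm h, zero_smul, smul_zero, add_zero]
    abel

theorem weylS_harm_eq_raise_lower (φ : 𝓢(Rn n, ℂ)) :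
    weylS (harm n) φ = ∑ j, raise j (lower j φ) + (n : ℂ) • φ := by
  have hI : ∀ ψ : 𝓢(Rn n, ℂ), Complex.I • Complex.I • ψ = -ψ := fun ψ => by
    rw [smul_smul, Complex.I_mul_I, neg_one_smul]
  have h : ∀ j : Fin n, raise j (lower j φ) = mulX j (mulX j φ) + opD j (opD j φ) - φ := by
    intro j
    simp only [lower_apply, raise_apply, map_add, map_smul, opD_mulX, smul_sub, smul_add, hI, ↓reduceIte]
    abel
  rw [weylS_harm, Fintype.sum_sum_type]
  simp only [h, Finset.sum_sub_distrib, Finset.sum_add_distrib, gen, Sum.elim_inl, Sum.elim_inr]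
  simp [Finset.sum_const, ← Nat.cast_smul_eq_nsmul ℂ]

/-- The Hermite functions. -/
def hermite : List (Fin n) → 𝓢(Rn n, ℂ)
  | [] => gauss n
  | j :: l => raise j (hermite l)

/-- The number operator: each creation operator in the word contributes the commutator `2`. -/
theorem sum_raise_lower_hermite (l : List (Fin n)) :
    ∑ j, raise j (lower j (hermite l)) = (2 * l.length : ℂ) • hermite l := by
  induction l with
  | nil => simp [hermite, lower_gauss]
  | cons k l ih =>
    have hcomm : ∀ j, raise j (raise k (lower j (hermite l))) = raise k (raise j (lower j (hermite l))) := by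
      intro j
      simp only [raise_apply, map_sub, map_smul, opD_mulX, smul_sub, smul_add]
      rw [mulX_mulX_comm j k, opD_opD_comm j k]
      by_cases h : j = k
      · subst h
        rfl
      · simp only [h, if_false, Ne.symm h, zero_smul, smul_zero, add_zero]
        abel
    simp only [hermite, lower_raise, map_add, map_smul, hcomm, Finset.sum_add_distrib, ← map_sum, ih]
    rw [Finset.sum_eq_single k]
    · simp only [if_true, ← add_smul]
      congr 1
      push_cast [List.length_cons]
      ring
    · intro j _ hj
      simp [hj]
    · simp

theorem weylS_harm_hermite (l : List (Fin n)) :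
    weylS (harm n) (hermite l) = (2 * l.length + n : ℂ) • hermite l := by
  rw [weylS_harm_eq_raise_lower, sum_raise_lower_hermite, add_smul]

/-- The span of the Hermite functions. -/
def hermiteSpan (n : ℕ) : Submodule ℂ 𝓢(Rn n, ℂ) := Submodule.span ℂ (Set.range hermite)

theorem raise_mem {φ : 𝓢(Rn n, ℂ)} (hφ : φ ∈ hermiteSpan n) (j : Fin n) :
    raise j φ ∈ hermiteSpan n := by
  have h : hermiteSpan n ≤ (hermiteSpan n).comap (raise j).toLinearMap :=
    Submodule.span_le.mpr (by
      rintro _ ⟨l, rfl⟩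
      exact Submodule.subset_span ⟨j :: l, rfl⟩)
  exact h hφ

theorem lower_hermite_mem (j : Fin n) (l : List (Fin n)) : lower j (hermite l) ∈ hermiteSpan n := by
  induction l with
  | nil => simp [hermite, lower_gauss]
  | cons k l ih =>
    rw [hermite, lower_raise]
    exact add_mem (raise_mem ih k)
      ((hermiteSpan n).smul_mem _ (Submodule.subset_span ⟨l, rfl⟩))

theorem mulX_mem {φ : 𝓢(Rn n, ℂ)} (hφ : φ ∈ hermiteSpan n) (j : Fin n) :
    mulX j φ ∈ hermiteSpan n := by
  have h : hermiteSpan n ≤ (hermiteSpan n).comap (lower j).toLinearMap :=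
    Submodule.span_le.mpr (by
      rintro _ ⟨l, rfl⟩
      exact lower_hermite_mem j l)
  have h1 : mulX j φ = (1 / 2 : ℂ) • (lower j φ + raise j φ) := by
    rw [lower_apply, raise_apply]
    module
  rw [h1]
  exact (hermiteSpan n).smul_mem _ (add_mem (h hφ) (raise_mem hφ j))

theorem exists_weylS_harm_eq (hn : 1 ≤ n) {φ : 𝓢(Rn n, ℂ)} (hφ : φ ∈ hermiteSpan n) :
    ∃ ψ, weylS (harm n) ψ = φ := by
  have h : hermiteSpan n ≤ LinearMap.range (quadOp (symMat (harm n))).toLinearMap :=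
    Submodule.span_le.mpr (by
      rintro _ ⟨l, rfl⟩
      -- Here `n ≥ 1` enters: the lowest eigenvalue is `n`.
      have hne : (2 * l.length + n : ℂ) ≠ 0 := by
        have : ((2 * l.length + n : ℕ) : ℂ) ≠ 0 := by
          rw [Nat.cast_ne_zero]
          omega
        exact_mod_cast this
      refine ⟨(2 * l.length + n : ℂ)⁻¹ • hermite l, ?_⟩
      simp only [ContinuousLinearMap.coe_coe, map_smul]
      rw [← weylS_eq_quadOp, weylS_harm_hermite, smul_smul, inv_mul_cancel₀ hne, one_smul])
  obtain ⟨ψ, hψ⟩ := h hφ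
  exact ⟨ψ, by rw [weylS_eq_quadOp]; exact hψ⟩

/-- Supplies the terms of the power series of `exp(i ξ·x)` times the Gaussian. -/
theorem exists_pow_mem (ξ : Rn n) (k : ℕ) :
    ∃ φ ∈ hermiteSpan n, ∀ x, φ x = (inner ℝ ξ x : ℂ) ^ k * gauss n x := by
  induction k with
  | zero => exact ⟨gauss n, Submodule.subset_span ⟨[], rfl⟩, fun x => by simp⟩
  | succ k ih =>
    obtain ⟨φ, hφ, hφx⟩ := ih
    refine ⟨∑ j, (ξ j : ℂ) • mulX j φ, Submodule.sum_mem _ fun j _ =>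
      (hermiteSpan n).smul_mem _ (mulX_mem hφ j), fun x => ?_⟩
    have h : inner ℝ ξ x = ∑ j, ξ j * x j := by
      simp [PiLp.inner_apply, mul_comm]
    simp only [sum_apply, smul_apply, mulX_apply, smul_eq_mul, hφx, ← mul_assoc, ← Finset.sum_mul]
    rw [pow_succ, h]
    push_cast
    ring

/-! ### Completeness of the Hermite functions -/

theorem memLp_exp_mul_gauss (a : ℝ) :
    MemLp (fun x : Rn n => Real.exp (a * ‖x‖) * Real.exp (-‖x‖ ^ 2 / 2)) 2 := by
  have hc : Continuous fun x : Rn n => Real.exp (a * ‖x‖) * Real.exp (-‖x‖ ^ 2 / 2) := by fun_prop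
  rw [memLp_two_iff_integrable_sq hc.aestronglyMeasurable]
  refine (((gauss n).integrable (μ := volume)).norm.const_mul (Real.exp (2 * a ^ 2))).mono'
    (hc.pow 2).aestronglyMeasurable (Filter.Eventually.of_forall fun x => ?_)
  rw [gauss_apply, Complex.norm_real, Real.norm_eq_abs, Real.norm_eq_abs, Real.abs_exp, ← Real.exp_add,
    ← Real.exp_add, ← Real.exp_nat_mul, Real.abs_exp, Real.exp_le_exp]
  push_cast
  nlinarith [sq_nonneg (2 * a - ‖x‖)]

theorem inner_incl_eq (v : L2 n) (φ : 𝓢(Rn n, ℂ)) :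
    inner ℂ v (incl φ) = ∫ x, (starRingEnd ℂ) (v x) * φ x := by
  rw [L2.inner_def]
  refine integral_congr_ae ?_
  filter_upwards [φ.coeFn_toLp 2 volume] with x hx
  have : (incl φ : L2 n) x = φ x := hx
  rw [this]
  simp [mul_comm]

theorem memLp_conj (v : L2 n) : MemLp (fun x => (starRingEnd ℂ) (v x)) 2 (volume : Measure (Rn n)) := by
  refine (Lp.memLp v).of_le (Complex.continuous_conj.comp_aestronglyMeasurable
    (Lp.aestronglyMeasurable v)) (Filter.Eventually.of_forall fun x => ?_)
  simp

/-- The exponential is expanded in its power series and integrated term by term. The majorant is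
`‖v‖` times `exp(‖ξ‖‖x‖ - ‖x‖²/2)`, a product of two square-integrable functions. -/
theorem integral_conj_mul_exp_gauss_eq_zero {v : L2 n}
    (hv : ∀ φ ∈ hermiteSpan n, inner ℂ v (incl φ) = 0) (ξ : Rn n) :
    ∫ x, (starRingEnd ℂ) (v x) * (Complex.exp (Complex.I * (inner ℝ ξ x : ℝ)) * gauss n x) = 0 := by
  let F : ℕ → Rn n → ℂ := fun k x => (Complex.I ^ k / k.factorial) *
    ((starRingEnd ℂ) (v x) * ((inner ℝ ξ x : ℂ) ^ k * gauss n x))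
  let bd : ℕ → Rn n → ℝ := fun k x =>
    ‖v x‖ * ((‖ξ‖ * ‖x‖) ^ k / k.factorial * Real.exp (-‖x‖ ^ 2 / 2))
  have hsum : ∀ x, HasSum (fun k => bd k x)
      (‖v x‖ * (Real.exp (‖ξ‖ * ‖x‖) * Real.exp (-‖x‖ ^ 2 / 2))) := fun x => by
    have h := NormedSpace.expSeries_div_hasSum_exp (‖ξ‖ * ‖x‖)
    rw [← Real.exp_eq_exp_ℝ] at h
    exact (h.mul_right _).mul_left _
  have hmeas : ∀ k, AEStronglyMeasurable (F k) volume := fun k => by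
    refine AEStronglyMeasurable.const_mul (AEStronglyMeasurable.mul
      (memLp_conj v).aestronglyMeasurable ?_) _
    exact Continuous.aestronglyMeasurable (by fun_prop)
  have h := hasSum_integral_of_dominated_convergence (μ := volume) (F := F)
    (f := fun x => (starRingEnd ℂ) (v x) * (Complex.exp (Complex.I * (inner ℝ ξ x : ℝ)) * gauss n x))
    bd hmeas (fun k => Filter.Eventually.of_forall fun x => ?_)
    (Filter.Eventually.of_forall fun x => (hsum x).summable) ?_
    (Filter.Eventually.of_forall fun x => ?_)
  · have h0 : ∀ k, ∫ x, F k x = 0 := fun k => by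
      obtain ⟨φ, hφ, hφx⟩ := exists_pow_mem ξ k
      have h1 := hv φ hφ
      rw [inner_incl_eq] at h1
      simp only [F, integral_const_mul, ← hφx, h1, mul_zero]
    simp only [h0] at h
    exact h.unique hasSum_zero
  · simp only [F, bd, norm_mul, norm_div, norm_pow, Complex.norm_I, one_pow, RCLike.norm_conj,
      gauss_apply, Complex.norm_real, Real.norm_eq_abs, Real.abs_exp, Complex.norm_natCast]
    have h1 : |inner ℝ ξ x| ^ k ≤ (‖ξ‖ * ‖x‖) ^ k := by
      gcongr
      exact abs_real_inner_le_norm ξ x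
    calc 1 / (k.factorial : ℝ) * (‖v x‖ * (|inner ℝ ξ x| ^ k * Real.exp (-‖x‖ ^ 2 / 2)))
        ≤ 1 / (k.factorial : ℝ) * (‖v x‖ * ((‖ξ‖ * ‖x‖) ^ k * Real.exp (-‖x‖ ^ 2 / 2))) := by gcongr
      _ = _ := by ring
  · simp only [fun x => (hsum x).tsum_eq]
    exact (Lp.memLp v).norm.integrable_mul (memLp_exp_mul_gauss ‖ξ‖)
  · have h2 := NormedSpace.expSeries_div_hasSum_exp (Complex.I * (inner ℝ ξ x : ℝ))
    rw [← Complex.exp_eq_exp_ℂ] at h2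
    refine ((h2.mul_right (gauss n x)).mul_left ((starRingEnd ℂ) (v x))).congr_fun fun k => ?_
    simp only [F]
    rw [mul_pow]
    ring

/-- The Fourier transform of the integrable function `conj v · gauss` vanishes. A smooth compactly
supported test function is the Fourier transform of a Schwartz function, so moving the transform
across the pairing makes `conj v · gauss` vanish almost everywhere. The Gaussian has no zeros. -/
theorem eq_zero_of_orthogonal_hermite {v : L2 n}
    (hv : ∀ φ ∈ hermiteSpan n, inner ℂ v (incl φ) = 0) : v = 0 := by
  let h : Rn n → ℂ := fun x => (starRingEnd ℂ) (v x) * gauss n x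
  have hh_int : Integrable h := (memLp_conj v).integrable_mul ((gauss n).memLp 2 volume)
  have hF : ∀ ξ, VectorFourier.fourierIntegral Real.fourierChar volume (innerₗ (Rn n)).flip h ξ = 0 := by
    intro ξ
    rw [VectorFourier.fourierIntegral, ← integral_conj_mul_exp_gauss_eq_zero hv (-(2 * Real.pi) • ξ)]
    congr 1
    ext x
    simp only [h, Circle.smul_def, Real.fourierChar_apply, smul_eq_mul, LinearMap.flip_apply,
      innerₗ_apply_apply, inner_smul_left]
    rw [mul_left_comm]
    congr 3
    simp
    ring
  have h0 : ∀ᵐ x, h x = 0 := by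
    refine ae_eq_zero_of_integral_contDiff_smul_eq_zero hh_int.locallyIntegrable fun g hg hgc => ?_
    have hgc' : HasCompactSupport fun x => (g x : ℂ) := hgc.comp_left (g := Complex.ofReal) (by simp)
    let φ : 𝓢(Rn n, ℂ) := hgc'.toSchwartzMap (Complex.ofRealCLM.contDiff.comp hg)
    have hφ : ∀ x, φ x = (g x : ℂ) := fun x => rfl
    let ψ : 𝓢(Rn n, ℂ) := 𝓕⁻ φ
    have hψ : ∀ x, VectorFourier.fourierIntegral Real.fourierChar volume (innerₗ (Rn n)) ψ x = φ x := by
      intro x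
      have h1 : (𝓕 ψ : 𝓢(Rn n, ℂ)) = φ := FourierTransform.fourier_fourierInv_eq φ
      rw [← h1]
      rfl
    have hflip := VectorFourier.integral_fourierIntegral_smul_eq_flip (μ := volume) (ν := volume)
      (e := Real.fourierChar) (L := innerₗ (Rn n)) (f := ψ) (g := h) Real.continuous_fourierChar
      (by exact continuous_inner) ψ.integrable hh_int
    simp only [hψ, hF, smul_zero, integral_zero, hφ] at hflip
    simpa [Complex.real_smul] using hflip
  refine Lp.ext ?_
  filter_upwards [h0, Lp.coeFn_zero ℂ 2 (volume : Measure (Rn n))] with x hx hx0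
  rw [hx0]
  have hg : gauss n x ≠ 0 := by
    rw [gauss_apply]
    exact_mod_cast (Real.exp_pos _).ne'
  rcases mul_eq_zero.mp hx with h1 | h1
  · simpa using h1
  · exact absurd h1 hg

/-- The harmonic oscillator has dense range on Schwartz functions. -/
theorem eq_zero_of_orthogonal_harm (hn : 1 ≤ n) {v : L2 n}
    (hv : ∀ φ, inner ℂ v (incl (weylS (harm n) φ)) = 0) : v = 0 := by
  refine eq_zero_of_orthogonal_hermite fun φ hφ => ?_
  obtain ⟨ψ, rfl⟩ := exists_weylS_harm_eq hn hφ
  exact hv ψ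

/-- The harmonic oscillator on Schwartz functions, with values in `L²`. -/
def harmIncl (n : ℕ) : 𝓢(Rn n, ℂ) →ₗ[ℂ] L2 n :=
  (incl.comp (quadOp (symMat (harm n)))).toLinearMap

theorem harmIncl_apply (φ : 𝓢(Rn n, ℂ)) : harmIncl n φ = incl (weylS (harm n) φ) := by
  rw [weylS_eq_quadOp]
  rfl

theorem denseRange_harmIncl (hn : 1 ≤ n) : DenseRange (harmIncl n) := by
  have hK : (LinearMap.range (harmIncl n)).topologicalClosure = ⊤ := by
    rw [Submodule.topologicalClosure_eq_top_iff, Submodule.eq_bot_iff]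
    intro v hv
    refine eq_zero_of_orthogonal_harm hn fun φ => ?_
    rw [← harmIncl_apply]
    exact (Submodule.mem_orthogonal' _ v).mp hv _ ⟨φ, rfl⟩
  intro f
  have h : f ∈ (LinearMap.range (harmIncl n)).topologicalClosure := by
    rw [hK]
    trivial
  rwa [← SetLike.mem_coe, Submodule.topologicalClosure_coe, LinearMap.coe_range] at h

/-! ### Transposition -/

/-- The effect of the map `(x, ξ) ↦ (x, t ξ)` on the coordinates. -/
def xiScale (t : ℝ) : Idx n → ℝ := Sum.elim (fun _ => 1) (fun _ => t)

/-- The sign in the transposition of a position or momentum operator. -/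
abbrev trSign : Idx n → ℝ := xiScale (-1)

theorem integral_gen_mul (i : Idx n) (φ ψ : 𝓢(Rn n, ℂ)) :
    ∫ x, gen i φ x * ψ x = (trSign i : ℂ) * ∫ x, φ x * gen i ψ x := by
  rcases i with j | j
  · simp only [trSign, xiScale, gen, Sum.elim_inl, mulX_apply, Complex.ofReal_one, one_mul]
    congr 1
    ext x
    ring
  · simp only [trSign, xiScale, gen, Sum.elim_inr]
    rw [integral_opD_mul]
    simp

/-- `A'` is the transpose of `A` on Schwartz functions. -/
def IsTranspose (A A' : 𝓢(Rn n, ℂ) →L[ℂ] 𝓢(Rn n, ℂ)) : Prop :=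
  ∀ φ ψ : 𝓢(Rn n, ℂ), ∫ x, A φ x * ψ x = ∫ x, φ x * A' ψ x

theorem isTranspose_gen (i : Idx n) : IsTranspose ((trSign i : ℂ) • gen i) (gen i) := by
  intro φ ψ
  have h : ((trSign i : ℂ) * trSign i) = 1 := by
    rcases i with j | j <;> simp [trSign, xiScale]
  simp only [smul_apply, smul_eq_mul, mul_assoc, integral_const_mul, integral_gen_mul]
  rw [← mul_assoc, h, one_mul]

theorem IsTranspose.comp {A A' B B' : 𝓢(Rn n, ℂ) →L[ℂ] 𝓢(Rn n, ℂ)} (hA : IsTranspose A A')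
    (hB : IsTranspose B B') : IsTranspose (A.comp B) (B'.comp A') := fun φ ψ => by
  simp only [ContinuousLinearMap.comp_apply]
  rw [hA, hB]

theorem integrable_mul (φ ψ : 𝓢(Rn n, ℂ)) : Integrable fun x => φ x * ψ x :=
  (φ.memLp 2 volume).integrable_mul (ψ.memLp 2 volume)

theorem IsTranspose.sum {ι : Type*} (s : Finset ι) {A A' : ι → 𝓢(Rn n, ℂ) →L[ℂ] 𝓢(Rn n, ℂ)}
    (h : ∀ i, IsTranspose (A i) (A' i)) : IsTranspose (∑ i ∈ s, A i) (∑ i ∈ s, A' i) := by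
  intro φ ψ
  simp only [sum_apply, Finset.sum_mul, Finset.mul_sum]
  rw [integral_finsetSum _ fun i _ => integrable_mul _ _,
    integral_finsetSum _ fun i _ => integrable_mul _ _]
  exact Finset.sum_congr rfl fun i _ => h i φ ψ

theorem IsTranspose.smul {A A' : 𝓢(Rn n, ℂ) →L[ℂ] 𝓢(Rn n, ℂ)} (h : IsTranspose A A') (c : ℂ) :
    IsTranspose (c • A) (c • A') := by
  intro φ ψ
  simp only [smul_apply, smul_eq_mul, mul_assoc, mul_left_comm _ c, integral_const_mul, h φ ψ]

theorem symMat_scaleXi (q : Symbol n) (t : ℝ) (i k : Idx n) :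
    symMat (scaleXi q t) i k = symMat q i k * (xiScale t i * xiScale t k : ℝ) := by
  have h : ∀ m : Idx n, LinearMap.prodMap (LinearMap.id : Rn n →ₗ[ℝ] Rn n) (t • LinearMap.id)
      (phaseVec m) = xiScale t m • phaseVec m := by
    rintro (j | j) <;> simp [phaseVec, xiScale]
  have h2 : QuadraticMap.polar (scaleXi q t) (phaseVec i) (phaseVec k) =
      QuadraticMap.polar q (xiScale t i • phaseVec i) (xiScale t k • phaseVec k) := by
    rw [← h, ← h]
    simp only [QuadraticMap.polar, scaleXi, QuadraticMap.comp_apply, map_add]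
  simp only [symMat, Matrix.of_apply, h2, QuadraticMap.polar_smul_left, QuadraticMap.polar_smul_right,
    Complex.real_smul]
  push_cast
  ring

/-- Transposition reverses products and changes the sign of momenta. The coefficient matrix is
symmetric, so only the reflection `ξ ↦ -ξ` remains, in agreement with the duality defining
`IsWeylImage`. -/
theorem isTranspose_quadOp (q : Symbol n) :
    IsTranspose (quadOp (symMat q)) (quadOp (symMat (scaleXi q (-1)))) := by
  have h : quadOp (symMat q) =
      ∑ i, ∑ k, symMat (scaleXi q (-1)) i k • ((trSign k : ℂ) • gen k).comp ((trSign i : ℂ) • gen i) := by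
    have hs : ∀ i : Idx n, (trSign i : ℂ) * trSign i = 1 := by
      rintro (j | j) <;> simp [trSign, xiScale]
    rw [quadOp, Finset.sum_comm]
    refine Finset.sum_congr rfl fun i _ => Finset.sum_congr rfl fun k _ => ?_
    ext1 φ
    simp only [smul_apply, ContinuousLinearMap.comp_apply, map_smul, smul_smul]
    rw [symMat_scaleXi, symMat_comm]
    congr 1
    push_cast
    linear_combination (-(symMat q i k)) * (hs i) - (symMat q i k) * (trSign i * trSign i) * hs k
  rw [h, quadOp]
  exact IsTranspose.sum _ fun i => IsTranspose.sum _ fun k =>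
    ((isTranspose_gen k).comp (isTranspose_gen i)).smul _

/-! ### Extension of operators through the harmonic oscillator -/

/-- The operator `A` is bounded relatively to the harmonic oscillator. -/
def IsRelBdd (A : 𝓢(Rn n, ℂ) →L[ℂ] 𝓢(Rn n, ℂ)) : Prop :=
  ∃ C, ∀ u, ‖incl (A u)‖ ≤ C * ‖harmIncl n u‖

/-- The closure of `A H⁻¹`, where `H` is the harmonic oscillator. -/
def overHarm (A : 𝓢(Rn n, ℂ) →L[ℂ] 𝓢(Rn n, ℂ)) : L2 n →L[ℂ] L2 n :=
  LinearMap.extendOfNorm (incl.comp A).toLinearMap (harmIncl n)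

theorem overHarm_harmIncl (hn : 1 ≤ n) {A : 𝓢(Rn n, ℂ) →L[ℂ] 𝓢(Rn n, ℂ)} (hA : IsRelBdd A)
    (u : 𝓢(Rn n, ℂ)) : overHarm A (harmIncl n u) = incl (A u) :=
  LinearMap.extendOfNorm_eq (f := (incl.comp A).toLinearMap) (denseRange_harmIncl hn) hA u

theorem isRelBdd_id (hn : 1 ≤ n) : IsRelBdd (ContinuousLinearMap.id ℂ 𝓢(Rn n, ℂ)) := by
  obtain ⟨C, -, h⟩ := exists_apriori hn (harm_re_pos (n := n))
  exact ⟨C, fun u => by rw [harmIncl_apply]; exact (h u).1⟩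

theorem isRelBdd_gen (hn : 1 ≤ n) (i : Idx n) : IsRelBdd (gen i) := by
  obtain ⟨C, -, h⟩ := exists_apriori hn (harm_re_pos (n := n))
  exact ⟨C, fun u => by rw [harmIncl_apply]; exact (h u).2.1 i⟩

theorem isRelBdd_gen_gen (hn : 1 ≤ n) (i k : Idx n) : IsRelBdd ((gen i).comp (gen k)) := by
  obtain ⟨C, -, h⟩ := exists_apriori hn (harm_re_pos (n := n))
  exact ⟨C, fun u => by rw [harmIncl_apply]; exact (h u).2.2 i k⟩

theorem IsRelBdd.smul {A : 𝓢(Rn n, ℂ) →L[ℂ] 𝓢(Rn n, ℂ)} (hA : IsRelBdd A) (c : ℂ) :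
    IsRelBdd (c • A) := by
  obtain ⟨C, h⟩ := hA
  refine ⟨‖c‖ * C, fun u => ?_⟩
  rw [smul_apply, map_smul, norm_smul, mul_assoc]
  exact mul_le_mul_of_nonneg_left (h u) (norm_nonneg c)

theorem isRelBdd_quadOp (hn : 1 ≤ n) (q : Symbol n) : IsRelBdd (quadOp (symMat q)) := by
  obtain ⟨C, -, h⟩ := exists_relative_bound hn (harm_re_pos (n := n)) q
  exact ⟨C, fun u => by rw [harmIncl_apply, ← weylS_eq_quadOp]; exact h u⟩

/-- The inverse of the harmonic oscillator. -/
def harmInv (n : ℕ) : L2 n →L[ℂ] L2 n := overHarm (ContinuousLinearMap.id ℂ 𝓢(Rn n, ℂ))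

theorem harmInv_harmIncl (hn : 1 ≤ n) (u : 𝓢(Rn n, ℂ)) : harmInv n (harmIncl n u) = incl u :=
  overHarm_harmIncl hn (isRelBdd_id hn) u

/-- The closure of `q^w H⁻¹`, where `H` is the harmonic oscillator. -/
def weylInv (q : Symbol n) : L2 n →L[ℂ] L2 n := overHarm (quadOp (symMat q))

theorem weylInv_harmIncl (hn : 1 ≤ n) (q : Symbol n) (u : 𝓢(Rn n, ℂ)) :
    weylInv q (harmIncl n u) = incl (weylS q u) := by
  rw [weylS_eq_quadOp]
  exact overHarm_harmIncl hn (isRelBdd_quadOp hn q) u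

theorem weylInv_harm (hn : 1 ≤ n) : weylInv (harm n) = 1 := by
  ext1 f
  refine (denseRange_harmIncl hn).induction_on f (isClosed_eq (by fun_prop) (by fun_prop)) fun u => ?_
  rw [weylInv_harmIncl hn, harmIncl_apply]
  rfl

theorem weylInv_add (hn : 1 ≤ n) (p q : Symbol n) : weylInv (p + q) = weylInv p + weylInv q := by
  ext1 f
  refine (denseRange_harmIncl hn).induction_on f (isClosed_eq (by fun_prop) (by fun_prop)) fun u => ?_
  rw [add_apply, weylInv_harmIncl hn, weylInv_harmIncl hn, weylInv_harmIncl hn, weylS_add, map_add]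

theorem weylInv_smul (hn : 1 ≤ n) (c : ℂ) (q : Symbol n) : weylInv (c • q) = c • weylInv q := by
  ext1 f
  refine (denseRange_harmIncl hn).induction_on f (isClosed_eq (by fun_prop) (by fun_prop)) fun u => ?_
  rw [smul_apply, weylInv_harmIncl hn, weylInv_harmIncl hn, weylS_smul, map_smul]

theorem continuous_pairing (φ : 𝓢(Rn n, ℂ)) :
    Continuous fun u : L2 n => (u : 𝓢'(Rn n, ℂ)) φ := by
  have h : Continuous fun T : 𝓢'(Rn n, ℂ) => T φ :=
    (PointwiseConvergenceCLM.evalCLM (RingHom.id ℂ) ℂ φ).continuous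
  exact h.comp (Lp.toTemperedDistributionCLM ℂ (volume : Measure (Rn n)) 2).continuous

theorem pairing_incl (ψ φ : 𝓢(Rn n, ℂ)) :
    ((incl ψ : L2 n) : 𝓢'(Rn n, ℂ)) φ = ∫ x, ψ x * φ x := by
  rw [Lp.toTemperedDistribution_apply]
  refine integral_congr_ae ?_
  filter_upwards [ψ.coeFn_toLp 2 volume] with x hx
  have : (incl ψ : L2 n) x = ψ x := hx
  rw [this, smul_eq_mul, mul_comm]

/-- Identifies the abstract extension `overHarm A f` with `A` applied to `H⁻¹f` in the sense of
distributions: both sides are continuous in `f` and agree on the dense range of `H`. -/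
theorem pairing_overHarm (hn : 1 ≤ n) {A A' : 𝓢(Rn n, ℂ) →L[ℂ] 𝓢(Rn n, ℂ)} (hA : IsRelBdd A)
    (h : IsTranspose A A') (f : L2 n) (φ : 𝓢(Rn n, ℂ)) :
    ((overHarm A f : L2 n) : 𝓢'(Rn n, ℂ)) φ = ((harmInv n f : L2 n) : 𝓢'(Rn n, ℂ)) (A' φ) := by
  refine (denseRange_harmIncl hn).induction_on f (isClosed_eq ?_ ?_) fun u => ?_
  · exact (continuous_pairing φ).comp (overHarm A).continuous
  · exact (continuous_pairing (A' φ)).comp (harmInv n).continuous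
  · rw [overHarm_harmIncl hn hA, harmInv_harmIncl hn, pairing_incl, pairing_incl, h]

theorem isWeylImage_harmInv (hn : 1 ≤ n) (q : Symbol n) (f : L2 n) :
    IsWeylImage q (harmInv n f) (weylInv q f) := by
  rw [isWeylImage_iff]
  intro φ
  rw [weylS_eq_quadOp]
  exact pairing_overHarm hn (isRelBdd_quadOp hn q) (isTranspose_quadOp q) f φ

theorem exists_pairing_gen (hn : 1 ≤ n) (f : L2 n) (i : Idx n) : ∃ g : L2 n, ∀ φ,
    (g : 𝓢'(Rn n, ℂ)) φ = ((harmInv n f : L2 n) : 𝓢'(Rn n, ℂ)) (gen i φ) :=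
  ⟨_, pairing_overHarm hn ((isRelBdd_gen hn i).smul _) (isTranspose_gen i) f⟩

theorem exists_pairing_gen_gen (hn : 1 ≤ n) (f : L2 n) (i k : Idx n) : ∃ g : L2 n, ∀ φ,
    (g : 𝓢'(Rn n, ℂ)) φ = ((harmInv n f : L2 n) : 𝓢'(Rn n, ℂ)) (gen i (gen k φ)) := by
  have h := (isTranspose_gen k).comp (isTranspose_gen i)
  refine ⟨_, pairing_overHarm hn (A := ((trSign k : ℂ) * trSign i) • (gen k).comp (gen i))
    ((isRelBdd_gen_gen hn k i).smul _) (A' := (gen i).comp (gen k)) ?_ f⟩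
  convert h using 1
  ext1 φ
  simp only [smul_apply, ContinuousLinearMap.comp_apply, map_smul, smul_smul]
  rw [mul_comm]

/-- Every product of at most two positions and momenta is bounded relatively to `H`, so it maps
`H⁻¹f` into `L²`. -/
theorem harmInv_mem_spaceB (hn : 1 ≤ n) (f : L2 n) : harmInv n f ∈ spaceB n := by
  intro k l hkl a b
  set T : 𝓢'(Rn n, ℂ) := ((harmInv n f : L2 n) : 𝓢'(Rn n, ℂ)) with hT
  have hmul : ∀ j (φ : 𝓢(Rn n, ℂ)), SchwartzMap.smulLeftCLM ℂ (fun x : Rn n => (x j : ℂ)) φ =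
    gen (Sum.inl j) φ := fun _ _ => rfl
  have hD : ∀ j (φ : 𝓢(Rn n, ℂ)), (∂_{stdVec j} φ : 𝓢(Rn n, ℂ)) =
      Complex.I • gen (Sum.inr j) φ := fun j φ => by
    simp [gen, opD_apply, smul_smul]
  -- The constant `c` will be `(-1)^l`: transposing each `D_j` changes its sign.
  have key : ∀ (c : ℂ) (A : 𝓢(Rn n, ℂ) → 𝓢(Rn n, ℂ)),
      (∃ g : L2 n, ∀ φ, (g : 𝓢'(Rn n, ℂ)) φ = T (A φ)) →
      (∀ φ, monomialOp a b T φ = c * T (A φ)) → monomialOp a b T ∈ l2Dist n := by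
    rintro c A ⟨g, hg⟩ h
    have : monomialOp a b T = c • (g : 𝓢'(Rn n, ℂ)) := by
      ext φ
      rw [h, smul_apply, hg, smul_eq_mul]
    rw [this]
    exact (l2Dist n).smul_mem _ ⟨g, rfl⟩
  have hI : ∀ c : ℂ, Complex.I * (Complex.I * c) = -c := fun c => by
    rw [← mul_assoc, Complex.I_mul_I, neg_one_mul]
  have hcases : (k = 0 ∧ l = 0) ∨ (k = 1 ∧ l = 0) ∨ (k = 2 ∧ l = 0) ∨ (k = 0 ∧ l = 1) ∨
      (k = 0 ∧ l = 2) ∨ (k = 1 ∧ l = 1) := by omega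
  rcases hcases with ⟨rfl, rfl⟩ | ⟨rfl, rfl⟩ | ⟨rfl, rfl⟩ | ⟨rfl, rfl⟩ | ⟨rfl, rfl⟩ | ⟨rfl, rfl⟩
  · refine key 1 id ⟨_, fun φ => rfl⟩ fun φ => ?_
    simp [monomialOp, -Lp.toTemperedDistribution_apply]
  · refine key 1 _ (exists_pairing_gen hn f (Sum.inl (a 0))) fun φ => ?_
    simp [monomialOp, ← hmul, -Lp.toTemperedDistribution_apply]
  · refine key 1 _ (exists_pairing_gen_gen hn f (Sum.inl (a 0)) (Sum.inl (a 1))) fun φ => ?_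
    have hg : (fun x : Rn n => ∏ i, (x (a i) : ℂ)) =
        (fun x : Rn n => (x (a 0) : ℂ)) * (fun x : Rn n => (x (a 1) : ℂ)) := by
      ext x
      simp
    rw [← hmul, ← hmul, SchwartzMap.smulLeftCLM_smulLeftCLM_apply (coord_growth _) (coord_growth _),
      ← hg]
    simp [monomialOp, -Lp.toTemperedDistribution_apply]
  · refine key (-1) _ (exists_pairing_gen hn f (Sum.inr (b 0))) fun φ => ?_
    simp [monomialOp, hD, -Lp.toTemperedDistribution_apply]
    exact hI _
  · refine key 1 _ (exists_pairing_gen_gen hn f (Sum.inr (b 1)) (Sum.inr (b 0))) fun φ => ?_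
    simp [monomialOp, hD, LineDeriv.iteratedLineDerivOp_succ_left, Fin.tail, -Lp.toTemperedDistribution_apply]
    rw [hI, neg_neg]
  · refine key (-1) _ (exists_pairing_gen_gen hn f (Sum.inr (b 0)) (Sum.inl (a 0))) fun φ => ?_
    simp [monomialOp, hD, ← hmul, -Lp.toTemperedDistribution_apply]
    exact hI _

theorem harmInv_mem_domain (hn : 1 ≤ n) (q : Symbol n) (f : L2 n) :
    harmInv n f ∈ (weylOp q).domain :=
  harmInv_mem_spaceB hn f

theorem weylOp_harmInv (hn : 1 ≤ n) (q : Symbol n) (f : L2 n) (h : harmInv n f ∈ (weylOp q).domain) :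
    weylOp q ⟨harmInv n f, h⟩ = weylInv q f :=
  (weylOp_isWeylImage q ⟨harmInv n f, h⟩).unique (isWeylImage_harmInv hn q f)

/-- `H` is its own transpose, so the conjugate of `w` is orthogonal to the range of `H` on Schwartz
functions, which is dense. -/
theorem eq_zero_of_isWeylImage_harm (hn : 1 ≤ n) {w : L2 n} (hw : IsWeylImage (harm n) w 0) :
    w = 0 := by
  rw [isWeylImage_iff] at hw
  have hs : symMat (scaleXi (harm n) (-1)) = symMat (harm n) := by
    ext i k
    rw [symMat_scaleXi, symMat_harm, Matrix.one_apply]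
    split_ifs with h
    · subst h
      rcases i with j | j <;> simp [xiScale]
    · simp
  let v : L2 n := (memLp_conj w).toLp
  have hv : v = 0 := by
    refine eq_zero_of_orthogonal_harm hn fun φ => ?_
    have h0 : ((0 : L2 n) : 𝓢'(Rn n, ℂ)) = 0 :=
      map_zero (Lp.toTemperedDistributionCLM ℂ (volume : Measure (Rn n)) 2)
    have h := hw φ
    rw [weylS_eq_quadOp, hs, ← weylS_eq_quadOp, h0, zero_apply, Lp.toTemperedDistribution_apply] at h
    rw [inner_incl_eq, h]
    refine integral_congr_ae ?_
    filter_upwards [(memLp_conj w).coeFn_toLp] with x hx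
    rw [hx]
    simp [mul_comm]
  refine Lp.ext ?_
  filter_upwards [(memLp_conj w).coeFn_toLp, Lp.coeFn_zero ℂ 2 (volume : Measure (Rn n))] with x hx hx0
  have h1 : v x = 0 := by
    rw [hv, hx0]
    rfl
  rw [hx0]
  have h2 : (starRingEnd ℂ) (w x) = 0 := hx.symm.trans h1
  simpa using h2

/-- The space `B` is the range of the inverse of the harmonic oscillator. -/
theorem exists_harmInv_eq (hn : 1 ≤ n) {u : L2 n} (hu : u ∈ spaceB n) : ∃ f, harmInv n f = u := by
  let f := weylOp (harm n) ⟨u, hu⟩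
  have h1 := weylOp_isWeylImage (harm n) ⟨u, hu⟩
  have h2 := isWeylImage_harmInv hn (harm n) f
  rw [weylInv_harm hn] at h2
  have h3 := h1.add (h2.smul (-1))
  refine ⟨f, ?_⟩
  have h4 : u + (-1 : ℂ) • harmInv n f = 0 := by
    refine eq_zero_of_isWeylImage_harm hn ?_
    convert h3 using 1
    simp [f]
  rw [neg_one_smul, ← sub_eq_add_neg, sub_eq_zero] at h4
  exact h4.symm

/-! ### The method of continuity -/

section Continuity

variable {E : Type*} [NormedAddCommGroup E] [NormedSpace ℂ E] [CompleteSpace E]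

theorem isUnit_of_norm_sub_lt {T S : E →L[ℂ] E} {c : ℝ} (hc : 0 < c) (hT : IsUnit T)
    (hb : ∀ x, c * ‖x‖ ≤ ‖T x‖) (h : ‖S - T‖ < c) : IsUnit S := by
  obtain ⟨U, rfl⟩ := hT
  have hU : ‖(↑U⁻¹ : E →L[ℂ] E)‖ ≤ c⁻¹ := by
    refine ContinuousLinearMap.opNorm_le_bound _ (by positivity) fun x => ?_
    have h1 := hb ((↑U⁻¹ : E →L[ℂ] E) x)
    have h2 : (U : E →L[ℂ] E) ((↑U⁻¹ : E →L[ℂ] E) x) = x := by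
      rw [← mul_apply_eq_comp, Units.mul_inv]
      rfl
    rw [h2] at h1
    rw [inv_mul_eq_div, le_div_iff₀ hc, mul_comm]
    exact h1
  have h3 : ‖-((↑U⁻¹ : E →L[ℂ] E) * (S - U))‖ < 1 := by
    rw [norm_neg]
    calc ‖(↑U⁻¹ : E →L[ℂ] E) * (S - U)‖ ≤ ‖(↑U⁻¹ : E →L[ℂ] E)‖ * ‖S - U‖ := norm_mul_le _ _
      _ ≤ c⁻¹ * ‖S - U‖ := by gcongr
      _ < c⁻¹ * c := by gcongr
      _ = 1 := inv_mul_cancel₀ hc.ne'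
  have h4 : S = U * (1 - -((↑U⁻¹ : E →L[ℂ] E) * (S - U))) := by
    rw [sub_neg_eq_add, mul_add, mul_one, ← mul_assoc, Units.mul_inv, one_mul, add_sub_cancel]
  rw [h4]
  exact U.isUnit.mul (isUnit_one_sub_of_norm_lt_one h3)

/-- Invertibility is an open condition, and pointwise lower bounds make it closed along the path;
the constant may depend on `s`. -/
theorem isUnit_of_continuous {T : ℝ → E →L[ℂ] E} (hT : Continuous T) (h0 : IsUnit (T 0))
    (hb : ∀ s ∈ Set.Icc (0 : ℝ) 1, ∃ c > 0, ∀ x, c * ‖x‖ ≤ ‖T s x‖) : IsUnit (T 1) := by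
  have hopen : IsOpen {s | IsUnit (T s)} := Units.isOpen.preimage hT
  have hclosed : IsClosed ({s | IsUnit (T s)} ∩ Set.Icc 0 1) := by
    refine isClosed_of_closure_subset fun s hs => ?_
    have hsI : s ∈ Set.Icc (0 : ℝ) 1 :=
      isClosed_Icc.closure_subset (closure_mono Set.inter_subset_right hs)
    refine ⟨?_, hsI⟩
    obtain ⟨c, hc, hcb⟩ := hb s hsI
    have hev : ∀ᶠ t in nhds s, ‖T t - T s‖ < c / 2 := by
      have := (hT.tendsto s).eventually (Metric.ball_mem_nhds (T s) (half_pos hc))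
      simpa [dist_eq_norm] using this
    obtain ⟨t, ht, htU, -⟩ := mem_closure_iff_nhds.mp hs _ hev
    -- The nearby invertible `T t` inherits the lower bound `c/2`, and `T s` lies within `c/2` of
    -- it.
    refine isUnit_of_norm_sub_lt (half_pos hc) htU (fun x => ?_) (S := T s) ?_
    · have h1 : T s x = T t x - (T t - T s) x := by simp
      have h2 := norm_sub_le (T t x) ((T t - T s) x)
      rw [← h1] at h2
      have h3 : ‖(T t - T s) x‖ ≤ c / 2 * ‖x‖ :=
        (ContinuousLinearMap.le_opNorm _ x).trans
          (mul_le_mul_of_nonneg_right (le_of_lt ht) (norm_nonneg x))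
      have h4 := hcb x
      linarith
    · rw [norm_sub_rev]
      exact ht
  exact hclosed.Icc_subset_of_forall_mem_nhdsWithin h0
    (fun s hs => mem_nhdsWithin_of_mem_nhds (hopen.mem_nhds hs.1)) (Set.right_mem_Icc.mpr zero_le_one)

end Continuity

/-! ### Resolvents of quadratic operators -/

theorem lower_bound_weylInv (hn : 1 ≤ n) {q : Symbol n} {ζ : ℂ} {c : ℝ}
    (h : ∀ u : 𝓢(Rn n, ℂ), c * ‖incl u‖ ≤ ‖incl (weylS q u - ζ • u)‖) (f : L2 n) :
    c * ‖harmInv n f‖ ≤ ‖weylInv q f - ζ • harmInv n f‖ := by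
  refine (denseRange_harmIncl hn).induction_on f (isClosed_le (by fun_prop) (by fun_prop)) fun u => ?_
  rw [harmInv_harmIncl hn, weylInv_harmIncl hn]
  simpa using h u

theorem exists_norm_le_weylInv (hn : 1 ≤ n) {p : Symbol n} (hpos : ∀ X, X ≠ 0 → 0 < (p X).re) :
    ∃ c > 0, ∀ f : L2 n, c * ‖f‖ ≤ ‖weylInv p f‖ := by
  obtain ⟨C, hC, h⟩ := exists_relative_bound hn hpos (harm n)
  refine ⟨C⁻¹, by positivity, fun f => ?_⟩
  refine (denseRange_harmIncl hn).induction_on f (isClosed_le (by fun_prop) (by fun_prop)) fun u => ?_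
  rw [weylInv_harmIncl hn, harmIncl_apply, inv_mul_eq_div, div_le_iff₀ hC, mul_comm]
  exact h u

/-- Every symbol on the segment from the harmonic oscillator to `p` has positive definite real part,
so the a priori estimate holds along the whole path. -/
theorem isUnit_weylInv_of_re_pos (hn : 1 ≤ n) {p : Symbol n} (hpos : ∀ X, X ≠ 0 → 0 < (p X).re) :
    IsUnit (weylInv p) := by
  let P : ℝ → Symbol n := fun s => ((1 - s : ℝ) : ℂ) • harm n + (s : ℂ) • p
  have hP : ∀ s, weylInv (P s) = ((1 - s : ℝ) : ℂ) • weylInv (harm n) + (s : ℂ) • weylInv p := by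
    intro s
    simp only [P, weylInv_add hn, weylInv_smul hn]
  have h := isUnit_of_continuous (T := fun s => weylInv (P s)) ?_ ?_ ?_
  · simpa [hP] using h
  · simp only [hP]
    fun_prop
  · simp [hP, weylInv_harm hn]
  · intro s hs
    refine exists_norm_le_weylInv hn fun X hX => ?_
    have h1 := harm_re_pos X hX
    have h2 := hpos X hX
    have h3 : (P s X).re = (1 - s) * (harm n X).re + s * (p X).re := by
      simp only [P, add_apply, smul_apply, smul_eq_mul, Complex.add_re,
        Complex.re_ofReal_mul]
    rw [h3]
    rcases hs.1.eq_or_lt with h0 | h0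
    · rw [← h0]
      linarith
    · have := mul_pos h0 h2
      have := mul_nonneg (sub_nonneg.mpr hs.2) h1.le
      linarith

theorem smul_symbol_apply (a : ℂ) (q : Symbol n) (X : Rn n × Rn n) : (a • q) X = a * q X := rfl

theorem isUnit_weylInv (hn : 1 ≤ n) {q : Symbol n} {a : ℂ}
    (hpos : ∀ X, X ≠ 0 → 0 < (a * q X).re) : IsUnit (weylInv q) ∧ a ≠ 0 := by
  have ha : a ≠ 0 := by
    rintro rfl
    have hX : ((stdVec ⟨0, hn⟩, 0) : Rn n × Rn n) ≠ 0 := fun h => by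
      have := congrArg (fun Y : Rn n × Rn n => Y.1 ⟨0, hn⟩) h
      simp [stdVec] at this
    simpa using hpos _ hX
  refine ⟨?_, ha⟩
  have h := isUnit_weylInv_of_re_pos hn (p := a • q) hpos
  rw [weylInv_smul hn] at h
  exact (isUnit_smul_iff (Units.mk0 a ha) (weylInv q)).mp h

/-- Continuity along `t ↦ q^w H⁻¹ - tζH⁻¹`, which is why the bound is required on the whole line. It
controls `H⁻¹f`; adding `tζH⁻¹f` back controls `q^w H⁻¹f`, and hence `f`. -/
theorem isUnit_weylInv_sub (hn : 1 ≤ n) {q : Symbol n} (hq : IsUnit (weylInv q)) {ζ : ℂ} {c : ℝ}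
    (hc : 0 < c) (h : ∀ t : ℝ, ∀ u : 𝓢(Rn n, ℂ), c * ‖incl u‖ ≤ ‖incl (weylS q u - (t * ζ) • u)‖) :
    IsUnit (weylInv q - ζ • harmInv n) := by
  obtain ⟨U, hU⟩ := hq
  have hC : ∀ f, ‖f‖ ≤ ‖(↑U⁻¹ : L2 n →L[ℂ] L2 n)‖ * ‖weylInv q f‖ := fun f => by
    have h1 := (↑U⁻¹ : L2 n →L[ℂ] L2 n).le_opNorm (weylInv q f)
    rwa [← hU, ← mul_apply_eq_comp, Units.inv_mul, one_apply_eq_self, hU] at h1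
  set C := ‖(↑U⁻¹ : L2 n →L[ℂ] L2 n)‖ + 1 with hCdef
  have hC0 : 0 < C := by positivity
  have hC : ∀ f, ‖f‖ ≤ C * ‖weylInv q f‖ := fun f =>
    (hC f).trans (mul_le_mul_of_nonneg_right (by linarith) (norm_nonneg _))
  have key := isUnit_of_continuous (T := fun t : ℝ => weylInv q - ((t : ℂ) * ζ) • harmInv n)
    (by fun_prop) (by simpa using ⟨U, hU⟩) ?_
  · simpa using key
  · intro t ht
    refine ⟨(C * (1 + ‖(t : ℂ) * ζ‖ / c))⁻¹, by positivity, fun f => ?_⟩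
    rw [inv_mul_eq_div, div_le_iff₀ (by positivity)]
    set g := (weylInv q - ((t : ℂ) * ζ) • harmInv n) f with hg
    have e1 : weylInv q f = g + ((t : ℂ) * ζ) • harmInv n f := by simp [hg]
    have e2 : c * ‖harmInv n f‖ ≤ ‖g‖ := lower_bound_weylInv hn (h t) f
    have e3 : ‖harmInv n f‖ ≤ ‖g‖ / c := by
      rw [le_div_iff₀ hc, mul_comm]
      exact e2
    have e4 : ‖weylInv q f‖ ≤ ‖g‖ + ‖(t : ℂ) * ζ‖ * (‖g‖ / c) := by
      rw [e1]
      refine (norm_add_le _ _).trans ?_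
      rw [norm_smul]
      gcongr
    calc ‖f‖ ≤ C * ‖weylInv q f‖ := hC f
      _ ≤ C * (‖g‖ + ‖(t : ℂ) * ζ‖ * (‖g‖ / c)) := by gcongr
      _ = ‖g‖ * (C * (1 + ‖(t : ℂ) * ζ‖ / c)) := by ring

/-- With `u = H⁻¹f`, the equation `(q^w - ζ)u = g` becomes one for bounded operators, and the lower
bound is exactly the norm bound of its solution operator. -/
theorem resolventNorm_le (hn : 1 ≤ n) {q : Symbol n} (hq : IsUnit (weylInv q)) {ζ : ℂ} {c : ℝ}
    (hc : 0 < c) (h : ∀ t : ℝ, ∀ u : 𝓢(Rn n, ℂ), c * ‖incl u‖ ≤ ‖incl (weylS q u - (t * ζ) • u)‖) :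
    resolventNorm (weylOp q) ζ ≤ ENNReal.ofReal c⁻¹ := by
  obtain ⟨U, hU⟩ := isUnit_weylInv_sub hn hq hc h
  have hUf : ∀ f, (U : L2 n →L[ℂ] L2 n) f = weylInv q f - ζ • harmInv n f := fun f => by
    rw [hU]
    simp
  let R : L2 n →L[ℂ] L2 n := (harmInv n).comp (↑U⁻¹ : L2 n →L[ℂ] L2 n)
  have hinv : ∀ f, (↑U⁻¹ : L2 n →L[ℂ] L2 n) ((U : L2 n →L[ℂ] L2 n) f) = f := fun f => by
    rw [← mul_apply_eq_comp, Units.inv_mul, one_apply_eq_self]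
  have hinv' : ∀ f, (U : L2 n →L[ℂ] L2 n) ((↑U⁻¹ : L2 n →L[ℂ] L2 n) f) = f := fun f => by
    rw [← mul_apply_eq_comp, Units.mul_inv, one_apply_eq_self]
  have hR : IsResolventAt (weylOp q) ζ R := by
    constructor
    · rintro ⟨u, hu⟩
      obtain ⟨f, rfl⟩ := exists_harmInv_eq hn hu
      rw [weylOp_harmInv hn, ← hUf]
      simp only [R, ContinuousLinearMap.comp_apply, hinv]
    · intro f
      refine ⟨⟨harmInv n ((↑U⁻¹ : L2 n →L[ℂ] L2 n) f), harmInv_mem_domain hn q _⟩, rfl, ?_⟩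
      rw [weylOp_harmInv hn, ← hUf, hinv']
  refine (iInf₂_le R hR).trans ?_
  rw [← ofReal_norm]
  refine ENNReal.ofReal_le_ofReal (ContinuousLinearMap.opNorm_le_bound _ (by positivity) fun f => ?_)
  have h1 := lower_bound_weylInv hn (by simpa using h 1) ((↑U⁻¹ : L2 n →L[ℂ] L2 n) f)
  rw [← hUf, hinv'] at h1
  rw [inv_mul_eq_div, le_div_iff₀ hc, mul_comm]
  exact h1

/-! ### Normality in the real case -/

theorem inner_weylInv (hn : 1 ≤ n) {p : Symbol n} (hre : ∀ X, (p X).im = 0) (f g : L2 n) :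
    inner ℂ (weylInv p f) (harmInv n g) = inner ℂ (harmInv n f) (weylInv p g) := by
  let b : Matrix (Idx n) (Idx n) ℝ := (symMat p).map Complex.re
  have hb : cpx b = symMat p := by
    ext i k
    have him : (symMat p i k).im = 0 := by
      simp [symMat, QuadraticMap.polar, hre]
    simpa [b] using Complex.ext (by simp) (by simp [him])
  have hsymm : ∀ i k, b i k = b k i := fun i k => by
    simp only [b, Matrix.map_apply]
    rw [symMat_comm]
  refine (denseRange_harmIncl hn).induction_on f
    (isClosed_eq (by fun_prop) (by fun_prop)) fun u => ?_
  refine (denseRange_harmIncl hn).induction_on g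
    (isClosed_eq (by fun_prop) (by fun_prop)) fun v => ?_
  rw [weylInv_harmIncl hn, weylInv_harmIncl hn, harmInv_harmIncl hn, harmInv_harmIncl hn,
    weylS_eq_quadOp, weylS_eq_quadOp, ← hb]
  exact inner_quadOp hsymm u v

/-- The graph is parametrized by all of `L²` through bounded operators, which removes the domain
from computations with adjoints and closedness. -/
theorem mem_graph_weylOp (hn : 1 ≤ n) (q : Symbol n) (x : L2 n × L2 n) :
    x ∈ (weylOp q).graph ↔ ∃ f, harmInv n f = x.1 ∧ weylInv q f = x.2 := by
  rw [LinearPMap.mem_graph_iff]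
  constructor
  · rintro ⟨⟨u, hu⟩, h1, h2⟩
    obtain ⟨f, rfl⟩ := exists_harmInv_eq hn hu
    exact ⟨f, h1, by rw [← h2, weylOp_harmInv hn]⟩
  · rintro ⟨f, h1, h2⟩
    exact ⟨⟨harmInv n f, harmInv_mem_domain hn q f⟩, h1, by rw [← h2, weylOp_harmInv hn]⟩

theorem dense_spaceB (hn : 1 ≤ n) : Dense (spaceB n : Set (L2 n)) := by
  refine denseRange_incl.mono ?_
  rintro _ ⟨u, rfl⟩
  rw [← harmInv_harmIncl hn]
  exact harmInv_mem_spaceB hn _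

/-- A complex multiple of a definite real quadratic form has a normal quantization. -/
theorem isNormalOp_weylOp (hn : 1 ≤ n) {q : Symbol n} {a : ℂ} (hpos : ∀ X, X ≠ 0 → 0 < (a * q X).re)
    (him : ∀ X, (a * q X).im = 0) : IsNormalOp (weylOp q) := by
  obtain ⟨hu, ha⟩ := isUnit_weylInv hn hpos
  have hbij := ContinuousLinearMap.isUnit_iff_bijective.mp hu
  have hsymm := inner_weylInv hn (p := a • q) him
  simp only [weylInv_smul hn, smul_apply, inner_smul_left, inner_smul_right] at hsymm
  have hca : (starRingEnd ℂ) a ≠ 0 := by simpa using ha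
  -- Since `(aq)^w` is symmetric, the adjoint of `q^w` is `d q^w` on the same domain; a scalar
  -- multiple of an operator commutes with it.
  set d := a / (starRingEnd ℂ) a with hd
  have hd0 : d ≠ 0 := div_ne_zero ha hca
  have hsymm' : ∀ f g, inner ℂ (weylInv q f) (harmInv n g) =
      inner ℂ (harmInv n f) (d • weylInv q g) := fun f g => by
    rw [inner_smul_right, hd, div_mul_eq_mul_div, eq_div_iff hca, mul_comm]
    exact hsymm f g
  have hdense : Dense ((weylOp q).domain : Set (L2 n)) := dense_spaceB hn
  have hadj : ∀ x : L2 n × L2 n, x ∈ (weylOp q)†.graph ↔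
      ∃ g, harmInv n g = x.1 ∧ d • weylInv q g = x.2 := by
    intro x
    rw [LinearPMap.adjoint_graph_eq_graph_adjoint hdense, Submodule.mem_adjoint_iff]
    constructor
    · intro h
      -- Surjectivity of `q^w` rules out a larger adjoint: a `g` with the required second component
      -- exists, and the difference of the first components is orthogonal to the whole range.
      obtain ⟨g, hg⟩ := hbij.2 (d⁻¹ • x.2)
      have hg' : d • weylInv q g = x.2 := by rw [hg, smul_inv_smul₀ hd0]
      refine ⟨g, ?_, hg'⟩
      obtain ⟨f, hf⟩ := hbij.2 (x.1 - harmInv n g)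
      have h1 := h _ _ ((mem_graph_weylOp hn q (_, _)).mpr ⟨f, rfl, rfl⟩)
      rw [← hg', ← hsymm', ← inner_sub_right, hf, inner_self_eq_zero, sub_eq_zero] at h1
      exact h1.symm
    · rintro ⟨g, h1, h2⟩ u v huv
      obtain ⟨f, rfl, rfl⟩ := (mem_graph_weylOp hn q (u, v)).mp huv
      rw [← h1, ← h2, hsymm', sub_self]
  refine ⟨hdense, ?_, fun u w => ?_⟩
  · obtain ⟨U, hU⟩ := hu
    -- As `q^w` has a bounded inverse, its graph is the flipped graph of a continuous map, hence
    -- closed.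
    have hgraph : ((weylOp q).graph : Set (L2 n × L2 n)) =
        {x | harmInv n ((↑U⁻¹ : L2 n →L[ℂ] L2 n) x.2) = x.1} := by
      ext x
      rw [SetLike.mem_coe, mem_graph_weylOp hn, Set.mem_ofPred_eq]
      constructor
      · rintro ⟨f, h1, h2⟩
        rw [← h1, ← h2, ← hU]
        congr 1
        rw [← mul_apply_eq_comp, Units.inv_mul, one_apply_eq_self]
      · intro h
        refine ⟨_, h, ?_⟩
        rw [← hU, ← mul_apply_eq_comp, Units.mul_inv, one_apply_eq_self]
    rw [LinearPMap.IsClosed, hgraph]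
    exact isClosed_eq (by fun_prop) (by fun_prop)
  · simp only [hadj, mem_graph_weylOp hn]
    constructor
    · rintro ⟨v, ⟨f, h1, h2⟩, g, h3, h4⟩
      exact ⟨d • v, ⟨f, h1, by rw [h2]⟩, d • g, by rw [map_smul, h3], by rw [map_smul, h4]⟩
    · rintro ⟨v, ⟨f, h1, h2⟩, g, h3, h4⟩
      exact ⟨d⁻¹ • v, ⟨f, h1, by rw [← h2, inv_smul_smul₀ hd0]⟩, d⁻¹ • g, by rw [map_smul, h3],
        by rw [map_smul, smul_inv_smul₀ hd0, h4]⟩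

/-! ### Dilations -/

/-- The dilation `φ ↦ φ(r ·)`. -/
def dil (r : ℝ) (hr : r ≠ 0) : 𝓢(Rn n, ℂ) →L[ℂ] 𝓢(Rn n, ℂ) :=
  compCLMOfContinuousLinearEquiv ℂ (ContinuousLinearEquiv.smulLeft (Units.mk0 r hr))

theorem dil_apply (r : ℝ) (hr : r ≠ 0) (φ : 𝓢(Rn n, ℂ)) (x : Rn n) : dil r hr φ x = φ (r • x) := rfl

theorem dil_gen (r : ℝ) (hr : r ≠ 0) (i : Idx n) (φ : 𝓢(Rn n, ℂ)) :
    dil r hr (gen i φ) = ((Sum.elim (fun _ => r) (fun _ => r⁻¹) i : ℝ) : ℂ) • gen i (dil r hr φ) := by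
  have hr' : (r : ℂ) ≠ 0 := by exact_mod_cast hr
  ext x
  rcases i with j | j
  · simp only [gen, Sum.elim_inl, dil_apply, smul_apply, mulX_apply, smul_eq_mul, PiLp.smul_apply]
    push_cast
    ring
  · have h : HasFDerivAt (dil r hr φ) ((fderiv ℝ φ (r • x)).comp (r • ContinuousLinearMap.id ℝ (Rn n))) x :=
      (φ.hasFDerivAt (r • x)).comp x ((hasFDerivAt_id x).const_smul r)
    simp only [gen, Sum.elim_inr, dil_apply, smul_apply, opD_apply, smul_eq_mul,
      SchwartzMap.lineDerivOp_apply_eq_fderiv, h.fderiv, ContinuousLinearMap.comp_apply, map_smul,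
      ContinuousLinearMap.id_apply, Complex.real_smul]
    push_cast
    field_simp

/-- The dilation sends `x` to `rx` and `D` to `r⁻¹D`. With `ξ` already scaled by `r²`, both
variables scale by `r`, and homogeneity yields `r²`. -/
theorem dil_weylS (r : ℝ) (hr : r ≠ 0) (q : Symbol n) (φ : 𝓢(Rn n, ℂ)) :
    dil r hr (weylS (scaleXi q (r ^ 2)) φ) = ((r ^ 2 : ℝ) : ℂ) • weylS q (dil r hr φ) := by
  have hr' : (r : ℂ) ≠ 0 := by exact_mod_cast hr
  simp only [weylS_eq_quadOp, quadOp_apply, map_sum, map_smul, Finset.smul_sum, dil_gen, smul_smul]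
  refine Finset.sum_congr rfl fun i _ => Finset.sum_congr rfl fun k _ => ?_
  congr 1
  rw [symMat_scaleXi]
  have h : ∀ m : Idx n, xiScale (r ^ 2) m * Sum.elim (fun _ => r) (fun _ => r⁻¹) m = r := by
    rintro (j | j)
    · simp [xiScale]
    · simp only [xiScale, Sum.elim_inr]
      field_simp
  have h1 := congrArg (fun t : ℝ => (t : ℂ)) (h i)
  have h2 := congrArg (fun t : ℝ => (t : ℂ)) (h k)
  push_cast at h1 h2 ⊢
  rw [mul_assoc, mul_mul_mul_comm, h1, h2]
  ring

theorem exists_norm_dil (r : ℝ) (hr : r ≠ 0) :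
    ∃ κ > 0, ∀ φ : 𝓢(Rn n, ℂ), ‖incl (dil r hr φ)‖ = κ * ‖incl φ‖ := by
  refine ⟨√|(r ^ Module.finrank ℝ (Rn n))⁻¹|, by positivity, fun φ => ?_⟩
  have h : inner ℂ (incl (dil r hr φ)) (incl (dil r hr φ)) =
      |(r ^ Module.finrank ℝ (Rn n))⁻¹| • inner ℂ (incl φ) (incl φ) := by
    rw [inner_incl, inner_incl, ← Measure.integral_comp_smul]
    rfl
  rw [@norm_eq_sqrt_re_inner ℂ, @norm_eq_sqrt_re_inner ℂ _ _ _ _ (incl φ), h,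
    ← Real.sqrt_mul (abs_nonneg _)]
  simp only [RCLike.re_eq_complex_re, Complex.smul_re, smul_eq_mul]

/-- Semiclassical rescaling of a lower bound on a line. -/
theorem lower_bound_scaleXi {q : Symbol n} {z : ℂ} {c : ℝ}
    (h : ∀ η : ℝ, ∀ u : 𝓢(Rn n, ℂ), c * ‖incl u‖ ≤ ‖incl (weylS q u - (η * z) • u)‖)
    {t : ℝ} (ht : 0 < t) (η : ℝ) (u : 𝓢(Rn n, ℂ)) :
    c * t * ‖incl u‖ ≤ ‖incl (weylS (scaleXi q t) u - (η * z) • u)‖ := by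
  have hr : √t ≠ 0 := (Real.sqrt_pos.mpr ht).ne'
  have ht' : (t : ℂ) ≠ 0 := by exact_mod_cast ht.ne'
  obtain ⟨κ, hκ, hnorm⟩ := exists_norm_dil (n := n) (√t) hr
  have h1 : dil (√t) hr (weylS (scaleXi q t) u - (η * z) • u) =
      (t : ℂ) • (weylS q (dil (√t) hr u) - (((η / t : ℝ) : ℂ) * z) • dil (√t) hr u) := by
    have h2 := dil_weylS (√t) hr q u
    rw [Real.sq_sqrt ht.le] at h2
    rw [map_sub, map_smul, h2, smul_sub, smul_smul]
    congr 2
    push_cast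
    field_simp
  -- Rescaling moves the spectral parameter from `ηz` to `(η/t)z`, still on the line `ℝz`. The norm
  -- factor `κ` of the dilation cancels.
  have h3 := h (η / t) (dil (√t) hr u)
  have h4 := hnorm (weylS (scaleXi q t) u - (η * z) • u)
  rw [h1, map_smul, norm_smul, Complex.norm_real, Real.norm_of_nonneg ht.le] at h4
  rw [hnorm] at h3
  have h5 := mul_le_mul_of_nonneg_left h3 ht.le
  rw [h4] at h5
  refine le_of_mul_le_mul_left ?_ hκ
  calc κ * (c * t * ‖incl u‖) = t * (c * (κ * ‖incl u‖)) := by ring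
    _ ≤ _ := h5

/-! ### The boundary of the numerical range -/

theorem exists_lower_bound_line (hn : 1 ≤ n) {q : Symbol n} (hell : IsElliptic q)
    (hq : ¬ IsNormalOp (weylOp q)) {z : ℂ} (hz : z ∈ frontier (numRange q)) (hz0 : z ≠ 0) :
    (∃ a : ℂ, ∀ X, X ≠ 0 → 0 < (a * q X).re) ∧ ∃ c > 0, ∀ η : ℝ, ∀ u : 𝓢(Rn n, ℂ),
      c * ‖incl u‖ ≤ ‖incl (weylS q u - (η * z) • u)‖ := by
  obtain ⟨s, hs, hsup⟩ := exists_support hell hz hz0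
  have hs2 : s * s = 1 := by rcases hs with rfl | rfl <;> norm_num
  have hs2' : (s : ℂ) * s = 1 := by exact_mod_cast hs2
  have hs0 : (s : ℂ) ≠ 0 := fun h => by simp [h] at hs2'
  -- Multiplication by `b` sends `ηz` to `isη`, so the line `ℝz` becomes the imaginary axis.
  set b : ℂ := s * (Complex.I / z) with hb
  have hb0 : b ≠ 0 := mul_ne_zero hs0 (div_ne_zero Complex.I_ne_zero hz0)
  have hpell : IsElliptic (b • q) := fun X hX => hell X (by
    rcases mul_eq_zero.mp hX with h | h
    · exact absurd h hb0
    · exact h)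
  have hpre : ∀ X, 0 ≤ ((b • q) X).re := hsup
  obtain ⟨M, s', -, -, hrot⟩ := exists_rotation hpell hpre
  -- The factor `M - is'` turns the positive combination of real and imaginary parts into a real
  -- part.
  have hre : ∀ X, (((M : ℂ) - s' * Complex.I) * b * q X).re =
      M * ((b • q) X).re + s' * ((b • q) X).im := fun X => by
    rw [mul_assoc, smul_symbol_apply]
    generalize b * q X = w
    simp
  refine ⟨⟨((M : ℂ) - s' * Complex.I) * b, fun X hX => by rw [hre]; exact hrot X hX⟩, ?_⟩
  have hre0 : ∃ X, ((b • q) X).re ≠ 0 := by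
    by_contra! h0
    -- If `Re(bq)` vanished, `-is'bq` would be real and positive definite.
    refine hq (isNormalOp_weylOp hn (a := -(s' * Complex.I) * b) (fun X hX => ?_) fun X => ?_)
    · have h1 := hrot X hX
      rw [h0, mul_zero, zero_add] at h1
      have h2 : (-(s' * Complex.I) * b * q X).re = s' * ((b • q) X).im := by
        rw [mul_assoc, smul_symbol_apply]
        generalize b * q X = w
        simp
      rwa [h2]
    · have h2 : (-(s' * Complex.I) * b * q X).im = -(s' * ((b • q) X).re) := by
        rw [mul_assoc, smul_symbol_apply]
        generalize b * q X = w
        simp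
      rw [h2, h0, mul_zero, neg_zero]
  obtain ⟨c, hc, h⟩ := exists_lower_bound hpell hpre hre0
  refine ⟨c / ‖b‖, by positivity, fun η u => ?_⟩
  have h1 := h (s * η) u
  have h2 : weylS (b • q) u - (Complex.I * ((s * η : ℝ) : ℂ)) • u = b • (weylS q u - (η * z) • u) := by
    rw [weylS_smul, smul_sub, smul_smul]
    congr 2
    rw [hb]
    push_cast
    field_simp
  rw [h2, map_smul, norm_smul] at h1
  rw [div_mul_eq_mul_div, div_le_iff₀ (norm_pos_iff.mpr hb0), mul_comm _ ‖b‖]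
  exact h1

end QuadWeyl

end

/-! ### Conclusion: the semiclassical and the uniform resolvent bounds -/

theorem mainTheorem8 (n : ℕ) (hn : 1 ≤ n) (q : QuadWeyl.Symbol n)
    (hell : QuadWeyl.IsElliptic q)
    (hnonnormal : ¬ QuadWeyl.IsNormalOp (QuadWeyl.weylOp q))
    (hrange : QuadWeyl.numRange q ≠ Set.univ) :
    (∀ z ∈ frontier (QuadWeyl.numRange q) \ {0},
      z ∉ QuadWeyl.scPseudospectrum 1 (QuadWeyl.scFamily q)) ∧
    (∀ z ∈ frontier (QuadWeyl.numRange q) \ {0}, ∃ C : ℝ, 0 < C ∧ ∀ η : ℝ,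
      QuadWeyl.resolventNorm (QuadWeyl.weylOp q) ((η : ℂ) * z) ≤ ENNReal.ofReal C) := by
  constructor
  · rintro z ⟨hz, hz0⟩ hmem
    obtain ⟨⟨a, ha⟩, c, hc, h⟩ := QuadWeyl.exists_lower_bound_line hn hell hnonnormal hz hz0
    -- The resolvent of the scaled operator is bounded by `c⁻¹t⁻¹`, so any constant above `c⁻¹`
    -- contradicts membership; `2c⁻¹` is taken.
    obtain ⟨t, ht, -, -, hle⟩ := hmem (2 * c⁻¹) (by positivity) 1 one_pos
    have hunit := (QuadWeyl.isUnit_weylInv hn (q := QuadWeyl.scaleXi q t) (a := a) fun X hX =>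
      ha (X.1, t • X.2) fun h0 => hX (Prod.ext (Prod.ext_iff.mp h0).1
        ((smul_eq_zero.mp (Prod.ext_iff.mp h0).2).resolve_left ht.ne'))).1
    have h1 := hle.trans (QuadWeyl.resolventNorm_le hn hunit (mul_pos hc ht)
      (QuadWeyl.lower_bound_scaleXi h ht))
    rw [ENNReal.ofReal_le_ofReal_iff (by positivity), Real.rpow_neg_one, mul_inv] at h1
    have h2 : 0 < c⁻¹ * t⁻¹ := by positivity
    linarith
  · rintro z ⟨hz, hz0⟩
    obtain ⟨⟨a, ha⟩, c, hc, h⟩ := QuadWeyl.exists_lower_bound_line hn hell hnonnormal hz hz0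
    refine ⟨c⁻¹, by positivity, fun η => ?_⟩
    refine QuadWeyl.resolventNorm_le hn (QuadWeyl.isUnit_weylInv hn ha).1 hc fun t u => ?_
    have h1 := h (t * η) u
    rwa [Complex.ofReal_mul, mul_assoc] at h1
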